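/- Let $d\in\mathbb N$. Let $\mathcal P_1(\mathbb R^d)$ be the set of Borel probability measures on $\mathbb R^d$ with finite first moment, with the $1$-Wasserstein metric $W_1$. Let $m_0\in\mathcal P_1(\mathbb R^d)$, let $U\subseteq\mathbb R^d$ be a linear subspace, and assume the following. * (State cost) $L:\mathbb R^d\times\mathcal P_1(\mathbb R^d)\to[0,+\infty]$ is either (a) finite everywhere and jointly uniformly continuous, or (b) independent of its second variable, with $\{L=+\infty\}$ open and $L$ continuous on $\{L<+\infty\}$. * (Control cost) $\psi:U\to[0,+\infty)$ is convex and lower semicontinuous with $\psi(0)=0$, and there are a function $\phi:[0,+\infty)\to[0,+\infty)$ that is strictly convex, continuously differentiable and superlinear at $+\infty$, with $\phi(0)=\phi'(0)=0$, and constants $K,C>0$ such that $\phi(2r)\le K(1+\phi(r))$ for all $r\ge0$ and $\phi(|x|)-1\le\psi(x)\le C(1+\phi(|x|))$ for all $x\in U$. (For example $\psi(u)=\frac1p|u|^p$ with $p>1$.) * (Drift) $\mathbf F:\mathbb R^d\times\mathcal P_1(\mathbb R^d)\to\mathbb R^d$ is jointly uniformly continuous and there are $C_F,C_F'\ge0$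 with $|\mathbf F(y,\mu)|\le C_F+C_F'\big(|y|+\int|z|\,d\mu(z)\big)$ for all $y,\mu$. Let $C([0,1];\mathcal P_1(\mathbb R^d))$ be the set of $W_1$-continuous curves, with uniform convergence in $W_1$, and $AC([0,1];\mathcal P_1(\mathbb R^d))$ the subset of absolutely continuous curves, i.e. those for which there is $g\in L^1(0,1)$ with $W_1(\mu_s,\mu_t)\le\int_s^t g(r)\,dr$ for all $0\le s\le t\le 1$. Let $\mathcal M(\mathbb R^d\times[0,1];U)$ be the set of finite $U$-valued Borel vector measures, with narrow convergence, i.e. convergence in duality with bounded continuous functions $f:\mathbb R^d\times[0,1]\to U$. Let $\mathcal C(m_0)$ be the set of $(\mu,\boldsymbol\nu)\in AC([0,1];\mathcal P_1(\mathbb R^d))\times\mathcal M(\mathbb R^d\times[0,1];U)$ with $\mu_0=m_0$ that solve $\partial_t\mu_t+\nabla\cdot(\mathbf F(\cdot,\mu_t)\mu_t+\boldsymbol\nu_t)=0$ in the sense that, for all $\varphi\in C_c^\infty(\mathbb R^d\times(0,1))$, $$\int_0^1\!\int_{\mathbb R^d}\big(\partial_t\varphi(y,t)+\nabla\varphi(y,t)\cdot\mathbf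 F(y,\mu_t)\big)\,d\mu_t(y)\,dt+\int_{\mathbb R^d\times[0,1]}\nabla\varphi(y,t)\cdot d\boldsymbol\nu(y,t)=0 .$$ For $\mu\in C([0,1];\mathcal P_1(\mathbb R^d))$ and $\boldsymbol\nu\in\mathcal M(\mathbb R^d\times[0,1];U)$ put $$\mathcal G(\mu,\boldsymbol\nu)=\Psi(\boldsymbol\nu|\mu)+\int_0^1\!\int_{\mathbb R^d}L(y,\mu_t)\,d\mu_t(y)\,dt,$$ where $\Psi(\boldsymbol\nu|\mu)=\int_0^1\int_{\mathbb R^d}\psi(\mathbf u(y,t))\,d\mu_t(y)\,dt$ if $d\boldsymbol\nu(y,t)=\mathbf u(y,t)\,d\mu_t(y)\,dt$ for some $\mathbf u\in L^1(d\mu_t\otimes dt;U)$, and $\Psi(\boldsymbol\nu|\mu)=+\infty$ otherwise. **Lemma.** Let $(\mu_n,\boldsymbol\nu_n)\in\mathcal C(m_0)$ for all $n\in\mathbb N$, with $\sup_n\mathcal G(\mu_n,\boldsymbol\nu_n)<+\infty$. Then there are $(\mu,\boldsymbol\nu)\in\mathcal C(m_0)$ and a subsequence along which $\mu_n\to\mu$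 in $C([0,1];\mathcal P_1(\mathbb R^d))$ and $\boldsymbol\nu_n\to\boldsymbol\nu$ narrowly in $\mathcal M(\mathbb R^d\times[0,1];U)$, and moreover $\mathcal G(\mu,\boldsymbol\nu)\le\sup_n\mathcal G(\mu_n,\boldsymbol\nu_n)$. -/

import Mathlib

open MeasureTheory Set Filter Topology
open scoped ENNReal RealInnerProductSpace

namespace MFC

noncomputable section

/-- The state space `ℝ^d` with its Euclidean norm. -/
abbrev E (d : ℕ) : Type := EuclideanSpace ℝ (Fin d)

/-- The space-time domain `ℝ^d × [0,1]`. -/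
abbrev X (d : ℕ) : Type := E d × unitInterval

/-- `𝒫₁(ℝ^d)`: Borel probability measures with finite first moment. -/
@[ext]
structure P1 (d : ℕ) where
  toMeasure : Measure (E d)
  isProbabilityMeasure : IsProbabilityMeasure toMeasure
  lintegral_enorm_lt_top : ∫⁻ x, ‖x‖ₑ ∂toMeasure < ∞

attribute [instance] P1.isProbabilityMeasure

/-- The first moment `M₁(μ) = ∫ |x| dμ(x)`. -/
def P1.moment {d : ℕ} (μ : P1 d) : ℝ := ∫ x, ‖x‖ ∂μ.toMeasure

/-- The `1`-Wasserstein distance: the infimum of `∫ |x - y| dπ(x,y)` over all transport plans `π`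
with marginals `μ` and `ν`. -/
def W1 {d : ℕ} (μ ν : P1 d) : ℝ≥0∞ :=
  ⨅ (π : Measure (E d × E d)) (_ : π.map Prod.fst = μ.toMeasure ∧ π.map Prod.snd = ν.toMeasure),
    ∫⁻ z, edist z.1 z.2 ∂π

/-- `C([0,1]; 𝒫₁(ℝ^d))`: curves that are continuous for `W₁`. -/
structure Curve (d : ℕ) where
  toFun : unitInterval → P1 d
  continuous_W1 : ∀ t, Tendsto (fun s => W1 (toFun s) (toFun t)) (𝓝 t) (𝓝 0)

instance (d : ℕ) : CoeFun (Curve d) (fun _ => unitInterval → P1 d) := ⟨Curve.toFun⟩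

/-- `μ ∈ AC([0,1]; 𝒫₁(ℝ^d))`: there is `g ∈ L¹(0,1)` with `W₁(μ_s, μ_t) ≤ ∫_s^t g(r) dr`
for all `s ≤ t`. -/
def Curve.IsAC {d : ℕ} (μ : Curve d) : Prop :=
  ∃ g : ℝ → ℝ, IntervalIntegrable g volume 0 1 ∧
    ∀ s t : unitInterval, s ≤ t → W1 (μ s) (μ t) ≤ ENNReal.ofReal (∫ r in (s : ℝ)..t, g r)

/-- The measure `dμ_t ⊗ dt` on `ℝ^d × [0,1]`, characterized by
`∫ f d(dμ_t ⊗ dt) = ∫₀¹ ∫ f(y,t) dμ_t(y) dt`. -/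
def Curve.spaceTime {d : ℕ} (μ : Curve d) : Measure (X d) :=
  (volume : Measure unitInterval).bind (fun t => (μ t).toMeasure.map (fun y => (y, t)))

/-- Integrals of Lipschitz functions against measures that are close in `W₁` are close. -/
theorem lintegral_le_add_of_W1_lt {d : ℕ} (μ ν : P1 d) {K : NNReal} {f : E d → NNReal}
    (hf : LipschitzWith K f) {ε : ℝ≥0∞} (h : W1 μ ν < ε) :
    ∫⁻ x, f x ∂μ.toMeasure ≤ ∫⁻ x, f x ∂ν.toMeasure + K * ε ∧
    ∫⁻ x, f x ∂ν.toMeasure ≤ ∫⁻ x, f x ∂μ.toMeasure + K * ε := by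
  have hm : Measurable (fun x => (f x : ℝ≥0∞)) := hf.continuous.measurable.coe_nnreal_ennreal
  have key : ∀ x y, (f x : ℝ≥0∞) ≤ f y + K * edist x y := fun x y => by
    have h1 := hf.edist_le_mul x y
    refine le_trans ?_ (add_le_add_right h1 _)
    rw [edist_nndist]
    norm_cast
    exact_mod_cast NNReal.coe_le_coe.1 (by
      have := le_abs_self ((f x : ℝ) - f y)
      push_cast
      rw [NNReal.dist_eq]; linarith)
  simp only [W1, iInf_lt_iff] at h
  obtain ⟨π, ⟨h1, h2⟩, hlt⟩ := h
  rw [← h1, ← h2, lintegral_map hm measurable_fst, lintegral_map hm measurable_snd]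
  constructor
  · calc _ ≤ ∫⁻ z, ((f z.2 : ℝ≥0∞) + K * edist z.1 z.2) ∂π := lintegral_mono fun z => key _ _
      _ = _ := by
        rw [lintegral_add_right _ (by fun_prop), lintegral_const_mul _ (by fun_prop)]
      _ ≤ _ := by gcongr
  · calc _ ≤ ∫⁻ z, ((f z.1 : ℝ≥0∞) + K * edist z.1 z.2) ∂π :=
          lintegral_mono fun z => by rw [edist_comm]; exact key _ _
      _ = _ := by
        rw [lintegral_add_right _ (by fun_prop), lintegral_const_mul _ (by fun_prop)]
      _ ≤ _ := by gcongr

theorem Curve.continuous_lintegral {d : ℕ} (μ : Curve d) {K : NNReal} {f : E d → NNReal}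
    (hf : LipschitzWith K f) (hb : ∀ x, f x ≤ 1) :
    Continuous fun t => ∫⁻ x, f x ∂(μ t).toMeasure := by
  rw [continuous_iff_continuousAt]
  intro t
  have hfin : ∫⁻ x, f x ∂(μ t).toMeasure ≠ ∞ := by
    refine ne_top_of_le_ne_top (b := 1) (by simp) ?_
    calc _ ≤ ∫⁻ x, 1 ∂(μ t).toMeasure := lintegral_mono fun x => ENNReal.coe_le_coe.2 (hb x)
      _ = 1 := by simp
  rw [ContinuousAt, ENNReal.tendsto_nhds hfin]
  intro ε hε
  have hpos : 0 < ε / (K + 1) := ENNReal.div_pos hε.ne' (by simp)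
  filter_upwards [(μ.continuous_W1 t).eventually (gt_mem_nhds hpos)] with s hs
  have h := lintegral_le_add_of_W1_lt (μ s) (μ t) hf hs
  have hK : (K : ℝ≥0∞) * (ε / (K + 1)) ≤ ε := by
    rw [← mul_div_assoc, mul_comm, mul_div_assoc]
    refine mul_le_of_le_one_right' (ENNReal.div_le_of_le_mul ?_)
    simp
  exact ⟨tsub_le_iff_right.2 (h.2.trans (by gcongr)), h.1.trans (by gcongr)⟩

theorem Curve.measurable_toMeasure {d : ℕ} (μ : Curve d) :
    Measurable fun t => (μ t).toMeasure := by
  refine Measurable.measure_of_isPiSystem_of_isProbabilityMeasure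
    (S := {s | IsClosed s}) (BorelSpace.measurable_eq.trans borel_eq_generateFrom_isClosed)
    isPiSystem_isClosed fun C hC => ?_
  have hpos : ∀ n : ℕ, 0 < 1 / ((n : ℝ) + 1) := fun n => Nat.one_div_pos_of_nat
  refine measurable_of_tendsto_metrizable (f := fun (n : ℕ) t =>
    ∫⁻ x, thickenedIndicator (hpos n) C x ∂(μ t).toMeasure) (fun n =>
      (μ.continuous_lintegral (lipschitzWith_thickenedIndicator (hpos n) C)
        (thickenedIndicator_le_one (hpos n) C)).measurable) ?_
  rw [tendsto_pi_nhds]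
  intro t
  exact tendsto_lintegral_thickenedIndicator_of_isClosed _ hC hpos
    tendsto_one_div_add_atTop_nhds_zero_nat

/-- `dμ_t ⊗ dt` integrates as it should; in particular `t ↦ μ_t` is measurable for every `W₁`-continuous
curve, so that the definition of `Curve.spaceTime` involves no junk value. -/
theorem Curve.lintegral_spaceTime {d : ℕ} (μ : Curve d) {f : X d → ℝ≥0∞} (hf : Measurable f) :
    ∫⁻ z, f z ∂μ.spaceTime = ∫⁻ t : unitInterval, ∫⁻ y, f (y, t) ∂(μ t).toMeasure := by
  have hm : Measurable fun t : unitInterval => (μ t).toMeasure.map (fun y => (y, t)) := by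
    refine Measure.measurable_of_measurable_coe _ fun s hs => ?_
    let κ : ProbabilityTheory.Kernel unitInterval (E d) := ⟨_, μ.measurable_toMeasure⟩
    have : ProbabilityTheory.IsMarkovKernel κ := ⟨fun t => (μ t).isProbabilityMeasure⟩
    have h := ProbabilityTheory.Kernel.measurable_kernel_prodMk_left (κ := κ)
      (measurable_swap hs)
    convert h using 2 with t
    rw [Measure.map_apply (by fun_prop) hs]
    rfl
  rw [Curve.spaceTime, Measure.lintegral_bind hm.aemeasurable hf.aemeasurable]
  exact lintegral_congr fun t => lintegral_map hf (by fun_prop)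

/-- The Euclidean inner product as a bilinear map, the second variable being
restricted to the subspace `U`. -/
def pairing {d : ℕ} (U : Submodule ℝ (E d)) : E d →L[ℝ] U →L[ℝ] ℝ :=
  (innerSL ℝ : E d →L[ℝ] E d →L[ℝ] ℝ).bilinearComp (ContinuousLinearMap.id ℝ (E d)) U.subtypeL

/-- `∫ f · dν` for `f : ℝ^d × [0,1] → ℝ^d` and `ν` a finite `U`-valued Borel vector measure.
Since `U` is finite dimensional, every such `ν` has finite variation, so that this is a genuine
integral for every bounded Borel function `f`. -/
def dotIntegral {d : ℕ} {U : Submodule ℝ (E d)} (ν : VectorMeasure (X d) U) (f : X d → E d) : ℝ :=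
  ν.integral f (pairing U)

/-- Narrow convergence in `ℳ(ℝ^d × [0,1]; U)`: convergence in duality with bounded continuous
functions `f : ℝ^d × [0,1] → U`. -/
def NarrowTendsto {d : ℕ} {U : Submodule ℝ (E d)} (νn : ℕ → VectorMeasure (X d) U)
    (ν : VectorMeasure (X d) U) : Prop :=
  ∀ f : X d → U, Continuous f → (∃ B : ℝ, ∀ z, ‖f z‖ ≤ B) →
    Tendsto (fun n => dotIntegral (νn n) (fun z => (f z : E d))) atTop
      (𝓝 (dotIntegral ν (fun z => (f z : E d))))

/-- Convergence in `C([0,1]; 𝒫₁(ℝ^d))`: uniform convergence in `W₁`. -/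
def CurveTendsto {d : ℕ} (μn : ℕ → Curve d) (μ : Curve d) : Prop :=
  Tendsto (fun n => ⨆ t, W1 (μn n t) (μ t)) atTop (𝓝 0)

/-- The hypotheses on the control cost `ψ : U → [0,∞)`, in terms of a moderating function `φ`
(of which only the values on `[0,∞)` matter). -/
structure IsControlCost {d : ℕ} (U : Submodule ℝ (E d)) (ψ : U → ℝ) : Prop where
  nonneg : ∀ x, 0 ≤ ψ x
  convex : ConvexOn ℝ univ ψ
  lowerSemicontinuous : LowerSemicontinuous ψ
  map_zero : ψ 0 = 0
  exists_moderating : ∃ φ : ℝ → ℝ,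
    (∀ r, 0 ≤ r → 0 ≤ φ r) ∧ StrictConvexOn ℝ (Ici 0) φ ∧ ContDiffOn ℝ 1 φ (Ici 0) ∧
    φ 0 = 0 ∧ derivWithin φ (Ici 0) 0 = 0 ∧ Tendsto (fun r => φ r / r) atTop atTop ∧
    (∃ K : ℝ, 0 < K ∧ ∀ r, 0 ≤ r → φ (2 * r) ≤ K * (1 + φ r)) ∧
    (∃ C : ℝ, 0 < C ∧ ∀ x : U, φ ‖x‖ - 1 ≤ ψ x ∧ ψ x ≤ C * (1 + φ ‖x‖))

/-- The hypotheses on the state and measure cost `L : ℝ^d × 𝒫₁(ℝ^d) → [0,∞]`: either it is finite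
and jointly uniformly continuous, or it does not depend on the measure, is infinite on an open
set, and is continuous on the complement of this set. -/
def IsStateCost {d : ℕ} (L : E d → P1 d → ℝ≥0∞) : Prop :=
  ((∀ y μ, L y μ ≠ ∞) ∧
    ∀ ε : ℝ, 0 < ε → ∃ δ : ℝ, 0 < δ ∧ ∀ (y y' : E d) (μ μ' : P1 d),
      dist y y' < δ → W1 μ μ' < ENNReal.ofReal δ → |(L y μ).toReal - (L y' μ').toReal| < ε) ∨
  ((∀ y μ μ', L y μ = L y μ') ∧
    ∀ μ, IsOpen {y | L y μ = ∞} ∧ ContinuousOn (fun y => L y μ) {y | L y μ < ∞})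

/-- The hypotheses on the vector field `F : ℝ^d × 𝒫₁(ℝ^d) → ℝ^d`: joint uniform continuity and
linear growth. -/
structure IsDrift {d : ℕ} (F : E d → P1 d → E d) : Prop where
  uniformContinuous : ∀ ε : ℝ, 0 < ε → ∃ δ : ℝ, 0 < δ ∧ ∀ (y y' : E d) (μ μ' : P1 d),
    dist y y' < δ → W1 μ μ' < ENNReal.ofReal δ → dist (F y μ) (F y' μ') < ε
  growth : ∃ C C' : ℝ, 0 ≤ C ∧ 0 ≤ C' ∧ ∀ y μ, ‖F y μ‖ ≤ C + C' * (‖y‖ + μ.moment)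

/-- `(μ, ν)` solves `∂_t μ_t + ∇ · (F(·, μ_t) μ_t + ν_t) = 0` in the sense of distributions: the
weak formulation holds for all `φ ∈ C_c^∞(ℝ^d × (0,1))`. -/
def SolvesContinuityEquation {d : ℕ} {U : Submodule ℝ (E d)} (F : E d → P1 d → E d)
    (μ : Curve d) (ν : VectorMeasure (X d) U) : Prop :=
  ∀ φ : E d × ℝ → ℝ, ContDiff ℝ (⊤ : ℕ∞) φ → HasCompactSupport φ → tsupport φ ⊆ univ ×ˢ Ioo 0 1 →
    (∫ t : unitInterval, ∫ y, (deriv (fun s : ℝ => φ (y, s)) t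
        + ⟪gradient (fun x => φ (x, (t : ℝ))) y, F y (μ t)⟫) ∂(μ t).toMeasure)
      + dotIntegral ν (fun z => gradient (fun x => φ (x, (z.2 : ℝ))) z.1) = 0

/-- The constraint set `𝒞(m₀)`. -/
structure Admissible {d : ℕ} {U : Submodule ℝ (E d)} (F : E d → P1 d → E d) (m₀ : P1 d)
    (μ : Curve d) (ν : VectorMeasure (X d) U) : Prop where
  isAC : μ.IsAC
  solves : SolvesContinuityEquation F μ ν
  initial : μ 0 = m₀

/-- `dν = u dμ_t dt` with `u ∈ L¹(dμ_t ⊗ dt; U)`. -/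
def IsDensity {d : ℕ} {U : Submodule ℝ (E d)} (ν : VectorMeasure (X d) U) (μ : Curve d)
    (u : X d → U) : Prop :=
  Integrable u μ.spaceTime ∧ ν = μ.spaceTime.withDensityᵥ u

/-- The control cost functional `Ψ(ν|μ)`: it equals `∫₀¹ ∫ ψ(u(y,t)) dμ_t(y) dt` if
`dν = u dμ_t dt` (see `Psi_eq`; the density is unique almost everywhere), and `∞` if `ν` has no
density. -/
def Psi {d : ℕ} {U : Submodule ℝ (E d)} (ψ : U → ℝ) (ν : VectorMeasure (X d) U)
    (μ : Curve d) : ℝ≥0∞ :=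
  ⨅ (u : X d → U) (_ : IsDensity ν μ u), ∫⁻ z, ENNReal.ofReal (ψ (u z)) ∂μ.spaceTime

theorem Psi_eq {d : ℕ} {U : Submodule ℝ (E d)} (ψ : U → ℝ) (ν : VectorMeasure (X d) U)
    (μ : Curve d) (u : X d → U) (hu : IsDensity ν μ u) :
    Psi ψ ν μ = ∫⁻ z, ENNReal.ofReal (ψ (u z)) ∂μ.spaceTime := by
  refine le_antisymm (iInf₂_le u hu) (le_iInf₂ fun v hv => le_of_eq ?_)
  have h : u =ᵐ[μ.spaceTime] v :=
    hu.1.ae_eq_of_withDensityᵥ_eq hv.1 (hu.2.symm.trans hv.2)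
  refine lintegral_congr_ae ?_
  filter_upwards [h] with z hz
  rw [hz]

theorem Psi_eq_top {d : ℕ} {U : Submodule ℝ (E d)} (ψ : U → ℝ) (ν : VectorMeasure (X d) U)
    (μ : Curve d) (h : ¬ ∃ u, IsDensity ν μ u) : Psi ψ ν μ = ∞ := by
  simp only [Psi, iInf_eq_top]
  exact fun u hu => (h ⟨u, hu⟩).elim

/-- The functional `𝒢(μ, ν) = Ψ(ν|μ) + ∫₀¹ ∫ L(y, μ_t) dμ_t(y) dt`. -/
def G {d : ℕ} {U : Submodule ℝ (E d)} (ψ : U → ℝ) (L : E d → P1 d → ℝ≥0∞) (μ : Curve d)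
    (ν : VectorMeasure (X d) U) : ℝ≥0∞ :=
  Psi ψ ν μ + ∫⁻ t : unitInterval, ∫⁻ y, L y (μ t) ∂(μ t).toMeasure

end

end MFC

/-! ### Linear programming duality for transport between finite sets -/

namespace MFC

/-! Finite cost forces dν_n = u_n dμ_t dt with ∫ψ(u_n) bounded, so that μ_n is transported by the
velocity V_n = F(·, μ_n) + u_n. Compactness comes from the superlinearity of the moderating
function: for every ε there is C_ε with |u| ≤ ε ψ(u) + C_ε (`IsControlCost.exists_norm_le`).

Curves: test the equation with the weights ⟨y⟩²/(R + ⟨y⟩) and apply Grönwall's inequality. For R = 0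
this bounds the first moments (`exists_moment_bound`); for large R it makes their tails uniformly
small (`exists_tail_bound`). A drift of linear growth is harmless because ⟨y⟩ times the gradient of
the weight is at most twice the weight. Kantorovich duality, obtained from Hahn–Banach separation on
finite sets and quantisation, gives W₁(μ_s, μ_t) ≤ ∫∫ |V| over the time interval, hence
equicontinuity (`exists_modulus`). Small tails upgrade narrow convergence to W₁ convergence, so all
values lie in one compact subset of 𝒫₁ and Arzelà–Ascoli applies (`exists_subseq_curveTendsto`).

Controls: the u_n are densities over different measures, so they are replaced by the laws of (z,
u_n(z)), which are tight. The barycentre of the conditional laws of a narrow limit is the limit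
control u'. Pairings with bounded continuous fields converge because they are linear in the control
and grow more slowly than ψ; Jensen's inequality and semicontinuity under narrow convergence bound
the cost (`exists_barycentre`, `exists_limit_control`).

Limit: uniform continuity of F and of L in case (a) allows the measure argument to be frozen at the
limit curve, and in case (b) L is lower semicontinuous. The limit curve is absolutely continuous
because it solves a transport equation with integrable velocity. -/

/-- **Finite Kantorovich duality**: if every admissible pair of potentials has value at most `w`,
then there is a transport plan of cost at most `w`. -/
theorem exists_plan_of_forall_potentials {ι κ : Type*} [Fintype ι] [Fintype κ]
    (a : ι → ℝ) (b : κ → ℝ) (ha : ∀ i, 0 ≤ a i) (hb : ∀ j, 0 ≤ b j) (ha1 : ∑ i, a i = 1)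
    (hb1 : ∑ j, b j = 1) (c : ι → κ → ℝ) (w : ℝ)
    (h : ∀ f : ι → ℝ, ∀ g : κ → ℝ, (∀ i j, f i + g j ≤ c i j) →
      ∑ i, f i * a i + ∑ j, g j * b j ≤ w) :
    ∃ p : ι → κ → ℝ, (∀ i j, 0 ≤ p i j) ∧ (∀ i, ∑ j, p i j = a i) ∧ (∀ j, ∑ i, p i j = b j) ∧
      ∑ i, ∑ j, p i j * c i j ≤ w := by
  classical
  by_contra hcon
  let T : (ι × κ → ℝ) →ₗ[ℝ] (ι → ℝ) × (κ → ℝ) × ℝ :=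
    { toFun := fun p => (fun i => ∑ j, p (i, j), fun j => ∑ i, p (i, j), ∑ x, p x * c x.1 x.2)
      map_add' := fun p q => by
        ext <;> simp [Finset.sum_add_distrib, add_mul]
      map_smul' := fun r p => by
        ext <;> simp [Finset.mul_sum, mul_assoc] }
  -- If no plan works, the compact convex set of (marginals, cost) of all joint weights misses {a} ×
  -- {b} × (-∞, w], and the two can be strictly separated.
  have hT : Continuous T := T.continuous_of_finiteDimensional
  have hdisj : Disjoint (T '' stdSimplex ℝ (ι × κ)) ({a} ×ˢ ({b} ×ˢ Iic w)) := by
    rw [Set.disjoint_left]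
    rintro _ ⟨p, hp, rfl⟩ ⟨h1, h2, h3⟩
    refine hcon ⟨fun i j => p (i, j), fun i j => hp.1 _, fun i => congrFun h1 i,
      fun j => congrFun h2 j, ?_⟩
    have h3' : ∑ x : ι × κ, p x * c x.1 x.2 ≤ w := h3
    rwa [Fintype.sum_prod_type] at h3'
  obtain ⟨F, u, v, hFu, huv, hFv⟩ := geometric_hahn_banach_compact_closed
    ((convex_stdSimplex ℝ (ι × κ)).linear_image T) ((isCompact_stdSimplex ℝ (ι × κ)).image hT)
    ((convex_singleton a).prod ((convex_singleton b).prod (convex_Iic w)))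
    (isClosed_singleton.prod (isClosed_singleton.prod isClosed_Iic)) hdisj
  set lam : ℝ := F (0, 0, 1) with hlam
  set p : ι → ℝ := fun i => F (Pi.single i 1, 0, 0) with hp
  set q : κ → ℝ := fun j => F (0, Pi.single j 1, 0) with hq
  have hF : ∀ x y r, F (x, y, r) = ∑ i, p i * x i + ∑ j, q j * y j + lam * r := by
    intro x y r
    have e1 : (x, y, r) = (ContinuousLinearMap.inl ℝ (ι → ℝ) ((κ → ℝ) × ℝ) x)
        + (ContinuousLinearMap.inr ℝ (ι → ℝ) ((κ → ℝ) × ℝ) (ContinuousLinearMap.inl ℝ (κ → ℝ) ℝ y))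
        + r • ((0 : ι → ℝ), (0 : κ → ℝ), (1 : ℝ)) := by ext <;> simp
    have ex : F (ContinuousLinearMap.inl ℝ (ι → ℝ) ((κ → ℝ) × ℝ) x) = ∑ i, p i * x i := by
      have := LinearMap.pi_apply_eq_sum_univ
        ((F.comp (ContinuousLinearMap.inl ℝ (ι → ℝ) ((κ → ℝ) × ℝ))) : (ι → ℝ) →ₗ[ℝ] ℝ) x
      simp only [ContinuousLinearMap.coe_coe, ContinuousLinearMap.comp_apply] at this
      rw [this]
      refine Finset.sum_congr rfl fun i _ => ?_
      rw [smul_eq_mul, mul_comm]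
      congr 2
      simp only [ContinuousLinearMap.inl_apply]
      congr 1
      ext k; simp [Pi.single_apply, eq_comm]
    have ey : F (ContinuousLinearMap.inr ℝ (ι → ℝ) ((κ → ℝ) × ℝ)
        (ContinuousLinearMap.inl ℝ (κ → ℝ) ℝ y)) = ∑ j, q j * y j := by
      have := LinearMap.pi_apply_eq_sum_univ
        ((F.comp ((ContinuousLinearMap.inr ℝ (ι → ℝ) ((κ → ℝ) × ℝ)).comp
          (ContinuousLinearMap.inl ℝ (κ → ℝ) ℝ))) : (κ → ℝ) →ₗ[ℝ] ℝ) y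
      simp only [ContinuousLinearMap.coe_coe, ContinuousLinearMap.comp_apply] at this
      rw [this]
      refine Finset.sum_congr rfl fun i _ => ?_
      rw [smul_eq_mul, mul_comm]
      congr 2
      simp only [ContinuousLinearMap.inl_apply, ContinuousLinearMap.inr_apply]
      congr 2
      ext k; simp [Pi.single_apply, eq_comm]
    rw [e1, map_add, map_add, ex, ey, map_smul, smul_eq_mul, mul_comm r]
  have hv : ∀ t ≤ w, v < ∑ i, p i * a i + ∑ j, q j * b j + lam * t := fun t ht => by
    rw [← hF]; exact hFv _ ⟨rfl, rfl, ht⟩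
  have hu : ∀ x ∈ stdSimplex ℝ (ι × κ), ∑ i, p i * (∑ j, x (i, j)) + ∑ j, q j * (∑ i, x (i, j))
      + lam * (∑ z, x z * c z.1 z.2) < u := fun x hx => by
    rw [← hF]; exact hFu _ ⟨x, hx, rfl⟩
  -- The half-line of costs is unbounded below while the functional stays above `v` on it, so the
  -- cost coefficient cannot be positive.
  have hlam0 : lam ≤ 0 := by
    by_contra hpos
    push Not at hpos
    set A := ∑ i, p i * a i + ∑ j, q j * b j
    have := hv (min w ((v - A) / lam)) (min_le_left _ _)
    have h2 : lam * min w ((v - A) / lam) ≤ lam * ((v - A) / lam) :=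
      mul_le_mul_of_nonneg_left (min_le_right _ _) hpos.le
    rw [mul_div_cancel₀ _ hpos.ne'] at h2
    linarith
  rcases hlam0.lt_or_eq with hneg | hzero
  -- Evaluation at the vertices of the simplex gives pointwise constraints. After division by
  -- `-lam`, with `u` absorbed into the first potential since `a` has mass one, they are admissible
  -- potentials of value above `w`.
  · have hpt : ∀ i j, p i + q j + lam * c i j < u := by
      intro i j
      have := hu (Pi.single (i, j) 1) (single_mem_stdSimplex ℝ _)
      have s1 : ∀ i', ∑ j', (Pi.single (i, j) (1 : ℝ) : ι × κ → ℝ) (i', j')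
          = if i' = i then 1 else 0 := by
        intro i'
        by_cases h : i' = i
        · subst h; simp [Pi.single_apply]
        · simp [h]
      have s2 : ∀ j', ∑ i', (Pi.single (i, j) (1 : ℝ) : ι × κ → ℝ) (i', j')
          = if j' = j then 1 else 0 := by
        intro j'
        by_cases h : j' = j
        · subst h; simp [Pi.single_apply]
        · simp [h]
      simp only [s1, s2] at this
      simpa [Pi.single_apply] using this
    have h1 := h (fun i => (p i - u) / (-lam)) (fun j => q j / (-lam)) (fun i j => by
      rw [← add_div, div_le_iff₀ (by linarith)]
      linarith [hpt i j])
    have h2 : ∑ i, (p i - u) / (-lam) * a i + ∑ j, q j / (-lam) * b j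
        = (∑ i, p i * a i + ∑ j, q j * b j - u) / (-lam) := by
      have e1 : ∑ i, (p i - u) / (-lam) * a i = (∑ i, p i * a i - u) / (-lam) := by
        have : ∑ i, p i * a i - u = ∑ i, (p i - u) * a i := by
          simp only [sub_mul, Finset.sum_sub_distrib, ← Finset.mul_sum, ha1, mul_one]
        rw [this, Finset.sum_div]
        exact Finset.sum_congr rfl fun i _ => by ring
      have e2 : ∑ j, q j / (-lam) * b j = (∑ j, q j * b j) / (-lam) := by
        rw [Finset.sum_div]
        exact Finset.sum_congr rfl fun i _ => by ring
      rw [e1, e2]; ring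
    rw [h2, div_le_iff₀ (by linarith)] at h1
    linarith [hv w le_rfl]
  -- With zero cost coefficient only the marginals matter, and the product plan, whose marginals are
  -- `a` and `b`, contradicts the separation.
  · have h1 := hu (fun z => a z.1 * b z.2) ⟨fun z => mul_nonneg (ha _) (hb _), by
      rw [Fintype.sum_prod_type]
      simp only [← Finset.mul_sum, hb1, mul_one, ha1]⟩
    simp only [← Finset.mul_sum, ← Finset.sum_mul, hb1, ha1, mul_one, one_mul, hzero, zero_mul]
      at h1
    have := hv w le_rfl
    rw [hzero] at this
    linarith

end MFC

/-! ### Kantorovich duality on ℝ^d and the metric axioms for `W1` -/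

namespace MFC

/-- A plan between the laws of a simple function under `μ` and `ν` lifts to a coupling of `μ` and
`ν`. -/
theorem exists_coupling_of_plan {α : Type*} [MeasurableSpace α] [MetricSpace α]
    (μ ν : Measure α) [IsProbabilityMeasure μ] [IsProbabilityMeasure ν] (q : SimpleFunc α α)
    (p : q.range → q.range → ℝ) (hp : ∀ i j, 0 ≤ p i j)
    (h1 : ∀ i, ∑ j, p i j = μ.real (q ⁻¹' {(i : α)}))
    (h2 : ∀ j, ∑ i, p i j = ν.real (q ⁻¹' {(j : α)})) :
    ∃ π : Measure (α × α), π.map Prod.fst = μ ∧ π.map Prod.snd = ν ∧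
      ∫⁻ z, edist (q z.1) (q z.2) ∂π ≤ ENNReal.ofReal (∑ i, ∑ j, p i j * dist (i : α) j) := by
  classical
  set A : q.range → Set α := fun i => q ⁻¹' {(i : α)} with hA
  have hAm : ∀ i, MeasurableSet (A i) := fun i => q.measurableSet_fiber _
  have hsum : ∀ (m : Measure α) (s : Set α), MeasurableSet s →
      ∑ i, m (A i ∩ s) = m s := by
    intro m s hs
    have h := sum_measure_preimage_singleton (μ := m.restrict s) q.range (f := q)
      (fun y _ => q.measurableSet_fiber y)
    have hu : q ⁻¹' (q.range : Set α) = univ := by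
      ext x; simp
    rw [hu, Measure.restrict_apply_univ, ← Finset.sum_attach] at h
    rw [← h]
    exact Finset.sum_congr rfl fun i _ => by rw [Measure.restrict_apply (hAm i)]
  -- The mass `p i j` is spread as the product of the conditional laws on the cells. On a null cell
  -- the conditional law is the zero measure instead of a probability, but then the corresponding
  -- row or column of `p` vanishes (`row0`, `col0`).
  set π : Measure (α × α) := ∑ i, ∑ j, ENNReal.ofReal (p i j) •
    (ProbabilityTheory.cond μ (A i)).prod (ProbabilityTheory.cond ν (A j)) with hπ
  have row0 : ∀ i j, μ (A i) = 0 → p i j = 0 := by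
    intro i j h
    have h3 : ∑ j, p i j = 0 := by rw [h1 i, Measure.real, h]; simp
    exact (Finset.sum_eq_zero_iff_of_nonneg fun j _ => hp i j).1 h3 j (Finset.mem_univ _)
  have col0 : ∀ i j, ν (A j) = 0 → p i j = 0 := by
    intro i j h
    have h3 : ∑ i, p i j = 0 := by rw [h2 j, Measure.real, h]; simp
    exact (Finset.sum_eq_zero_iff_of_nonneg fun i _ => hp i j).1 h3 i (Finset.mem_univ _)
  have condun : ∀ (m : Measure α) [IsFiniteMeasure m] i, m (A i) ≠ 0 →
      ProbabilityTheory.cond m (A i) univ = 1 := by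
    intro m _ i h
    have := ProbabilityTheory.cond_isProbabilityMeasure h
    exact measure_univ
  refine ⟨π, ?_, ?_, ?_⟩
  · ext s hs
    rw [Measure.map_apply measurable_fst hs, ← Set.prod_univ, ← hsum μ s hs]
    simp only [hπ, Measure.finsetSum_apply, Measure.smul_apply, Measure.prod_prod, smul_eq_mul]
    refine Finset.sum_congr rfl fun i _ => ?_
    have e1 : ∀ j, ENNReal.ofReal (p i j) * (ProbabilityTheory.cond μ (A i) s *
        ProbabilityTheory.cond ν (A j) univ)
        = ENNReal.ofReal (p i j) * ProbabilityTheory.cond μ (A i) s := by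
      intro j
      by_cases h : ν (A j) = 0
      · rw [col0 i j h]; simp
      · rw [condun ν j h, mul_one]
    rw [Finset.sum_congr rfl fun j _ => e1 j, ← Finset.sum_mul,
      ← ENNReal.ofReal_sum_of_nonneg fun j _ => hp i j, h1 i, ofReal_measureReal,
      ProbabilityTheory.cond_apply (hAm i), ← mul_assoc]
    by_cases h : μ (A i) = 0
    · have : μ (A i ∩ s) = 0 := measure_mono_null inter_subset_left h
      rw [this]; simp
    · rw [ENNReal.mul_inv_cancel h (measure_ne_top _ _), one_mul]
  · ext s hs
    rw [Measure.map_apply measurable_snd hs, ← Set.univ_prod, ← hsum ν s hs]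
    simp only [hπ, Measure.finsetSum_apply, Measure.smul_apply, Measure.prod_prod, smul_eq_mul]
    rw [Finset.sum_comm]
    refine Finset.sum_congr rfl fun j _ => ?_
    have e1 : ∀ i, ENNReal.ofReal (p i j) * (ProbabilityTheory.cond μ (A i) univ *
        ProbabilityTheory.cond ν (A j) s)
        = ENNReal.ofReal (p i j) * ProbabilityTheory.cond ν (A j) s := by
      intro i
      by_cases h : μ (A i) = 0
      · rw [row0 i j h]; simp
      · rw [condun μ i h, one_mul]
    rw [Finset.sum_congr rfl fun i _ => e1 i, ← Finset.sum_mul,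
      ← ENNReal.ofReal_sum_of_nonneg fun i _ => hp i j, h2 j, ofReal_measureReal,
      ProbabilityTheory.cond_apply (hAm j), ← mul_assoc]
    by_cases h : ν (A j) = 0
    · have : ν (A j ∩ s) = 0 := measure_mono_null inter_subset_left h
      rw [this]; simp
    · rw [ENNReal.mul_inv_cancel h (measure_ne_top _ _), one_mul]
  · rw [hπ, lintegral_finsetSum_measure,
      ENNReal.ofReal_sum_of_nonneg fun i _ =>
        Finset.sum_nonneg fun j _ => mul_nonneg (hp i j) dist_nonneg]
    refine Finset.sum_le_sum fun i _ => ?_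
    rw [lintegral_finsetSum_measure,
      ENNReal.ofReal_sum_of_nonneg fun j _ => mul_nonneg (hp i j) dist_nonneg]
    refine Finset.sum_le_sum fun j _ => ?_
    rw [lintegral_smul_measure, ENNReal.ofReal_mul (hp i j), ← edist_dist, smul_eq_mul]
    by_cases hij : p i j = 0
    · simp [hij]
    refine mul_le_mul_right ?_ _
    have hi : μ (A i) ≠ 0 := fun h => hij (row0 i j h)
    have hj : ν (A j) ≠ 0 := fun h => hij (col0 i j h)
    have := ProbabilityTheory.cond_isProbabilityMeasure hi
    have := ProbabilityTheory.cond_isProbabilityMeasure hj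
    have a1 : ∀ᵐ z ∂(ProbabilityTheory.cond μ (A i)).prod (ProbabilityTheory.cond ν (A j)),
        z.1 ∈ A i := Measure.quasiMeasurePreserving_fst.ae (ProbabilityTheory.ae_cond_mem (hAm i))
    have a2 : ∀ᵐ z ∂(ProbabilityTheory.cond μ (A i)).prod (ProbabilityTheory.cond ν (A j)),
        z.2 ∈ A j := Measure.quasiMeasurePreserving_snd.ae (ProbabilityTheory.ae_cond_mem (hAm j))
    calc _ = ∫⁻ z, edist (i : α) j ∂(ProbabilityTheory.cond μ (A i)).prod
          (ProbabilityTheory.cond ν (A j)) := by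
          refine lintegral_congr_ae ?_
          filter_upwards [a1, a2] with z hz1 hz2
          rw [show q z.1 = i from hz1, show q z.2 = j from hz2]
      _ ≤ edist (i : α) j := by simp

variable {d : ℕ}

theorem P1.integrable_norm (μ : P1 d) : Integrable (fun x => ‖x‖) μ.toMeasure :=
  ⟨by fun_prop, by simpa [HasFiniteIntegral] using μ.lintegral_enorm_lt_top⟩

theorem P1.integrable_id (μ : P1 d) : Integrable (fun x => x) μ.toMeasure :=
  (integrable_norm_iff (by fun_prop)).1 μ.integrable_norm

theorem P1.integrable_of_lipschitz (μ : P1 d) {K : NNReal} {f : E d → ℝ} (hf : LipschitzWith K f) :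
    Integrable f μ.toMeasure := by
  refine Integrable.mono' (((μ.integrable_norm).const_mul K).add (integrable_const |f 0|))
    hf.continuous.aestronglyMeasurable (ae_of_all _ fun x => ?_)
  have h := hf.dist_le_mul x 0
  rw [dist_zero_right, Real.dist_eq] at h
  have := abs_sub_abs_le_abs_sub (f x) (f 0)
  simp only [Pi.add_apply, Real.norm_eq_abs]
  linarith

/-- The easy direction of duality. No optimal plan is needed: a plan of cost below `r + ε` gives the
bound up to ε. -/
theorem abs_integral_sub_le_of_W1_le (μ ν : P1 d) {K : NNReal} {f : E d → ℝ}
    (hf : LipschitzWith K f) {r : ℝ} (hr : 0 ≤ r) (h : W1 μ ν ≤ ENNReal.ofReal r) :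
    |∫ x, f x ∂μ.toMeasure - ∫ x, f x ∂ν.toMeasure| ≤ K * r := by
  have key : ∀ ε : ℝ, 0 < ε →
      |∫ x, f x ∂μ.toMeasure - ∫ x, f x ∂ν.toMeasure| ≤ K * (r + ε) := by
    intro ε hε
    have hlt : W1 μ ν < ENNReal.ofReal (r + ε) :=
      h.trans_lt ((ENNReal.ofReal_lt_ofReal_iff (by linarith)).2 (by linarith))
    simp only [W1, iInf_lt_iff] at hlt
    obtain ⟨π, ⟨h1, h2⟩, hlt⟩ := hlt
    have m1 : AEStronglyMeasurable f (π.map Prod.fst) := hf.continuous.aestronglyMeasurable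
    have m2 : AEStronglyMeasurable f (π.map Prod.snd) := hf.continuous.aestronglyMeasurable
    have i1 : Integrable (fun z : E d × E d => f z.1) π :=
      (h1 ▸ μ.integrable_of_lipschitz hf : Integrable f (π.map Prod.fst)).comp_measurable
        measurable_fst
    have i2 : Integrable (fun z : E d × E d => f z.2) π :=
      (h2 ▸ ν.integrable_of_lipschitz hf : Integrable f (π.map Prod.snd)).comp_measurable
        measurable_snd
    rw [← h1, ← h2, integral_map measurable_fst.aemeasurable m1,
      integral_map measurable_snd.aemeasurable m2, ← integral_sub i1 i2]
    have e : ‖∫ z, (f z.1 - f z.2) ∂π‖ₑ ≤ ENNReal.ofReal (K * (r + ε)) := by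
      refine (enorm_integral_le_lintegral_enorm _).trans ?_
      calc _ ≤ ∫⁻ z, K * edist z.1 z.2 ∂π := lintegral_mono fun z => by
            rw [← edist_eq_enorm_sub]; exact hf.edist_le_mul _ _
        _ = K * ∫⁻ z, edist z.1 z.2 ∂π := lintegral_const_mul _ (by fun_prop)
        _ ≤ K * ENNReal.ofReal (r + ε) := by gcongr
        _ = _ := by rw [ENNReal.ofReal_mul (NNReal.coe_nonneg K), ENNReal.ofReal_coe_nnreal]
    rwa [← ofReal_norm, ENNReal.ofReal_le_ofReal_iff (by positivity), Real.norm_eq_abs] at e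
  refine le_of_forall_pos_le_add fun ε hε => (key (ε / (K + 1)) (by positivity)).trans ?_
  rw [mul_add]
  gcongr
  rw [← mul_div_assoc, div_le_iff₀ (by positivity)]
  nlinarith [K.2]

/-- **Kantorovich duality**, the hard direction. -/
theorem W1_le_of_forall (μ ν : P1 d) (r : ℝ)
    (h : ∀ f : E d → ℝ, LipschitzWith 1 f → ∫ x, f x ∂μ.toMeasure - ∫ x, f x ∂ν.toMeasure ≤ r) :
    W1 μ ν ≤ ENNReal.ofReal r := by
  have hr : 0 ≤ r := by simpa using h (fun _ => 0) ((LipschitzWith.const 0).weaken zero_le_one)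
  refine ENNReal.le_of_forall_pos_le_add fun ε hε _ => ?_
  have hε4 : (0 : ℝ≥0∞) < ENNReal.ofReal (ε / 4) := by simpa using hε
  have hid : Measurable (fun x : E d => x) := measurable_id
  have t1 := SimpleFunc.tendsto_approxOn_range_L1_enorm hid μ.integrable_id
  have t2 := SimpleFunc.tendsto_approxOn_range_L1_enorm hid ν.integrable_id
  obtain ⟨n, hn1, hn2⟩ := ((t1.eventually (gt_mem_nhds hε4)).and
    (t2.eventually (gt_mem_nhds hε4))).exists
  -- Quantisation at L¹ error ε/4 under both measures. The errors are paid twice: once to compare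
  -- potentials (cost bound `r + ε / 2`), once to return from the quantised cost to the true one.
  set q := SimpleFunc.approxOn (fun x : E d => x) hid (range (fun x : E d => x) ∪ {0}) 0 (by simp) n
  have hqd : ∀ m : P1 d, ∫⁻ x, ‖q x - x‖ₑ ∂m.toMeasure < ENNReal.ofReal (ε / 4) →
      ∀ f : E d → ℝ, LipschitzWith 1 f →
      |∫ x, f (q x) ∂m.toMeasure - ∫ x, f x ∂m.toMeasure| ≤ ε / 4 := by
    intro m hm f hf
    have i1 : Integrable (fun x => f (q x)) m.toMeasure := by
      have := (q.map f).integrable_of_isFiniteMeasure (μ := m.toMeasure)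
      rwa [SimpleFunc.coe_map] at this
    rw [← integral_sub i1 (m.integrable_of_lipschitz hf)]
    have e : ‖∫ x, (f (q x) - f x) ∂m.toMeasure‖ₑ ≤ ENNReal.ofReal (ε / 4) := by
      refine (enorm_integral_le_lintegral_enorm _).trans (le_trans (lintegral_mono fun x => ?_) hm.le)
      have := hf.edist_le_mul (q x) x
      simpa [edist_eq_enorm_sub] using this
    rw [← ofReal_norm, ENNReal.ofReal_le_ofReal_iff (by positivity)] at e
    exact e
  have hint : ∀ (m : P1 d) (f : q.range → ℝ) (g : E d → ℝ), (∀ i : q.range, g i = f i) →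
      ∑ i, f i * m.toMeasure.real (q ⁻¹' {(i : E d)}) = ∫ x, g (q x) ∂m.toMeasure := by
    intro m f g hg
    have e : (fun x => g (q x)) = fun x => ∑ i : q.range,
        (q ⁻¹' {(i : E d)}).indicator (fun _ => f i) x := by
      ext x
      rw [Finset.sum_eq_single ⟨q x, q.mem_range_self x⟩]
      · simp [hg ⟨q x, q.mem_range_self x⟩]
      · intro i _ hi
        refine indicator_of_notMem (fun hx => hi ?_) _
        ext1; exact (show q x = i from hx).symm
      · simp
    rw [e, integral_finsetSum _ fun i _ =>
      (integrable_const (f i)).indicator (q.measurableSet_fiber _)]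
    refine Finset.sum_congr rfl fun i _ => ?_
    rw [integral_indicator_const _ (q.measurableSet_fiber _), smul_eq_mul, mul_comm]
  have mass : ∀ m : P1 d, ∑ i : q.range, m.toMeasure.real (q ⁻¹' {(i : E d)}) = 1 := by
    intro m
    have := hint m (fun _ => 1) (fun _ => 1) (fun _ => rfl)
    simpa using this
  obtain ⟨p, hp0, hp1, hp2, hpc⟩ := exists_plan_of_forall_potentials
    (fun i : q.range => μ.toMeasure.real (q ⁻¹' {(i : E d)}))
    (fun i : q.range => ν.toMeasure.real (q ⁻¹' {(i : E d)}))
    (fun _ => measureReal_nonneg) (fun _ => measureReal_nonneg) (mass μ) (mass ν)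
    (fun i j => dist (i : E d) j) (r + ε / 2) (by
      intro f g hfg
      have hne : (Finset.univ : Finset q.range).Nonempty :=
        ⟨⟨q 0, q.mem_range_self 0⟩, Finset.mem_univ _⟩
      -- The c-transform of `g`: it is 1-Lipschitz on the whole space, dominates `f` on the atoms,
      -- and `-H` dominates `g`. Hence (f, g) may be replaced by (H, -H), to which the hypothesis
      -- applies.
      set H : E d → ℝ := fun x => Finset.univ.inf' hne fun j : q.range => dist x j - g j with hH
      have hHl : LipschitzWith 1 H := by
        refine LipschitzWith.of_le_add fun x y => ?_
        obtain ⟨j, -, hj⟩ := Finset.exists_mem_eq_inf' hne fun j : q.range => dist y j - g j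
        have h1 : H x ≤ dist x j - g j := Finset.inf'_le _ (Finset.mem_univ j)
        have h2 : H y = dist y j - g j := hj
        linarith [dist_triangle x y j]
      have hf1 : ∀ i : q.range, f i ≤ H i := fun i =>
        Finset.le_inf' hne _ fun j _ => by linarith [hfg i j]
      have hg1 : ∀ j : q.range, g j ≤ -H j := fun j => by
        have : H j ≤ dist (j : E d) j - g j := Finset.inf'_le _ (Finset.mem_univ j)
        rw [dist_self] at this; linarith
      calc _ ≤ ∑ i : q.range, H i * μ.toMeasure.real (q ⁻¹' {(i : E d)})
            + ∑ j : q.range, -H j * ν.toMeasure.real (q ⁻¹' {(j : E d)}) := by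
            refine add_le_add (Finset.sum_le_sum fun i _ => ?_) (Finset.sum_le_sum fun j _ => ?_)
            · exact mul_le_mul_of_nonneg_right (hf1 i) measureReal_nonneg
            · exact mul_le_mul_of_nonneg_right (hg1 j) measureReal_nonneg
        _ = ∫ x, H (q x) ∂μ.toMeasure - ∫ x, H (q x) ∂ν.toMeasure := by
            rw [hint μ (fun i => H i) H fun _ => rfl]
            simp only [neg_mul, Finset.sum_neg_distrib]
            rw [hint ν (fun i => H i) H fun _ => rfl]
            ring
        _ ≤ r + ε / 2 := by
            have a1 := abs_le.1 (hqd μ hn1 H hHl)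
            have a2 := abs_le.1 (hqd ν hn2 H hHl)
            linarith [h H hHl])
  obtain ⟨π, hπ1, hπ2, hπc⟩ := exists_coupling_of_plan μ.toMeasure ν.toMeasure q p hp0 hp1 hp2
  refine (iInf₂_le π ⟨hπ1, hπ2⟩).trans ?_
  have c1 : ∫⁻ z, ‖q z.1 - z.1‖ₑ ∂π ≤ ENNReal.ofReal (ε / 4) := by
    rw [← hπ1, lintegral_map (by fun_prop) measurable_fst] at hn1
    exact hn1.le
  have c2 : ∫⁻ z, ‖q z.2 - z.2‖ₑ ∂π ≤ ENNReal.ofReal (ε / 4) := by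
    rw [← hπ2, lintegral_map (by fun_prop) measurable_snd] at hn2
    exact hn2.le
  calc ∫⁻ z, edist z.1 z.2 ∂π
      ≤ ∫⁻ z, (‖q z.1 - z.1‖ₑ + (edist (q z.1) (q z.2) + ‖q z.2 - z.2‖ₑ)) ∂π := by
        refine lintegral_mono fun z => ?_
        rw [← edist_eq_enorm_sub, ← edist_eq_enorm_sub, edist_comm (q z.1) z.1, ← add_assoc]
        exact edist_triangle4 _ _ _ _
    _ = ∫⁻ z, ‖q z.1 - z.1‖ₑ ∂π + (∫⁻ z, edist (q z.1) (q z.2) ∂π + ∫⁻ z, ‖q z.2 - z.2‖ₑ ∂π) := by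
        rw [lintegral_add_left (by fun_prop), lintegral_add_right _ (by fun_prop)]
    _ ≤ ENNReal.ofReal (ε / 4) + (ENNReal.ofReal (r + ε / 2) + ENNReal.ofReal (ε / 4)) := by
        gcongr
        exact hπc.trans (ENNReal.ofReal_le_ofReal hpc)
    _ = ENNReal.ofReal r + ε := by
        rw [← ENNReal.ofReal_add (by positivity) (by positivity),
          ← ENNReal.ofReal_add (by positivity) (by positivity),
          ← ENNReal.ofReal_coe_nnreal, ← ENNReal.ofReal_add hr (by positivity)]
        congr 1; ring

theorem W1_self (μ : P1 d) : W1 μ μ = 0 := by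
  simpa using W1_le_of_forall μ μ 0 fun f _ => by simp

/-- A 1-Lipschitz function differs from its value at the origin by at most |x|, so the dual problem
is bounded by the sum of the first moments. -/
theorem W1_ne_top (μ ν : P1 d) : W1 μ ν ≠ ∞ := by
  refine ne_top_of_le_ne_top ENNReal.ofReal_ne_top (W1_le_of_forall μ ν
    (∫ x, ‖x‖ ∂μ.toMeasure + ∫ x, ‖x‖ ∂ν.toMeasure) fun f hf => ?_)
  have hg : LipschitzWith 1 fun x => f x - f 0 :=
    LipschitzWith.of_dist_le_mul fun x y => by simpa [Real.dist_eq] using hf.dist_le_mul x y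
  have e : ∀ m : P1 d, |∫ x, f x ∂m.toMeasure - f 0| ≤ ∫ x, ‖x‖ ∂m.toMeasure := by
    intro m
    have : ∫ x, f x ∂m.toMeasure - f 0 = ∫ x, (f x - f 0) ∂m.toMeasure := by
      rw [integral_sub (m.integrable_of_lipschitz hf) (integrable_const _)]; simp
    rw [this]
    rw [← Real.norm_eq_abs]
    refine norm_integral_le_of_norm_le m.integrable_norm (ae_of_all _ fun x => ?_)
    simpa [Real.dist_eq] using hf.dist_le_mul x 0
  linarith [abs_le.1 (e μ), abs_le.1 (e ν)]

theorem abs_integral_sub_le_W1 (μ ν : P1 d) {K : NNReal} {f : E d → ℝ} (hf : LipschitzWith K f) :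
    |∫ x, f x ∂μ.toMeasure - ∫ x, f x ∂ν.toMeasure| ≤ K * (W1 μ ν).toReal :=
  abs_integral_sub_le_of_W1_le μ ν hf ENNReal.toReal_nonneg
    (by rw [ENNReal.ofReal_toReal (W1_ne_top μ ν)])

theorem W1_le_of_forall' (μ ν : P1 d) (r : ℝ≥0∞) (hr : r ≠ ∞)
    (h : ∀ f : E d → ℝ, LipschitzWith 1 f →
      ∫ x, f x ∂μ.toMeasure - ∫ x, f x ∂ν.toMeasure ≤ r.toReal) :
    W1 μ ν ≤ r := by
  rw [← ENNReal.ofReal_toReal hr]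
  exact W1_le_of_forall μ ν _ h

theorem W1_comm (μ ν : P1 d) : W1 μ ν = W1 ν μ := by
  have : ∀ μ ν : P1 d, W1 μ ν ≤ W1 ν μ := fun μ ν =>
    W1_le_of_forall' _ _ _ (W1_ne_top _ _) fun f hf => by
      have := (abs_le.1 (abs_integral_sub_le_W1 ν μ hf)).1
      simp only [NNReal.coe_one, one_mul] at this
      linarith
  exact le_antisymm (this _ _) (this _ _)

/-- On the dual side the inequality is additive for each fixed test function; no gluing of transport
plans is required. -/
theorem W1_triangle (μ ν ρ : P1 d) : W1 μ ρ ≤ W1 μ ν + W1 ν ρ := by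
  refine W1_le_of_forall' _ _ _ (ENNReal.add_ne_top.2 ⟨W1_ne_top _ _, W1_ne_top _ _⟩)
    fun f hf => ?_
  rw [ENNReal.toReal_add (W1_ne_top _ _) (W1_ne_top _ _)]
  have h1 := (abs_le.1 (abs_integral_sub_le_W1 μ ν hf)).2
  have h2 := (abs_le.1 (abs_integral_sub_le_W1 ν ρ hf)).2
  simp only [NNReal.coe_one, one_mul] at h1 h2
  linarith

/-- Integrals of Lipschitz functions along a `W₁`-continuous curve are continuous. -/
theorem Curve.continuous_integral (μ : Curve d) {K : NNReal} {f : E d → ℝ}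
    (hf : LipschitzWith K f) : Continuous fun t => ∫ x, f x ∂(μ t).toMeasure := by
  rw [continuous_iff_continuousAt]
  intro t
  rw [ContinuousAt, tendsto_iff_dist_tendsto_zero]
  have h : Tendsto (fun s => K * (W1 (μ s) (μ t)).toReal) (𝓝 t) (𝓝 (K * (0 : ℝ≥0∞).toReal)) :=
    ((ENNReal.tendsto_toReal (by simp)).comp (μ.continuous_W1 t)).const_mul _
  simp only [ENNReal.toReal_zero, mul_zero] at h
  exact squeeze_zero (fun _ => dist_nonneg) (fun s => abs_integral_sub_le_W1 _ _ hf) h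

/-! ### Smooth weights that detect the tails of first moments -/

/-- The Japanese bracket `√(1 + |y|²)`. -/
noncomputable def bracket (y : E d) : ℝ := √(1 + ‖y‖ ^ 2)

/-- The weight `⟨y⟩² / (R + ⟨y⟩)`, which is comparable to `|y|` for `|y| ≥ R` and vanishes as
`R → ∞`. -/
noncomputable def weight (R : ℝ) (y : E d) : ℝ := bracket y ^ 2 / (R + bracket y)

theorem one_le_bracket (y : E d) : 1 ≤ bracket y := Real.one_le_sqrt.2 (by nlinarith [sq_nonneg ‖y‖])

theorem bracket_pos (y : E d) : 0 < bracket y := zero_lt_one.trans_le (one_le_bracket y)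

theorem norm_le_bracket (y : E d) : ‖y‖ ≤ bracket y := Real.le_sqrt_of_sq_le (by linarith)

theorem bracket_le (y : E d) : bracket y ≤ 1 + ‖y‖ :=
  Real.sqrt_le_iff.2 ⟨by positivity, by nlinarith [norm_nonneg y]⟩

theorem contDiff_bracket : ContDiff ℝ (⊤ : ℕ∞) (bracket (d := d)) :=
  (contDiff_const.add (contDiff_norm_sq ℝ)).sqrt fun y => by positivity

theorem norm_fderiv_bracket_le (y : E d) : ‖fderiv ℝ bracket y‖ ≤ 1 := by
  have h := ((hasStrictFDerivAt_norm_sq y).hasFDerivAt.const_add 1).sqrt (by positivity)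
  have h' : fderiv ℝ bracket y = _ := h.fderiv
  have hb := bracket_pos y
  have hn := norm_le_bracket y
  rw [bracket] at hb hn
  rw [h', ← Nat.cast_smul_eq_nsmul ℝ, norm_smul, norm_smul, innerSL_apply_norm,
    Real.norm_of_nonneg (by positivity), Real.norm_of_nonneg (by positivity),
    div_mul_eq_mul_div, div_le_one (by positivity)]
  push_cast
  linarith

theorem weight_nonneg {R : ℝ} (hR : 0 ≤ R) (y : E d) : 0 ≤ weight R y :=
  div_nonneg (sq_nonneg _) (by linarith [bracket_pos y])

theorem contDiff_weight {R : ℝ} (hR : 0 ≤ R) : ContDiff ℝ (⊤ : ℕ∞) (weight (d := d) R) :=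
  (contDiff_bracket.pow 2).div (contDiff_const.add contDiff_bracket)
    fun y => by linarith [bracket_pos y]

/-- The profile s²/(R + s) has derivative s(2R + s)/(R + s)² ≤ 2s/(R + s), and the bracket is
1-Lipschitz. This yields both the bound 2 and, for R > 0, the bound 2⟨y⟩/R. -/
theorem norm_fderiv_weight_le {R : ℝ} (hR : 0 ≤ R) (y : E d) :
    ‖fderiv ℝ (weight R) y‖ ≤ 2 * bracket y / (R + bracket y) := by
  have hb := bracket_pos y
  have hRb : 0 < R + bracket y := by linarith
  have hd : HasFDerivAt bracket (fderiv ℝ bracket y) y :=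
    (contDiff_bracket.differentiable (by simp) y).hasFDerivAt
  have h1 : HasDerivAt (fun s : ℝ => s ^ 2 / (R + s))
      ((2 * bracket y * (R + bracket y) - bracket y ^ 2 * 1) / (R + bracket y) ^ 2) (bracket y) := by
    simpa using! (hasDerivAt_pow 2 (bracket y)).fun_div ((hasDerivAt_id' (bracket y)).const_add R)
      hRb.ne'
  have h2 : HasFDerivAt (weight R) _ y := h1.comp_hasFDerivAt y hd
  rw [h2.fderiv, norm_smul]
  have h3 : 0 ≤ (2 * bracket y * (R + bracket y) - bracket y ^ 2 * 1) / (R + bracket y) ^ 2 :=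
    div_nonneg (by nlinarith) (by positivity)
  rw [Real.norm_of_nonneg h3]
  refine (mul_le_of_le_one_right h3 (norm_fderiv_bracket_le y)).trans ?_
  rw [div_le_div_iff₀ (by positivity) hRb]
  have : 0 ≤ bracket y ^ 2 * (R + bracket y) := by positivity
  nlinarith

/-- This closes the Grönwall argument for the tails: a drift of size c⟨y⟩ changes the integral of
the weight at a rate at most 2c times that integral. -/
theorem bracket_mul_norm_fderiv_weight_le {R : ℝ} (hR : 0 ≤ R) (y : E d) :
    bracket y * ‖fderiv ℝ (weight R) y‖ ≤ 2 * weight R y := by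
  have := mul_le_mul_of_nonneg_left (norm_fderiv_weight_le hR y) (bracket_pos y).le
  refine this.trans (le_of_eq ?_)
  rw [weight]; ring

theorem norm_fderiv_weight_le_two {R : ℝ} (hR : 0 ≤ R) (y : E d) :
    ‖fderiv ℝ (weight R) y‖ ≤ 2 := by
  refine (norm_fderiv_weight_le hR y).trans ?_
  rw [div_le_iff₀ (by linarith [bracket_pos y])]
  linarith

theorem lipschitz_weight {R : ℝ} (hR : 0 ≤ R) : LipschitzWith 2 (weight (d := d) R) :=
  lipschitzWith_of_nnnorm_fderiv_le ((contDiff_weight hR).differentiable (by simp))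
    fun y => norm_fderiv_weight_le_two hR y

theorem lipschitz_bracket : LipschitzWith 1 (bracket (d := d)) :=
  lipschitzWith_of_nnnorm_fderiv_le (contDiff_bracket.differentiable (by simp))
    fun y => norm_fderiv_bracket_le y

/-- Through this case a single differential estimate serves both the moments and the tails. -/
theorem weight_zero (y : E d) : weight 0 y = bracket y := by
  rw [weight, zero_add, sq, mul_div_assoc, div_self (bracket_pos y).ne', mul_one]

theorem weight_anti {R S : ℝ} (hR : 0 ≤ R) (hRS : R ≤ S) (y : E d) : weight S y ≤ weight R y := by
  have := bracket_pos y
  exact div_le_div_of_nonneg_left (sq_nonneg _) (by linarith) (by linarith)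

theorem weight_le_bracket {R : ℝ} (hR : 0 ≤ R) (y : E d) : weight R y ≤ bracket y :=
  (weight_anti le_rfl hR y).trans (weight_zero y).le

theorem bracket_le_two_mul_weight {R : ℝ} (hR : 0 ≤ R) {y : E d} (h : R ≤ bracket y) :
    bracket y ≤ 2 * weight R y := by
  have := bracket_pos y
  rw [weight, mul_div_assoc', le_div_iff₀ (by linarith)]
  nlinarith

theorem norm_le_two_mul_weight {R : ℝ} (hR : 0 ≤ R) {y : E d} (h : R ≤ ‖y‖) :
    ‖y‖ ≤ 2 * weight R y :=
  (norm_le_bracket y).trans (bracket_le_two_mul_weight hR (h.trans (norm_le_bracket y)))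

/-- Dominated convergence with the bracket as majorant, which is integrable because the first moment
is finite. -/
theorem tendsto_integral_weight (μ : P1 d) :
    Tendsto (fun R => ∫ y, weight R y ∂μ.toMeasure) atTop (𝓝 0) := by
  have h := tendsto_integral_filter_of_dominated_convergence (μ := μ.toMeasure) (l := atTop)
    (F := fun (R : ℝ) (y : E d) => weight R y) (f := fun _ => 0) bracket ?_ ?_
    (μ.integrable_of_lipschitz lipschitz_bracket) ?_
  · simpa using h
  · filter_upwards [eventually_ge_atTop 0] with R hR
    exact (lipschitz_weight hR).continuous.aestronglyMeasurable
  · filter_upwards [eventually_ge_atTop 0] with R hR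
    refine ae_of_all _ fun y => ?_
    rw [Real.norm_of_nonneg (weight_nonneg hR y)]
    exact weight_le_bracket hR y
  · refine ae_of_all _ fun y => ?_
    exact (tendsto_atTop_add_const_right _ _ tendsto_id).const_div_atTop _

/-! ### From narrow convergence with small tails to convergence in `W1` -/

/-- An explicit continuous partition of unity on a ball, subordinate to small balls. -/
theorem exists_partition (R ε : ℝ) (hε : 0 < ε) :
    ∃ (s : Finset (E d)) (χ : E d → E d → ℝ), (∀ i, Continuous (χ i)) ∧ (∀ i x, 0 ≤ χ i x) ∧
      (∀ x, ∑ i ∈ s, χ i x ≤ 1) ∧ (∀ x, ‖x‖ ≤ R → ∑ i ∈ s, χ i x = 1) ∧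
      ∀ i x, χ i x ≠ 0 → dist x i ≤ ε := by
  obtain ⟨t, htf, hcov⟩ := Metric.totallyBounded_iff.1
    (isCompact_closedBall (0 : E d) R).totallyBounded (ε / 2) (by positivity)
  set s := htf.toFinset
  set g : E d → E d → ℝ := fun i x => max 0 (ε - dist x i) with hg
  have hgc : ∀ i, Continuous (g i) := fun i => by fun_prop
  have hg0 : ∀ i x, 0 ≤ g i x := fun i x => le_max_left _ _
  -- The floor `ε / 2` keeps the denominator positive everywhere. It is inactive on the ball, where
  -- some centre lies within `ε / 2` and its tent has height at least `ε / 2`.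
  set S : E d → ℝ := fun x => max (∑ i ∈ s, g i x) (ε / 2) with hS
  have hSc : Continuous S := by
    have : Continuous fun x => ∑ i ∈ s, g i x := continuous_finsetSum _ fun i _ => hgc i
    fun_prop
  have hSp : ∀ x, 0 < S x := fun x => lt_max_of_lt_right (by positivity)
  refine ⟨s, fun i x => g i x / S x, fun i => (hgc i).div hSc fun x => (hSp x).ne',
    fun i x => div_nonneg (hg0 i x) (hSp x).le, fun x => ?_, fun x hx => ?_, fun i x h => ?_⟩
  · rw [← Finset.sum_div, div_le_one (hSp x)]; exact le_max_left _ _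
  · rw [← Finset.sum_div, div_eq_one_iff_eq (hSp x).ne', eq_comm]
    refine max_eq_left ?_
    obtain ⟨i, hi, hxi⟩ := mem_iUnion₂.1 (hcov (mem_closedBall_zero_iff.2 hx))
    refine le_trans ?_ (Finset.single_le_sum (fun j _ => hg0 j x) (htf.mem_toFinset.2 hi))
    have : dist x i < ε / 2 := hxi
    exact le_max_of_le_right (by linarith)
  · by_contra! hlt
    refine h ?_
    change g i x / S x = 0
    rw [show g i x = 0 from max_eq_left (by linarith), zero_div]

/-- A bound on the Wasserstein distance in terms of finitely many test functions and the tails. -/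
theorem exists_W1_le_sum (R ε : ℝ) (hR : 0 ≤ R) (hε : 0 < ε) :
    ∃ (s : Finset (E d)) (χ : E d → E d → ℝ), (∀ i ∈ s, Continuous (χ i)) ∧
      (∀ i ∈ s, ∀ x, 0 ≤ χ i x ∧ χ i x ≤ 1) ∧
      ∀ μ ν : P1 d, W1 μ ν ≤ ENNReal.ofReal (
        ∑ i ∈ s, ‖i‖ * |∫ x, χ i x ∂μ.toMeasure - ∫ x, χ i x ∂ν.toMeasure| + 2 * ε +
        2 * ∫ x, weight R x ∂μ.toMeasure + 2 * ∫ x, weight R x ∂ν.toMeasure) := by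
  obtain ⟨s, χ, hc, h0, h1, hR1, hd⟩ := exists_partition (d := d) R ε hε
  have hle : ∀ i ∈ s, ∀ x, χ i x ≤ 1 := fun i hi x =>
    (Finset.single_le_sum (fun j _ => h0 j x) hi).trans (h1 x)
  refine ⟨s, χ, fun i _ => hc i, fun i hi x => ⟨h0 i x, hle i hi x⟩, fun μ ν => ?_⟩
  refine W1_le_of_forall μ ν _ fun f hf => ?_
  -- After recentring, |g(x)| ≤ ‖x‖: this bounds the coefficients g(i) by ‖i‖, uniformly in `f`, and
  -- controls `g` outside the ball by the weight.
  set g : E d → ℝ := fun x => f x - f 0 with hg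
  have hgl : LipschitzWith 1 g :=
    LipschitzWith.of_dist_le_mul fun x y => by simpa [hg, Real.dist_eq] using hf.dist_le_mul x y
  have hgn : ∀ x, |g x| ≤ ‖x‖ := fun x => by
    simpa [hg, Real.dist_eq] using hf.dist_le_mul x 0
  have hint : ∀ m : P1 d, ∀ i ∈ s, Integrable (χ i) m.toMeasure := fun m i hi =>
    Integrable.of_bound (hc i).aestronglyMeasurable 1 (ae_of_all _ fun x => by
      rw [Real.norm_of_nonneg (h0 i x)]; exact hle i hi x)
  have hw : ∀ m : P1 d, Integrable (weight R) m.toMeasure := fun m =>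
    m.integrable_of_lipschitz (lipschitz_weight hR)
  have hpt : ∀ x, |g x - ∑ i ∈ s, g i * χ i x| ≤ ε + 2 * weight R x := by
    intro x
    have e : g x - ∑ i ∈ s, g i * χ i x
        = ∑ i ∈ s, (g x - g i) * χ i x + (1 - ∑ i ∈ s, χ i x) * g x := by
      simp only [sub_mul, Finset.sum_sub_distrib, ← Finset.mul_sum]; ring
    rw [e]
    refine (abs_add_le _ _).trans (add_le_add ?_ ?_)
    · calc |∑ i ∈ s, (g x - g i) * χ i x| ≤ ∑ i ∈ s, |(g x - g i) * χ i x| :=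
            Finset.abs_sum_le_sum_abs _ _
        _ ≤ ∑ i ∈ s, ε * χ i x := by
            refine Finset.sum_le_sum fun i _ => ?_
            by_cases hi : χ i x = 0
            · simp [hi]
            rw [abs_mul, abs_of_nonneg (h0 i x)]
            refine mul_le_mul_of_nonneg_right ?_ (h0 i x)
            have := hgl.dist_le_mul x i
            rw [Real.dist_eq] at this
            simp only [NNReal.coe_one, one_mul] at this
            exact this.trans (hd i x hi)
        _ = ε * ∑ i ∈ s, χ i x := by rw [Finset.mul_sum]
        _ ≤ ε := mul_le_of_le_one_right hε.le (h1 x)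
    · by_cases hx : ‖x‖ ≤ R
      · rw [hR1 x hx]; simpa using weight_nonneg hR x
      · have s0 : 0 ≤ ∑ i ∈ s, χ i x := Finset.sum_nonneg fun i _ => h0 i x
        rw [abs_mul, abs_of_nonneg (by linarith [h1 x])]
        refine (mul_le_of_le_one_left (abs_nonneg _) (by linarith)).trans ?_
        exact (hgn x).trans (norm_le_two_mul_weight hR (not_le.1 hx).le)
  have hdiff : ∀ m : P1 d, |∫ x, g x ∂m.toMeasure - ∑ i ∈ s, g i * ∫ x, χ i x ∂m.toMeasure|
      ≤ ε + 2 * ∫ x, weight R x ∂m.toMeasure := by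
    intro m
    have e : ∑ i ∈ s, g i * ∫ x, χ i x ∂m.toMeasure
        = ∫ x, ∑ i ∈ s, g i * χ i x ∂m.toMeasure := by
      rw [integral_finsetSum _ fun i hi => (hint m i hi).const_mul _]
      simp only [integral_const_mul]
    rw [e, ← integral_sub (m.integrable_of_lipschitz hgl)
      (integrable_finsetSum _ fun i hi => (hint m i hi).const_mul _)]
    have := norm_integral_le_of_norm_le (f := fun x => g x - ∑ i ∈ s, g i * χ i x)
      (g := fun x => ε + 2 * weight R x) ((integrable_const ε).add ((hw m).const_mul 2))
      (ae_of_all m.toMeasure hpt)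
    refine this.trans (le_of_eq ?_)
    rw [integral_add (integrable_const _) ((hw m).const_mul 2), integral_const_mul]
    simp
  have hfg : ∀ m : P1 d, ∫ x, f x ∂m.toMeasure = ∫ x, g x ∂m.toMeasure + f 0 := by
    intro m
    rw [hg, integral_sub (m.integrable_of_lipschitz hf) (integrable_const _)]; simp
  have hs : ∑ i ∈ s, g i * ∫ x, χ i x ∂μ.toMeasure - ∑ i ∈ s, g i * ∫ x, χ i x ∂ν.toMeasure
      ≤ ∑ i ∈ s, ‖i‖ * |∫ x, χ i x ∂μ.toMeasure - ∫ x, χ i x ∂ν.toMeasure| := by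
    rw [← Finset.sum_sub_distrib]
    refine Finset.sum_le_sum fun i _ => ?_
    rw [← mul_sub]
    refine (le_abs_self _).trans ?_
    rw [abs_mul]
    exact mul_le_mul_of_nonneg_right (hgn i) (abs_nonneg _)
  have a1 := abs_le.1 (hdiff μ)
  have a2 := abs_le.1 (hdiff ν)
  rw [hfg μ, hfg ν]
  linarith

/-- The underlying probability measure. -/
def P1.toProb (μ : P1 d) : ProbabilityMeasure (E d) := ⟨μ.toMeasure, μ.isProbabilityMeasure⟩

/-- Narrow convergence with uniformly small tails implies convergence in `W₁`. -/
theorem tendsto_W1_of_tendsto_toProb {μ : ℕ → P1 d} {μ' : P1 d}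
    (h : Tendsto (fun n => (μ n).toProb) atTop (𝓝 μ'.toProb))
    (ht : ∀ ε > 0, ∃ R ≥ 0, ∀ n, ∫ x, weight R x ∂(μ n).toMeasure ≤ ε) :
    Tendsto (fun n => W1 (μ n) μ') atTop (𝓝 0) := by
  refine ENNReal.tendsto_nhds_zero.2 fun ε hε => ?_
  rcases eq_or_ne ε ∞ with rfl | htop
  · simp
  lift ε to NNReal using htop
  have hε' : (0 : ℝ) < ε := by exact_mod_cast hε
  obtain ⟨R₁, hR₁, hb⟩ := ht (ε / 8) (by positivity)
  -- `R₁` is enlarged until the limit measure has a small tail too; weights decrease in R, so the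
  -- bound for the sequence persists. The total error is ε/8 plus three terms 2 · ε/8.
  obtain ⟨R, hRε, hRR⟩ := (((tendsto_integral_weight μ').eventually
    (gt_mem_nhds (by positivity : (0 : ℝ) < ε / 8))).and (eventually_ge_atTop R₁)).exists
  have hR : 0 ≤ R := le_trans hR₁ hRR
  obtain ⟨s, χ, hc, h01, hW⟩ := exists_W1_le_sum (d := d) R (ε / 8) hR (by positivity)
  have hlim : Tendsto (fun n => ∑ i ∈ s, ‖i‖ *
      |∫ x, χ i x ∂(μ n).toMeasure - ∫ x, χ i x ∂μ'.toMeasure|) atTop (𝓝 0) := by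
    rw [show (0 : ℝ) = ∑ i ∈ s, ‖i‖ * 0 by simp]
    refine tendsto_finsetSum _ fun i hi => Tendsto.const_mul _ ?_
    have hi' := (ProbabilityMeasure.tendsto_iff_forall_integral_tendsto.1 h)
      (BoundedContinuousFunction.ofNormedAddCommGroup (χ i) (hc i hi) 1 fun x => by
        rw [Real.norm_of_nonneg (h01 i hi x).1]; exact (h01 i hi x).2)
    have := (hi'.sub_const (∫ x, χ i x ∂μ'.toMeasure)).abs
    simpa [P1.toProb] using! this
  filter_upwards [hlim.eventually (gt_mem_nhds (by positivity : (0 : ℝ) < ε / 8))] with n hn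
  refine (hW (μ n) μ').trans ?_
  rw [← ENNReal.ofReal_coe_nnreal]
  refine ENNReal.ofReal_le_ofReal ?_
  have : ∫ x, weight R x ∂(μ n).toMeasure ≤ ε / 8 :=
    (integral_mono ((μ n).integrable_of_lipschitz (lipschitz_weight hR))
      ((μ n).integrable_of_lipschitz (lipschitz_weight hR₁)) fun x => weight_anti hR₁ hRR x).trans
      (hb n)
  linarith

end MFC

/-! ### Weak derivatives on the unit interval -/

namespace MFC

theorem map_val_volume_unitInterval :
    (volume : Measure unitInterval).map Subtype.val = volume.restrict (Icc (0 : ℝ) 1) :=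
  map_comap_subtype_coe measurableSet_Icc volume

/-- The extension by `projIcc` is only a device to reach interval integrals on ℝ; its values outside
[0,1] do not enter. -/
theorem setIntegral_unitInterval (k : unitInterval → ℝ) {s t : unitInterval} (hst : s ≤ t) :
    ∫ r in Ioc s t, k r = ∫ r in (s : ℝ)..t, k (projIcc 0 1 zero_le_one r) := by
  rw [intervalIntegral.integral_of_le hst,
    ← Measure.restrict_restrict_of_subset (s := Ioc (s : ℝ) t) (t := Icc (0 : ℝ) 1)
      fun x hx => ⟨s.2.1.trans hx.1.le, hx.2.trans t.2.2⟩,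
    ← map_val_volume_unitInterval,
    (MeasurableEmbedding.subtype_coe measurableSet_Icc).setIntegral_map]
  simp only [projIcc_val]
  rfl

theorem integral_unitInterval (k : unitInterval → ℝ) :
    ∫ r, k r = ∫ r in (0 : ℝ)..1, k (projIcc 0 1 zero_le_one r) := by
  rw [intervalIntegral.integral_of_le zero_le_one, ← integral_Icc_eq_integral_Ioc,
    ← map_val_volume_unitInterval,
    (MeasurableEmbedding.subtype_coe measurableSet_Icc).integral_map]
  simp only [projIcc_val]

theorem integrableOn_unitInterval {k : unitInterval → ℝ} (hk : Integrable k) :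
    IntegrableOn (fun r => k (projIcc 0 1 zero_le_one r)) (Icc (0 : ℝ) 1) := by
  rw [IntegrableOn, ← map_val_volume_unitInterval,
    (MeasurableEmbedding.subtype_coe measurableSet_Icc).integrable_map_iff]
  have : (fun r => k (projIcc 0 1 zero_le_one r)) ∘ Subtype.val = k :=
    funext fun r => congrArg k (projIcc_val zero_le_one r)
  rwa [this]

/-- The limit at x = 0 is 0, not 1; differences of two such limits are therefore indicators of
half-open intervals `Ioc s t`. -/
theorem tendsto_smoothTransition_nat_mul (x : ℝ) :
    Tendsto (fun n : ℕ => Real.smoothTransition (n * x)) atTop (𝓝 (if 0 < x then 1 else 0)) := by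
  split_ifs with hx
  · refine tendsto_const_nhds.congr' ?_
    filter_upwards [(tendsto_natCast_atTop_atTop.atTop_mul_const hx).eventually_ge_atTop 1] with n hn
    exact (Real.smoothTransition.one_of_one_le hn).symm
  · refine tendsto_const_nhds.congr fun n => ?_
    exact (Real.smoothTransition.zero_of_nonpos
      (mul_nonpos_of_nonneg_of_nonpos n.cast_nonneg (not_lt.1 hx))).symm

theorem monotone_smoothTransition : Monotone Real.smoothTransition := Real.smoothTransition.monotone

/-- Rescaled smooth transitions have derivatives that concentrate at `s`. -/
theorem tendsto_integral_deriv_smoothTransition {h : unitInterval → ℝ} (hh : Continuous h)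
    {s : unitInterval} (h1 : s < 1) :
    Tendsto (fun n : ℕ => ∫ r : unitInterval,
      deriv (fun x : ℝ => Real.smoothTransition (n * (x - s))) r * h r) atTop (𝓝 (h s)) := by
  have hcd : ∀ n : ℕ, ContDiff ℝ 1 fun x : ℝ => Real.smoothTransition (n * (x - s)) := fun n =>
    Real.smoothTransition.contDiff.comp (by fun_prop)
  have hdc : ∀ n : ℕ, Continuous (deriv fun x : ℝ => Real.smoothTransition (n * (x - s))) :=
    fun n => (hcd n).continuous_deriv le_rfl
  have hmono : ∀ n : ℕ, Monotone fun x : ℝ => Real.smoothTransition (n * (x - s)) := fun n x y hxy =>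
    monotone_smoothTransition (mul_le_mul_of_nonneg_left (by linarith) n.cast_nonneg)
  have hd0 : ∀ n : ℕ, ∀ x : ℝ, 0 ≤ deriv (fun x : ℝ => Real.smoothTransition (n * (x - s))) x :=
    fun n x => (hmono n).deriv_nonneg
  -- Once n(1 - s) ≥ 1 the transition is complete by time 1, so its derivative has total mass one;
  -- this is where `s < 1` enters.
  have hmass : ∀ᶠ n : ℕ in atTop, ∫ r : unitInterval,
      deriv (fun x : ℝ => Real.smoothTransition (n * (x - s))) r = 1 := by
    have hs1 : (0 : ℝ) < 1 - s := sub_pos.2 h1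
    filter_upwards [(tendsto_natCast_atTop_atTop.atTop_mul_const hs1).eventually_ge_atTop 1]
      with n hn
    have e : ∫ r : unitInterval, deriv (fun x : ℝ => Real.smoothTransition (n * (x - s))) r
        = ∫ r in (0 : ℝ)..1, deriv (fun x : ℝ => Real.smoothTransition (n * (x - s))) r := by
      rw [integral_unitInterval fun r => deriv (fun x : ℝ => Real.smoothTransition (n * (x - s))) r]
      refine intervalIntegral.integral_congr fun r hr => ?_
      rw [uIcc_of_le zero_le_one] at hr
      simp only [projIcc_of_mem zero_le_one hr]
    rw [e, intervalIntegral.integral_deriv_eq_sub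
      (fun x _ => (hcd n).differentiable (by simp) x) ((hdc n).intervalIntegrable _ _),
      Real.smoothTransition.one_of_one_le hn, Real.smoothTransition.zero_of_nonpos, sub_zero]
    have : (0 : ℝ) ≤ s := s.2.1
    nlinarith [n.cast_nonneg (α := ℝ)]
  have hzero : ∀ n : ℕ, ∀ x : ℝ, (x < s ∨ 1 < n * (x - s)) →
      deriv (fun x : ℝ => Real.smoothTransition (n * (x - s))) x = 0 := by
    intro n x hx
    rcases hx with hx | hx
    · have : (fun x : ℝ => Real.smoothTransition (n * (x - s))) =ᶠ[𝓝 x] fun _ => 0 := by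
        filter_upwards [gt_mem_nhds hx] with y hy
        exact Real.smoothTransition.zero_of_nonpos
          (mul_nonpos_of_nonneg_of_nonpos n.cast_nonneg (by linarith))
      rw [this.deriv_eq]; simp
    · have : (fun x : ℝ => Real.smoothTransition (n * (x - s))) =ᶠ[𝓝 x] fun _ => 1 := by
        have hc : Continuous fun x : ℝ => (n : ℝ) * (x - s) := by fun_prop
        filter_upwards [hc.continuousAt.eventually (lt_mem_nhds hx)] with y hy
        exact Real.smoothTransition.one_of_one_le hy.le
      rw [this.deriv_eq]; simp
  have hint : ∀ n : ℕ, ∀ g : unitInterval → ℝ, Continuous g → Integrable fun r : unitInterval =>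
      deriv (fun x : ℝ => Real.smoothTransition (n * (x - s))) r * g r := fun n g hg =>
    (((hdc n).comp continuous_subtype_val).mul hg).integrable_of_hasCompactSupport
      (HasCompactSupport.of_compactSpace _)
  rw [Metric.tendsto_nhds]
  intro ε hε
  obtain ⟨δ, hδ, hδ'⟩ := Metric.continuous_iff.1 hh s (ε / 2) (by positivity)
  filter_upwards [hmass, (tendsto_natCast_atTop_atTop.atTop_mul_const hδ).eventually_gt_atTop 1]
    with n hn hnδ
  have i1 := hint n (fun _ => h s) continuous_const
  have e1 : (∫ r : unitInterval,
      deriv (fun x : ℝ => Real.smoothTransition (n * (x - s))) r * h r) - h s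
      = ∫ r : unitInterval,
        deriv (fun x : ℝ => Real.smoothTransition (n * (x - s))) r * (h r - h s) := by
    rw [integral_congr_ae (ae_of_all _ fun r => mul_sub _ _ _), integral_sub (hint n h hh) i1, integral_mul_const, hn, one_mul]
  rw [Real.dist_eq, e1, ← Real.norm_eq_abs]
  have i2 := hint n (fun _ => ε / 2) continuous_const
  refine (norm_integral_le_of_norm_le i2 (ae_of_all _ fun r => ?_)).trans_lt ?_
  · rw [norm_mul, Real.norm_of_nonneg (hd0 n r)]
    by_cases hr : (r : ℝ) < s ∨ 1 < n * ((r : ℝ) - s)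
    · rw [hzero n r hr]; simp
    · push Not at hr
      refine mul_le_mul_of_nonneg_left (hδ' r ?_).le (hd0 n r)
      rw [Subtype.dist_eq, Real.dist_eq, abs_of_nonneg (by linarith)]
      by_contra! hge
      have : (n : ℝ) * δ ≤ n * ((r : ℝ) - s) := mul_le_mul_of_nonneg_left hge n.cast_nonneg
      linarith
  · rw [integral_mul_const, hn]; linarith

/-- A continuous function with integrable distributional derivative is its primitive. -/
theorem sub_eq_integral_of_weak_deriv {h k : unitInterval → ℝ} (hh : Continuous h)
    (hk : Integrable k)
    (H : ∀ η : ℝ → ℝ, ContDiff ℝ (⊤ : ℕ∞) η → HasCompactSupport η → tsupport η ⊆ Ioo 0 1 →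
      ∫ t : unitInterval, (deriv η t * h t + η t * k t) = 0)
    {s t : unitInterval} (hst : s ≤ t) : h t - h s = ∫ r in Ioc s t, k r := by
  -- Smooth plateaus tending to the indicator of `Ioc s t` are admissible test functions only for 0
  -- < s and t < 1. The end points are recovered later by continuity.
  have interior : ∀ s t : unitInterval, 0 < s → s ≤ t → t < 1 →
      h t - h s = ∫ r in Ioc s t, k r := by
    intro s t h0 hst h1
    set η : ℕ → ℝ → ℝ := fun n r => Real.smoothTransition (n * (r - s)) -
      Real.smoothTransition (n * (r - t)) with hη
    have hcd : ∀ n : ℕ, ∀ c : ℝ, ContDiff ℝ (⊤ : ℕ∞) fun x : ℝ => Real.smoothTransition (n * (x - c)) :=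
      fun n c => Real.smoothTransition.contDiff.comp (by fun_prop)
    have hdc : ∀ n : ℕ, ∀ c : ℝ, Continuous (deriv fun x : ℝ => Real.smoothTransition (n * (x - c))) :=
      fun n c => (hcd n c).continuous_deriv (by simp)
    have hstR : (s : ℝ) ≤ t := hst
    have ht1 : (0 : ℝ) < 1 - t := sub_pos.2 h1
    have hder : ∀ n r, deriv (η n) r = deriv (fun x : ℝ => Real.smoothTransition (n * (x - s))) r
        - deriv (fun x : ℝ => Real.smoothTransition (n * (x - t))) r := fun n r =>
      deriv_fun_sub ((hcd n s).differentiable (by simp) r) ((hcd n t).differentiable (by simp) r)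
    have hηb : ∀ n r, |η n r| ≤ 1 := fun n r => abs_sub_le_iff.2
      ⟨by linarith [Real.smoothTransition.le_one (n * (r - s)),
          Real.smoothTransition.nonneg (n * (r - t))],
        by linarith [Real.smoothTransition.le_one (n * (r - t)),
          Real.smoothTransition.nonneg (n * (r - s))]⟩
    have hηc : ∀ n, Continuous (η n) := fun n => ((hcd n s).sub (hcd n t)).continuous
    have hev : ∀ᶠ n : ℕ in atTop, ∫ r : unitInterval, η n r * k r
        = -((∫ r : unitInterval, deriv (fun x : ℝ => Real.smoothTransition (n * (x - s))) r * h r)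
          - ∫ r : unitInterval, deriv (fun x : ℝ => Real.smoothTransition (n * (x - t))) r * h r) := by
      filter_upwards [(tendsto_natCast_atTop_atTop.atTop_mul_const
        (half_pos ht1)).eventually_ge_atTop 1, eventually_gt_atTop 0] with n hn hnpos
      have hn0 : (0 : ℝ) < n := by exact_mod_cast hnpos
      -- Beyond the midpoint of t and 1 both transitions equal one as soon as n(1 - t)/2 ≥ 1, and
      -- they cancel.
      have hsub : Function.support (η n) ⊆ Icc (s : ℝ) ((1 + t) / 2) := by
        intro r hr
        by_contra hcon
        refine hr ?_
        simp only [mem_Icc, not_and_or, not_le] at hcon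
        rcases hcon with hlt | hgt
        · rw [hη]
          simp only
          rw [Real.smoothTransition.zero_of_nonpos (by nlinarith),
            Real.smoothTransition.zero_of_nonpos (by nlinarith), sub_zero]
        · rw [hη]
          simp only
          rw [Real.smoothTransition.one_of_one_le (by nlinarith),
            Real.smoothTransition.one_of_one_le (by nlinarith), sub_self]
      have hts : tsupport (η n) ⊆ Icc (s : ℝ) ((1 + t) / 2) := closure_minimal hsub isClosed_Icc
      have h0R : (0 : ℝ) < s := h0
      have key := H (η n) ((hcd n s).sub (hcd n t))
        (HasCompactSupport.of_support_subset_isCompact isCompact_Icc hsub)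
        (hts.trans fun r hr => ⟨h0R.trans_le hr.1, hr.2.trans_lt (by linarith)⟩)
      have j1 : ∀ c : ℝ, Integrable fun r : unitInterval =>
          deriv (fun x : ℝ => Real.smoothTransition (n * (x - c))) r * h r := fun c =>
        (((hdc n c).comp continuous_subtype_val).mul hh).integrable_of_hasCompactSupport
          (HasCompactSupport.of_compactSpace _)
      have j2 : Integrable fun r : unitInterval => η n r * k r :=
        hk.bdd_mul ((hηc n).comp continuous_subtype_val).aestronglyMeasurable
          (ae_of_all _ fun r => hηb n r)
      simp only [hder, sub_mul] at key
      rw [integral_add (by exact (j1 s).sub (j1 t)) j2, integral_sub (j1 s) (j1 t)] at key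
      linarith
    have l1 := ((tendsto_integral_deriv_smoothTransition hh (hst.trans_lt h1)).sub
      (tendsto_integral_deriv_smoothTransition hh h1)).neg
    have l2 : Tendsto (fun n => ∫ r : unitInterval, η n r * k r) atTop
        (𝓝 (∫ r, (Ioc s t).indicator k r)) := by
      refine tendsto_integral_of_dominated_convergence (fun r => |k r|) (fun n =>
        ((hηc n).comp continuous_subtype_val).aestronglyMeasurable.mul hk.aestronglyMeasurable)
        hk.abs (fun n => ae_of_all _ fun r => ?_) (ae_of_all _ fun r => ?_)
      · rw [norm_mul]
        exact mul_le_of_le_one_left (norm_nonneg _) (hηb n r)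
      · have := ((tendsto_smoothTransition_nat_mul ((r : ℝ) - s)).sub
          (tendsto_smoothTransition_nat_mul ((r : ℝ) - t))).mul_const (k r)
        convert this using 2
        simp only [sub_pos]
        by_cases a : s < r
        · by_cases b : t < r
          · simp [indicator, a, b, not_le.2 b]
          · simp [indicator, a, b, not_lt.1 b]
        · have b : ¬ t < r := fun b => a (hst.trans_lt b)
          simp [indicator, a, b]
    have := tendsto_nhds_unique (l2.congr' hev) l1
    rw [integral_indicator measurableSet_Ioc] at this
    rw [this]; ring
  set K : ℝ → ℝ := fun x => ∫ r in (0 : ℝ)..x, k (projIcc 0 1 zero_le_one r) with hK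
  have hki := integrableOn_unitInterval hk
  have hKc : ContinuousOn K (Icc 0 1) := by
    have := intervalIntegral.continuousOn_primitive_interval
      (f := fun r => k (projIcc 0 1 zero_le_one r)) (a := 0) (b := 1) (μ := volume)
      (by rwa [uIcc_of_le zero_le_one])
    rwa [uIcc_of_le zero_le_one] at this
  have hKI : ∀ s t : unitInterval, s ≤ t → ∫ r in Ioc s t, k r = K t - K s := by
    intro s t hst
    rw [setIntegral_unitInterval k hst, hK]
    simp only
    have ii : ∀ a b : unitInterval, IntervalIntegrable (fun r => k (projIcc 0 1 zero_le_one r))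
        volume (a : ℝ) b := fun a b =>
      (hki.mono_set (uIcc_subset_Icc a.2 b.2)).intervalIntegrable
    exact (intervalIntegral.integral_interval_sub_left (ii 0 t) (ii 0 s)).symm
  have hcont : Continuous fun t : unitInterval => h t - K t :=
    hh.sub (continuousOn_iff_continuous_domRestrict.1 hKc)
  have hhalf : ∃ m : unitInterval, 0 < m ∧ m < 1 :=
    ⟨⟨1 / 2, by norm_num, by norm_num⟩, by rw [← Subtype.coe_lt_coe]; norm_num,
      by rw [← Subtype.coe_lt_coe]; norm_num⟩
  obtain ⟨m, hm0, hm1⟩ := hhalf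
  -- The difference of `h` and the primitive of `k` is constant on (0,1) and continuous on [0,1],
  -- hence constant on the closure.
  have hconst : ∀ t : unitInterval, h t - K t = h m - K m := by
    have heq : EqOn (fun t : unitInterval => h t - K t) (fun _ => h m - K m) (Ioo 0 1) := by
      intro t ht
      simp only
      rcases le_total t m with hle | hle
      · have := interior t m ht.1 hle hm1
        rw [hKI t m hle] at this
        linarith
      · have := interior m t hm0 hle ht.2
        rw [hKI m t hle] at this
        linarith
    have hcl : closure (Ioo (0 : unitInterval) 1) = Icc 0 1 := closure_Ioo (by simp)
    intro t
    refine heq.closure hcont continuous_const ?_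
    rw [hcl]
    exact ⟨t.2.1, t.2.2⟩
  rw [hKI s t hst]
  linarith [hconst s, hconst t]

/-! ### Disintegration of space-time measures -/

/-- A `W₁`-continuous curve as a Markov kernel from time to space. -/
noncomputable def Curve.kernel (μ : Curve d) : ProbabilityTheory.Kernel unitInterval (E d) :=
  ⟨fun t => (μ t).toMeasure, μ.measurable_toMeasure⟩

instance (μ : Curve d) : ProbabilityTheory.IsMarkovKernel μ.kernel :=
  ⟨fun t => (μ t).isProbabilityMeasure⟩

/-- Up to a swap of the factors, dμ_t ⊗ dt is a composition-product, which brings in Fubini's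
theorem for kernels. -/
theorem Curve.spaceTime_eq (μ : Curve d) :
    μ.spaceTime = ((volume : Measure unitInterval).compProd μ.kernel).map
      (MeasurableEquiv.prodComm (α := unitInterval) (β := E d)) := by
  ext s hs
  have h := μ.lintegral_spaceTime (measurable_const.indicator hs : Measurable (s.indicator 1))
  rw [lintegral_indicator_one hs] at h
  rw [h, MeasurableEquiv.map_apply, Measure.compProd_apply (MeasurableEquiv.measurable _ hs)]
  refine lintegral_congr fun t => ?_
  have : (fun y => s.indicator (1 : X d → ℝ≥0∞) (y, t)) = ((fun y => (y, t)) ⁻¹' s).indicator 1 := by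
    ext y; rfl
  rw [this, lintegral_indicator_one (by exact measurable_prodMk_right hs)]
  rfl

instance (μ : Curve d) : IsProbabilityMeasure μ.spaceTime := by
  rw [μ.spaceTime_eq]
  exact Measure.isProbabilityMeasure_map (MeasurableEquiv.measurable _).aemeasurable

section SpaceTime

variable {H : Type*} [NormedAddCommGroup H] {f : X d → H}

theorem Curve.integrable_spaceTime (μ : Curve d) :
    Integrable f μ.spaceTime ↔ Integrable (fun z : unitInterval × E d => f (z.2, z.1))
      ((volume : Measure unitInterval).compProd μ.kernel) := by
  rw [μ.spaceTime_eq, integrable_map_equiv]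
  rfl

variable [NormedSpace ℝ H]

theorem Curve.integral_spaceTime (μ : Curve d) (hf : Integrable f μ.spaceTime) :
    ∫ z, f z ∂μ.spaceTime = ∫ t : unitInterval, ∫ y, f (y, t) ∂(μ t).toMeasure := by
  rw [μ.spaceTime_eq, integral_map_equiv]
  exact Measure.integral_compProd (μ.integrable_spaceTime.1 hf)

theorem Curve.integrable_integral (μ : Curve d) (hf : Integrable f μ.spaceTime) :
    Integrable fun t : unitInterval => ∫ y, f (y, t) ∂(μ t).toMeasure :=
  Integrable.integral_compProd (μ.integrable_spaceTime.1 hf)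

theorem Curve.setIntegral_spaceTime (μ : Curve d) (hf : Integrable f μ.spaceTime)
    {s : Set unitInterval} (hs : MeasurableSet s) :
    ∫ z in Prod.snd ⁻¹' s, f z ∂μ.spaceTime = ∫ t in s, ∫ y, f (y, t) ∂(μ t).toMeasure := by
  have hs' : MeasurableSet (Prod.snd ⁻¹' s : Set (X d)) := measurable_snd hs
  rw [← integral_indicator hs', μ.integral_spaceTime (hf.indicator hs'), ← integral_indicator hs]
  refine integral_congr_ae (ae_of_all _ fun t => ?_)
  by_cases ht : t ∈ s
  · simp [indicator, ht]
  · simp [indicator, ht]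

end SpaceTime

/-- Lipschitz functions of space are integrable over space-time. -/
theorem Curve.integrable_spaceTime_lipschitz (μ : Curve d) {K : NNReal} {f : E d → ℝ}
    (hf : LipschitzWith K f) : Integrable (fun z : X d => f z.1) μ.spaceTime := by
  rw [μ.integrable_spaceTime]
  refine (Measure.integrable_compProd_iff
    (hf.continuous.comp continuous_snd).aestronglyMeasurable).2 ?_
  refine ⟨ae_of_all _ fun t => (μ t).integrable_of_lipschitz hf, ?_⟩
  have hn : LipschitzWith (1 * K) fun x => ‖f x‖ := lipschitzWith_one_norm.comp hf
  exact (μ.continuous_integral hn).integrable_of_hasCompactSupport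
    (HasCompactSupport.of_compactSpace _)

/-! ### Vector measures with a density -/

section Density

/-- For simple functions this is the definition of the density together with linearity. Bounded
functions follow by dominated convergence on both sides, since the variation of the vector measure
has density ‖u‖ and is finite. -/
theorem integral_withDensityᵥ {X₀ E₀ F₀ G₀ : Type*} [MeasurableSpace X₀]
    [NormedAddCommGroup E₀] [NormedSpace ℝ E₀] [NormedAddCommGroup F₀] [NormedSpace ℝ F₀]
    [CompleteSpace F₀] [NormedAddCommGroup G₀] [NormedSpace ℝ G₀] [CompleteSpace G₀]
    (m : Measure X₀) {u : X₀ → F₀} (hu : Integrable u m) (B : E₀ →L[ℝ] F₀ →L[ℝ] G₀)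
    {f : X₀ → E₀} (hf : StronglyMeasurable f) {C : ℝ} (hC : ∀ z, ‖f z‖ ≤ C) :
    (m.withDensityᵥ u).integral f B = ∫ z, B (f z) (u z) ∂m := by
  set ν := m.withDensityᵥ u with hν
  have hvar : ν.variation = m.withDensity fun z => ‖u z‖ₑ := Measure.variation_withDensityᵥ hu
  have hfin : IsFiniteMeasure ν.variation := by
    rw [hvar]; exact isFiniteMeasure_withDensity hu.2.ne
  have hmeas : ∀ g : SimpleFunc X₀ E₀, AEStronglyMeasurable (fun z => B (g z) (u z)) m := fun g =>
    B.aestronglyMeasurable_comp₂ g.stronglyMeasurable.aestronglyMeasurable hu.1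
  have hb : ∀ (D : ℝ) (g : X₀ → E₀), (∀ z, ‖g z‖ ≤ D) →
      ∀ z, ‖B (g z) (u z)‖ ≤ ‖B‖ * D * ‖u z‖ := fun D g hD z =>
    (B.le_opNorm₂ _ _).trans (by gcongr; exact hD z)
  have hi : ∀ g : SimpleFunc X₀ E₀, Integrable (fun z => B (g z) (u z)) m := by
    intro g
    obtain ⟨D, hD⟩ := g.exists_forall_norm_le
    exact Integrable.mono' (hu.norm.const_mul (‖B‖ * D)) (hmeas g) (ae_of_all _ (hb D g hD))
  have simple : ∀ g : SimpleFunc X₀ E₀, ν.integral g B = ∫ z, B (g z) (u z) ∂m := by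
    intro g
    induction g using SimpleFunc.induction with
    | const c hs =>
      rename_i s
      have e0 : ⇑(SimpleFunc.piecewise s hs (SimpleFunc.const X₀ c) (SimpleFunc.const X₀ 0))
          = s.indicator fun _ => c := by
        ext z
        by_cases hz : z ∈ s <;> simp [hz]
      have e1 : ν.integral (s.indicator fun _ => c) B = B c (ν s) := by
        rw [VectorMeasure.integral_eq_setToFun]
        exact setToFun_indicator_const _ hs (measure_ne_top _ _) c
      have e2 : (fun z => B (s.indicator (fun _ => c) z) (u z)) = s.indicator fun z => B c (u z) := by
        ext z
        by_cases hz : z ∈ s <;> simp [hz]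
      rw [e0, e1, e2, integral_indicator hs, ContinuousLinearMap.integral_comp_comm _ hu.integrableOn,
        hν, withDensityᵥ_apply hu hs]
    | add _ hf hg =>
      rename_i f g _
      have e1 : ν.integral ⇑(f + g) B = ν.integral f B + ν.integral g B :=
        VectorMeasure.integral_add (f.integrable_of_isFiniteMeasure)
          (g.integrable_of_isFiniteMeasure)
      rw [e1, hf, hg, ← integral_add (hi f) (hi g)]
      simp only [SimpleFunc.coe_add, Pi.add_apply, map_add, add_apply]
  have hC' : ∀ z, ‖f z‖ ≤ |C| := fun z => (hC z).trans (le_abs_self C)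
  have l1 : Tendsto (fun n => ν.integral (hf.approxBounded |C| n) B) atTop (𝓝 (ν.integral f B)) :=
    VectorMeasure.tendsto_integral_of_dominated_convergence (fun _ => |C|)
      (fun n => (hf.approxBounded |C| n).stronglyMeasurable.aestronglyMeasurable)
      (integrable_const _)
      (fun n => ae_of_all _ fun z => hf.norm_approxBounded_le (abs_nonneg C) n z)
      (ae_of_all _ fun z => hf.tendsto_approxBounded_of_norm_le (hC' z))
  have l2 : Tendsto (fun n => ∫ z, B (hf.approxBounded |C| n z) (u z) ∂m) atTop
      (𝓝 (∫ z, B (f z) (u z) ∂m)) :=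
    tendsto_integral_of_dominated_convergence (fun z => ‖B‖ * |C| * ‖u z‖) (fun n => hmeas _)
      (hu.norm.const_mul _)
      (fun n => ae_of_all _ (hb |C| _ fun z => hf.norm_approxBounded_le (abs_nonneg C) n z))
      (ae_of_all _ fun z => ((B.flip (u z)).continuous.tendsto _).comp
        (hf.tendsto_approxBounded_of_norm_le (hC' z)))
  refine tendsto_nhds_unique (l1.congr fun n => simple _) l2

variable {U : Submodule ℝ (E d)}

theorem dotIntegral_withDensity (m : Measure (X d)) {u : X d → U} (hu : Integrable u m)
    {f : X d → E d} (hf : StronglyMeasurable f) {C : ℝ} (hC : ∀ z, ‖f z‖ ≤ C) :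
    dotIntegral (m.withDensityᵥ u) f = ∫ z, ⟪f z, (u z : E d)⟫ ∂m :=
  integral_withDensityᵥ m hu (pairing U) hf hC

end Density

/-! ### Test functions, the drift, and the continuity equation as a transport equation -/

theorem deriv_time_eq {φ : E d × ℝ → ℝ} (hφ : ContDiff ℝ (⊤ : ℕ∞) φ) (y : E d) (t : ℝ) :
    deriv (fun s => φ (y, s)) t = fderiv ℝ φ (y, t) (0, 1) := by
  have h1 := (hφ.differentiable (by simp) (y, t)).hasFDerivAt
  have h2 : HasDerivAt (fun s : ℝ => (y, s)) ((0 : E d), (1 : ℝ)) t :=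
    (hasDerivAt_const t y).prodMk (hasDerivAt_id t)
  exact (h1.comp_hasDerivAt t h2).deriv

theorem fderiv_space_eq {φ : E d × ℝ → ℝ} (hφ : ContDiff ℝ (⊤ : ℕ∞) φ) (y : E d) (t : ℝ) :
    fderiv ℝ (fun x => φ (x, t)) y
      = (fderiv ℝ φ (y, t)).comp (ContinuousLinearMap.inl ℝ (E d) ℝ) := by
  have h1 := (hφ.differentiable (by simp) (y, t)).hasFDerivAt
  have h2 : HasFDerivAt (fun x : E d => (x, t)) (ContinuousLinearMap.inl ℝ (E d) ℝ) y :=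
    hasFDerivAt_prodMk_left y t
  exact (h1.comp y h2).fderiv

theorem gradient_eq_toDual_symm (f : E d → ℝ) (y : E d) :
    gradient f y = (InnerProductSpace.toDual ℝ (E d)).symm (fderiv ℝ f y) := rfl

theorem norm_gradient (f : E d → ℝ) (y : E d) : ‖gradient f y‖ = ‖fderiv ℝ f y‖ := by
  rw [gradient_eq_toDual_symm, LinearIsometryEquiv.norm_map]

section TestFunction

variable {φ : E d × ℝ → ℝ} (hφ : ContDiff ℝ (⊤ : ℕ∞) φ) (hc : HasCompactSupport φ)
include hφ

theorem continuous_deriv_time :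
    Continuous fun z : X d => deriv (fun s => φ (z.1, s)) (z.2 : ℝ) := by
  simp only [deriv_time_eq hφ]
  have := hφ.continuous_fderiv (by simp)
  fun_prop

theorem continuous_gradient_space :
    Continuous fun z : X d => gradient (fun x => φ (x, (z.2 : ℝ))) z.1 := by
  simp only [gradient_eq_toDual_symm, fderiv_space_eq hφ]
  have := hφ.continuous_fderiv (by simp)
  refine (LinearIsometryEquiv.continuous _).comp ?_
  fun_prop

include hc

theorem exists_bound_test : ∃ C : ℝ, 0 ≤ C ∧ ∀ z : X d,
    ‖deriv (fun s => φ (z.1, s)) (z.2 : ℝ)‖ ≤ C ∧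
    ‖gradient (fun x => φ (x, (z.2 : ℝ))) z.1‖ ≤ C := by
  obtain ⟨C, hC⟩ := (hc.fderiv ℝ).exists_bound_of_continuous (hφ.continuous_fderiv (by simp))
  have hC0 : 0 ≤ C := (norm_nonneg _).trans (hC 0)
  refine ⟨C, hC0, fun z => ⟨?_, ?_⟩⟩
  · rw [deriv_time_eq hφ]
    refine (ContinuousLinearMap.le_opNorm _ _).trans ?_
    rw [Prod.norm_mk]
    simpa using hC _
  · rw [norm_gradient, fderiv_space_eq hφ]
    refine (ContinuousLinearMap.opNorm_comp_le _ _).trans ?_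
    calc _ ≤ C * 1 := mul_le_mul (hC _) (ContinuousLinearMap.norm_inl_le_one ℝ (E d) ℝ)
          (norm_nonneg _) hC0
      _ = C := mul_one C

end TestFunction

/-- The curve `μ` is a weak solution of `∂_t μ_t + ∇ · (V μ_t) = 0`. -/
def TransportedBy (μ : Curve d) (V : X d → E d) : Prop :=
  Integrable V μ.spaceTime ∧ ∀ φ : E d × ℝ → ℝ, ContDiff ℝ (⊤ : ℕ∞) φ → HasCompactSupport φ →
    tsupport φ ⊆ univ ×ˢ Ioo 0 1 →
    ∫ z, (deriv (fun s : ℝ => φ (z.1, s)) (z.2 : ℝ)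
      + ⟪gradient (fun x => φ (x, (z.2 : ℝ))) z.1, V z⟫) ∂μ.spaceTime = 0

theorem integrable_inner_of_bound {m : Measure (X d)} {g V : X d → E d} (hg : Continuous g)
    {C : ℝ} (hC : ∀ z, ‖g z‖ ≤ C) (hV : Integrable V m) :
    Integrable (fun z => ⟪g z, V z⟫) m := by
  refine Integrable.mono' (hV.norm.const_mul C) (hg.aestronglyMeasurable.inner hV.1)
    (ae_of_all _ fun z => ?_)
  exact (norm_inner_le_norm _ _).trans (mul_le_mul_of_nonneg_right (hC z) (norm_nonneg _))

section Drift

variable {F : E d → P1 d → E d} (hF : IsDrift F)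
include hF

theorem IsDrift.continuous (μ : Curve d) : Continuous fun z : X d => F z.1 (μ z.2) := by
  rw [continuous_iff_continuousAt]
  intro z
  rw [ContinuousAt, Metric.tendsto_nhds]
  intro ε hε
  obtain ⟨δ, hδ, h⟩ := hF.uniformContinuous ε hε
  have h1 : ∀ᶠ w : X d in 𝓝 z, dist w.1 z.1 < δ :=
    continuous_fst.continuousAt.eventually (Metric.ball_mem_nhds _ hδ)
  have h2 : ∀ᶠ w : X d in 𝓝 z, W1 (μ w.2) (μ z.2) < ENNReal.ofReal δ :=
    continuous_snd.continuousAt.eventually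
      ((μ.continuous_W1 z.2).eventually (gt_mem_nhds (ENNReal.ofReal_pos.2 hδ)))
  filter_upwards [h1, h2] with w hw1 hw2 using h _ _ _ _ hw1 hw2

omit hF in
theorem P1.moment_nonneg (μ : P1 d) : 0 ≤ μ.moment := integral_nonneg fun _ => norm_nonneg _

/-- All constants are absorbed into the bracket because ⟨y⟩ ≥ 1. -/
theorem IsDrift.exists_norm_le (M : ℝ) (hM : 0 ≤ M) :
    ∃ c, 0 ≤ c ∧ ∀ (y : E d) (μ : P1 d), μ.moment ≤ M → ‖F y μ‖ ≤ c * bracket y := by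
  obtain ⟨C, C', hC, hC', h⟩ := hF.growth
  refine ⟨C + C' + C' * M, by positivity, fun y μ hμ => (h y μ).trans ?_⟩
  have h1 := one_le_bracket y
  have h2 := norm_le_bracket y
  have h3 : C' * μ.moment ≤ C' * M := mul_le_mul_of_nonneg_left hμ hC'
  have h4 : C' * ‖y‖ ≤ C' * bracket y := mul_le_mul_of_nonneg_left h2 hC'
  have h5 : C ≤ C * bracket y := le_mul_of_one_le_right hC h1
  have h6 : C' * M ≤ C' * M * bracket y := le_mul_of_one_le_right (by positivity) h1
  linarith

omit hF in
theorem Curve.exists_moment_le (μ : Curve d) : ∃ M, 0 ≤ M ∧ ∀ t, (μ t).moment ≤ M := by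
  have hc : Continuous fun t => (μ t).moment := μ.continuous_integral lipschitzWith_one_norm
  obtain ⟨t₀, -, h⟩ := isCompact_univ.exists_isMaxOn univ_nonempty hc.continuousOn
  exact ⟨_, (μ t₀).moment_nonneg, fun t => h (mem_univ t)⟩

theorem IsDrift.integrable (μ : Curve d) :
    Integrable (fun z : X d => F z.1 (μ z.2)) μ.spaceTime := by
  obtain ⟨M, hM, hμ⟩ := μ.exists_moment_le
  obtain ⟨c, -, hc⟩ := hF.exists_norm_le M hM
  exact Integrable.mono' ((μ.integrable_spaceTime_lipschitz lipschitz_bracket).const_mul c)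
    (hF.continuous μ).aestronglyMeasurable (ae_of_all _ fun z => hc _ _ (hμ _))

/-- In the presence of a density, the continuity equation is a transport equation. -/
theorem solvesContinuityEquation_iff {U : Submodule ℝ (E d)} {μ : Curve d}
    {ν : VectorMeasure (X d) U} {u : X d → U} (hu : IsDensity ν μ u) :
    SolvesContinuityEquation F μ ν ↔ TransportedBy μ fun z => F z.1 (μ z.2) + (u z : E d) := by
  have hui : Integrable (fun z => (u z : E d)) μ.spaceTime :=
    U.subtypeL.integrable_comp hu.1
  have hFi := hF.integrable μ
  have hV : Integrable (fun z => F z.1 (μ z.2) + (u z : E d)) μ.spaceTime := hFi.add hui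
  rw [TransportedBy, and_iff_right hV, SolvesContinuityEquation]
  refine forall_congr' fun φ => forall_congr' fun hφ => forall_congr' fun hc =>
    forall_congr' fun _ => ?_
  obtain ⟨C, -, hC⟩ := exists_bound_test hφ hc
  have c1 := continuous_deriv_time (d := d) hφ
  have c2 := continuous_gradient_space (d := d) hφ
  have i1 : Integrable (fun z : X d => deriv (fun s => φ (z.1, s)) (z.2 : ℝ)) μ.spaceTime :=
    Integrable.of_bound c1.aestronglyMeasurable C (ae_of_all _ fun z => (hC z).1)
  have i2 := integrable_inner_of_bound c2 (fun z => (hC z).2) hFi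
  have i3 := integrable_inner_of_bound c2 (fun z => (hC z).2) hui
  rw [hu.2, dotIntegral_withDensity μ.spaceTime hu.1 c2.stronglyMeasurable fun z => (hC z).2,
    ← μ.integral_spaceTime (f := fun z : X d => deriv (fun s : ℝ => φ (z.1, s)) z.2
        + ⟪gradient (fun x => φ (x, (z.2 : ℝ))) z.1, F z.1 (μ z.2)⟫) (i1.add i2),
    ← integral_add (by exact i1.add i2) i3]
  simp only [inner_add_right, add_assoc]

end Drift

end MFC

/-! ### Solutions of transport equations -/

namespace MFC

variable {d : ℕ} {μ : Curve d} {V : X d → E d}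

theorem integrable_fderiv_apply {m : Measure (X d)} {ζ : E d → ℝ} (hζ : ContDiff ℝ (⊤ : ℕ∞) ζ)
    {K : ℝ} (hK : ∀ y, ‖fderiv ℝ ζ y‖ ≤ K) (hV : Integrable V m) :
    Integrable (fun z => fderiv ℝ ζ z.1 (V z)) m := by
  refine Integrable.mono' (hV.norm.const_mul K) ?_ (ae_of_all _ fun z => ?_)
  · exact (ContinuousLinearMap.apply ℝ ℝ : E d →L[ℝ] (E d →L[ℝ] ℝ) →L[ℝ] ℝ).flip.aestronglyMeasurable_comp₂
      ((hζ.continuous_fderiv (by simp)).comp continuous_fst).aestronglyMeasurable hV.1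
  · exact (ContinuousLinearMap.le_opNorm _ _).trans
      (mul_le_mul_of_nonneg_right (hK _) (norm_nonneg _))

/-- Integrals of compactly supported smooth functions along a solution of a transport equation. -/
theorem TransportedBy.integral_sub_of_hasCompactSupport (hV : TransportedBy μ V) {ζ : E d → ℝ}
    (hζ : ContDiff ℝ (⊤ : ℕ∞) ζ) (hc : HasCompactSupport ζ) {s t : unitInterval} (hst : s ≤ t) :
    ∫ y, ζ y ∂(μ t).toMeasure - ∫ y, ζ y ∂(μ s).toMeasure
      = ∫ z in Prod.snd ⁻¹' Ioc s t, fderiv ℝ ζ z.1 (V z) ∂μ.spaceTime := by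
  obtain ⟨K, hK⟩ := hζ.lipschitzWith_of_hasCompactSupport hc (by simp)
  obtain ⟨C, hC⟩ := (hc.fderiv ℝ).exists_bound_of_continuous (hζ.continuous_fderiv (by simp))
  have hi := integrable_fderiv_apply hζ hC hV.1
  rw [μ.setIntegral_spaceTime hi measurableSet_Ioc]
  -- Product test functions η(t)ζ(y) turn the equation into a statement about the weak derivative of
  -- t ↦ ∫ ζ dμ_t.
  refine sub_eq_integral_of_weak_deriv (h := fun t => ∫ y, ζ y ∂(μ t).toMeasure)
    (μ.continuous_integral hK) (μ.integrable_integral hi) (fun η hη hηc hηs => ?_) hst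
  have hφ : ContDiff ℝ (⊤ : ℕ∞) fun z : E d × ℝ => η z.2 * ζ z.1 :=
    (hη.comp contDiff_snd).mul (hζ.comp contDiff_fst)
  have hsub : Function.support (fun z : E d × ℝ => η z.2 * ζ z.1) ⊆ tsupport ζ ×ˢ tsupport η := by
    intro z hz
    exact ⟨subset_tsupport _ (right_ne_zero_of_mul hz), subset_tsupport _ (left_ne_zero_of_mul hz)⟩
  have key := hV.2 _ hφ (HasCompactSupport.of_support_subset_isCompact (hc.prod hηc) hsub)
    ((closure_minimal hsub ((isClosed_tsupport ζ).prod (isClosed_tsupport η))).trans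
      fun z hz => ⟨mem_univ _, hηs hz.2⟩)
  obtain ⟨Cη, hCη⟩ := hηc.exists_bound_of_continuous hη.continuous
  have i1 : Integrable (fun z : X d => deriv η (z.2 : ℝ) * ζ z.1) μ.spaceTime := by
    obtain ⟨Cd, hCd⟩ := hηc.deriv.exists_bound_of_continuous (hη.continuous_deriv (by simp))
    refine (μ.integrable_spaceTime_lipschitz hK).bdd_mul (c := Cd) ?_ (ae_of_all _ fun z => hCd _)
    have := hη.continuous_deriv (by simp)
    exact (show Continuous fun z : X d => deriv η (z.2 : ℝ) by fun_prop).aestronglyMeasurable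
  have i2 : Integrable (fun z : X d => η (z.2 : ℝ) * fderiv ℝ ζ z.1 (V z)) μ.spaceTime := by
    refine hi.bdd_mul (c := Cη) ?_ (ae_of_all _ fun z => hCη _)
    have := hη.continuous
    exact (show Continuous fun z : X d => η (z.2 : ℝ) by fun_prop).aestronglyMeasurable
  have e : ∀ z : X d, deriv (fun s : ℝ => η (z.1, s).2 * ζ (z.1, s).1) (z.2 : ℝ)
      + ⟪gradient (fun x => η (x, (z.2 : ℝ)).2 * ζ (x, (z.2 : ℝ)).1) z.1, V z⟫
      = deriv η (z.2 : ℝ) * ζ z.1 + η (z.2 : ℝ) * fderiv ℝ ζ z.1 (V z) := by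
    intro z
    rw [inner_gradient_left]
    simp only
    rw [fderiv_const_mul (hζ.differentiable (by simp) z.1),
      deriv_mul_const (hη.differentiable (by simp) _)]
    rfl
  rw [integral_congr_ae (ae_of_all _ e)] at key
  rw [← key, μ.integral_spaceTime (by exact i1.add i2)]
  refine integral_congr_ae ?_
  filter_upwards [(Measure.integrable_compProd_iff (μ.integrable_spaceTime.1 i2).1).1
    (μ.integrable_spaceTime.1 i2) |>.1] with t ht
  rw [integral_add (((μ t).integrable_of_lipschitz hK).const_mul _) ht, integral_const_mul,
    integral_const_mul]

/-- Integrals of smooth Lipschitz functions along a solution of a transport equation. -/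
theorem TransportedBy.integral_sub (hV : TransportedBy μ V) {ζ : E d → ℝ}
    (hζ : ContDiff ℝ (⊤ : ℕ∞) ζ) {K : NNReal} (hK : ∀ y, ‖fderiv ℝ ζ y‖ ≤ K)
    {s t : unitInterval} (hst : s ≤ t) :
    ∫ y, ζ y ∂(μ t).toMeasure - ∫ y, ζ y ∂(μ s).toMeasure
      = ∫ z in Prod.snd ⁻¹' Ioc s t, fderiv ℝ ζ z.1 (V z) ∂μ.spaceTime := by
  have hL : LipschitzWith K ζ :=
    lipschitzWith_of_nnnorm_fderiv_le (hζ.differentiable (by simp)) hK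
  let χ : ContDiffBump (0 : E d) := ⟨1, 2, one_pos, one_lt_two⟩
  have hχ : ContDiff ℝ (⊤ : ℕ∞) χ := χ.contDiff
  obtain ⟨B, hB⟩ := (χ.hasCompactSupport.fderiv ℝ).exists_bound_of_continuous
    (hχ.continuous_fderiv (by simp))
  have hB0 : 0 ≤ B := (norm_nonneg _).trans (hB 0)
  set a : ℕ → ℝ := fun n => ((n : ℝ) + 1)⁻¹ with ha
  have ha0 : ∀ n, 0 < a n := fun n => by positivity
  have ha1 : ∀ n, a n ≤ 1 := fun n => inv_le_one_of_one_le₀ (by linarith [n.cast_nonneg (α := ℝ)])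
  have hat : Tendsto a atTop (𝓝 0) := by
    simpa [ha] using tendsto_one_div_add_atTop_nhds_zero_nat (𝕜 := ℝ)
  set χn : ℕ → E d → ℝ := fun n y => χ (a n • y) with hχn
  have hχns : ∀ n, ContDiff ℝ (⊤ : ℕ∞) (χn n) := fun n => hχ.comp (contDiff_const_smul _)
  have hχnf : ∀ n y, fderiv ℝ (χn n) y = a n • fderiv ℝ χ (a n • y) := fun n y => by
    have h1 := (hχ.differentiable (by simp) (a n • y)).hasFDerivAt.comp y
      ((hasFDerivAt_id y).const_smul (a n))
    have h2 : fderiv ℝ (χn n) y = _ := h1.fderiv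
    rw [h2]
    ext v; simp
  have hχc : ∀ n, HasCompactSupport (χn n) := fun n =>
    χ.hasCompactSupport.comp_smul (ha0 n).ne'
  have hone : ∀ y, ∀ᶠ n in atTop, χn n =ᶠ[𝓝 y] fun _ => 1 := by
    intro y
    have h1 : Tendsto (fun n => ‖a n • y‖) atTop (𝓝 0) := by
      simpa using (hat.smul_const y).norm
    filter_upwards [h1.eventually (gt_mem_nhds one_pos)] with n hn
    have hcont : Continuous fun x : E d => ‖a n • x‖ := by fun_prop
    filter_upwards [hcont.continuousAt.eventually (gt_mem_nhds hn)] with x hx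
    exact χ.one_of_mem_closedBall (mem_closedBall_zero_iff.2 hx.le)
  set ζn : ℕ → E d → ℝ := fun n y => χn n y * ζ y with hζn
  have hζns : ∀ n, ContDiff ℝ (⊤ : ℕ∞) (ζn n) := fun n => (hχns n).mul hζ
  have hζnc : ∀ n, HasCompactSupport (ζn n) := fun n => (hχc n).mul_right
  -- The cutoff has gradient of order `a n`, while ζ grows at most linearly; on the support of that
  -- gradient `a n * ‖y‖ ≤ 2`, so the product stays bounded uniformly in n.
  have hζnf : ∀ n y, ‖fderiv ℝ (ζn n) y‖ ≤ K + (|ζ 0| + 2 * K) * B := by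
    intro n y
    have h1 : fderiv ℝ (ζn n) y = χn n y • fderiv ℝ ζ y + ζ y • fderiv ℝ (χn n) y :=
      fderiv_fun_mul ((hχns n).differentiable (by simp) y) (hζ.differentiable (by simp) y)
    rw [h1]
    refine (norm_add_le _ _).trans (add_le_add ?_ ?_)
    · rw [norm_smul, Real.norm_of_nonneg χ.nonneg]
      exact (mul_le_of_le_one_left (norm_nonneg _) χ.le_one).trans (hK y)
    · rw [hχnf, norm_smul, norm_smul, Real.norm_of_nonneg (ha0 n).le]
      by_cases hy : fderiv ℝ χ (a n • y) = 0
      · rw [hy, norm_zero, mul_zero, mul_zero]; positivity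
      · have h2 : a n • y ∈ tsupport χ := support_fderiv_subset ℝ hy
        rw [χ.tsupport_eq, mem_closedBall_zero_iff, norm_smul, Real.norm_of_nonneg (ha0 n).le] at h2
        have h3 : |ζ y| ≤ |ζ 0| + K * ‖y‖ := by
          have h4 := hL.dist_le_mul y 0
          rw [dist_zero_right, Real.dist_eq] at h4
          linarith [abs_sub_abs_le_abs_sub (ζ y) (ζ 0)]
        rw [← mul_assoc]
        refine mul_le_mul ?_ (hB _) (norm_nonneg _) (by positivity)
        have h5 : a n * ‖y‖ ≤ 2 := h2
        calc ‖ζ y‖ * a n ≤ (|ζ 0| + K * ‖y‖) * a n := by gcongr; exact h3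
          _ = |ζ 0| * a n + K * (a n * ‖y‖) := by ring
          _ ≤ |ζ 0| * 1 + K * 2 := by gcongr; exact ha1 n
          _ = _ := by ring
  have hζnv : ∀ n y, |ζn n y| ≤ |ζ y| := fun n y => by
    rw [hζn]
    simp only
    rw [abs_mul, abs_of_nonneg χ.nonneg]
    exact mul_le_of_le_one_left (abs_nonneg _) χ.le_one
  have lim : ∀ r, Tendsto (fun n => ∫ y, ζn n y ∂(μ r).toMeasure) atTop
      (𝓝 (∫ y, ζ y ∂(μ r).toMeasure)) := fun r =>
    tendsto_integral_of_dominated_convergence (fun y => |ζ y|)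
      (fun n => (hζns n).continuous.aestronglyMeasurable) ((μ r).integrable_of_lipschitz hL).abs
      (fun n => ae_of_all _ (hζnv n)) (ae_of_all _ fun y => by
        refine tendsto_const_nhds.congr' ?_
        filter_upwards [hone y] with n hn
        rw [hζn]
        simp only
        rw [hn.self_of_nhds, one_mul])
  have lim2 : Tendsto (fun n => ∫ z in Prod.snd ⁻¹' Ioc s t, fderiv ℝ (ζn n) z.1 (V z) ∂μ.spaceTime)
      atTop (𝓝 (∫ z in Prod.snd ⁻¹' Ioc s t, fderiv ℝ ζ z.1 (V z) ∂μ.spaceTime)) := by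
    refine tendsto_integral_of_dominated_convergence
      (fun z => (K + (|ζ 0| + 2 * K) * B) * ‖V z‖)
      (fun n => (integrable_fderiv_apply (hζns n) (hζnf n) hV.1.integrableOn).1)
      (hV.1.norm.const_mul _).integrableOn
      (fun n => ae_of_all _ fun z => (ContinuousLinearMap.le_opNorm _ _).trans
        (mul_le_mul_of_nonneg_right (hζnf n _) (norm_nonneg _)))
      (ae_of_all _ fun z => ?_)
    refine tendsto_const_nhds.congr' ?_
    filter_upwards [hone z.1] with n hn
    have : ζn n =ᶠ[𝓝 z.1] ζ := by
      filter_upwards [hn] with x hx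
      rw [hζn]
      simp only
      rw [hx, one_mul]
    rw [this.fderiv_eq]
  refine tendsto_nhds_unique (((lim t).sub (lim s)).congr fun n => ?_) lim2
  exact hV.integral_sub_of_hasCompactSupport (hζns n) (hζnc n) hst

/-- Lipschitz functions are uniform limits of smooth functions with the same Lipschitz constant. -/
theorem exists_contDiff_lipschitz_approx {f : E d → ℝ} (hf : LipschitzWith 1 f) {ε : ℝ}
    (hε : 0 < ε) : ∃ g : E d → ℝ, ContDiff ℝ (⊤ : ℕ∞) g ∧ LipschitzWith 1 g ∧
      ∀ x, |g x - f x| ≤ ε := by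
  let φ : ContDiffBump (0 : E d) := ⟨ε / 2, ε, by positivity, by linarith⟩
  have hli : LocallyIntegrable f (volume : Measure (E d)) := hf.continuous.locallyIntegrable
  have hcc : HasCompactSupport (φ.normed (volume : Measure (E d))) := φ.hasCompactSupport_normed
  have hcont : Continuous (φ.normed (volume : Measure (E d))) := φ.continuous_normed
  refine ⟨convolution (φ.normed volume) f (ContinuousLinearMap.lsmul ℝ ℝ) volume,
    hcc.contDiff_convolution_left _ φ.contDiff_normed hli, ?_, fun x => ?_⟩
  · refine LipschitzWith.of_dist_le_mul fun x y => ?_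
    have hex : ∀ x, Integrable (fun t => φ.normed volume t * f (x - t)) (volume : Measure (E d)) :=
      fun x => (hcont.mul (hf.continuous.comp (by fun_prop))).integrable_of_hasCompactSupport
        hcc.mul_right
    simp only [convolution, ContinuousLinearMap.lsmul_apply, smul_eq_mul]
    rw [Real.dist_eq, ← integral_sub (hex x) (hex y), ← Real.norm_eq_abs]
    have := norm_integral_le_of_norm_le (μ := (volume : Measure (E d)))
      (f := fun t => φ.normed volume t * f (x - t) - φ.normed volume t * f (y - t))
      (g := fun t => φ.normed volume t * dist x y)
      ((hcont.integrable_of_hasCompactSupport hcc).mul_const _) (ae_of_all _ fun t => by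
        rw [← mul_sub, norm_mul, Real.norm_of_nonneg (φ.nonneg_normed t)]
        refine mul_le_mul_of_nonneg_left ?_ (φ.nonneg_normed t)
        simpa [Real.dist_eq] using hf.dist_le_mul (x - t) (y - t))
    rw [integral_mul_const, φ.integral_normed, one_mul] at this
    simpa using this
  · have := φ.dist_normed_convolution_le (μ := (volume : Measure (E d))) (g := f) (x₀ := x) (ε := ε)
      hf.continuous.aestronglyMeasurable fun y hy => by
        have h1 := hf.dist_le_mul y x
        simp only [NNReal.coe_one, one_mul] at h1
        exact h1.trans (Metric.mem_ball.1 hy).le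
    rwa [Real.dist_eq] at this

/-- The Wasserstein distance along a solution of a transport equation is controlled by the `L¹`-norm
of the velocity. -/
theorem TransportedBy.W1_le (hV : TransportedBy μ V) {s t : unitInterval} (hst : s ≤ t) :
    W1 (μ s) (μ t) ≤ ENNReal.ofReal (∫ z in Prod.snd ⁻¹' Ioc s t, ‖V z‖ ∂μ.spaceTime) := by
  rw [W1_comm]
  refine W1_le_of_forall _ _ _ fun f hf => ?_
  refine le_of_forall_pos_le_add fun ε hε => ?_
  -- Duality tests with all 1-Lipschitz functions, the transport identity only with smooth ones; the
  -- two errors ε/2, at times s and t, bridge the gap.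
  obtain ⟨g, hg, hgl, hgf⟩ := exists_contDiff_lipschitz_approx hf (half_pos hε)
  have hfg : ∀ m : P1 d, |∫ y, g y ∂m.toMeasure - ∫ y, f y ∂m.toMeasure| ≤ ε / 2 := by
    intro m
    rw [← MeasureTheory.integral_sub (m.integrable_of_lipschitz hgl) (m.integrable_of_lipschitz hf),
      ← Real.norm_eq_abs]
    have := norm_integral_le_of_norm_le (f := fun y => g y - f y) (integrable_const (ε / 2))
      (ae_of_all m.toMeasure hgf)
    simpa using this
  have hK : ∀ y, ‖fderiv ℝ g y‖ ≤ (1 : NNReal) := fun y => norm_fderiv_le_of_lipschitz ℝ hgl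
  have h1 := hV.integral_sub hg hK hst
  have h2 : ∫ z in Prod.snd ⁻¹' Ioc s t, fderiv ℝ g z.1 (V z) ∂μ.spaceTime
      ≤ ∫ z in Prod.snd ⁻¹' Ioc s t, ‖V z‖ ∂μ.spaceTime := by
    refine integral_mono (integrable_fderiv_apply hg hK hV.1).integrableOn hV.1.norm.integrableOn
      fun z => (Real.le_norm_self _).trans ((ContinuousLinearMap.le_opNorm _ _).trans ?_)
    exact mul_le_of_le_one_left (norm_nonneg _) (hK _)
  linarith [abs_le.1 (hfg (μ s)), abs_le.1 (hfg (μ t))]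

/-- The majorant of the metric speed is r ↦ ∫ ‖V(·, r)‖ dμ_r, integrable by Fubini. Absolute
continuity of a limit curve thus follows from its equation. -/
theorem TransportedBy.isAC (hV : TransportedBy μ V) : μ.IsAC := by
  have hi := μ.integrable_integral hV.1.norm
  refine ⟨fun r => ∫ y, ‖V (y, projIcc 0 1 zero_le_one r)‖ ∂(μ (projIcc 0 1 zero_le_one r)).toMeasure,
    ?_, fun s t hst => ?_⟩
  · rw [intervalIntegrable_iff_integrableOn_Icc_of_le zero_le_one]
    exact integrableOn_unitInterval hi
  · rw [← setIntegral_unitInterval (fun t => ∫ y, ‖V (y, t)‖ ∂(μ t).toMeasure) hst,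
      ← μ.setIntegral_spaceTime hV.1.norm measurableSet_Ioc]
    exact hV.W1_le hst

/-! ### Grönwall's inequality and a priori estimates -/

/-- **Grönwall's inequality** in integral form on the unit interval. -/
theorem le_mul_exp_of_le_add_integral {A : unitInterval → ℝ} (hA : Continuous A) {b c : ℝ}
    (hc : 0 ≤ c) (hb : 0 ≤ b) (h : ∀ t, A t ≤ b + c * ∫ r in Ioc 0 t, A r) (t : unitInterval) :
    A t ≤ b * Real.exp c := by
  set a : ℝ → ℝ := fun r => A (projIcc 0 1 zero_le_one r) with ha
  have hac : Continuous a := hA.comp continuous_projIcc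
  set P : ℝ → ℝ := fun x => ∫ r in (0 : ℝ)..x, a r with hP
  have hPd : ∀ x, HasDerivAt P (a x) x := fun x => (hac.integral_hasStrictDerivAt 0 x).hasDerivAt
  have hle : ∀ x ∈ Icc (0 : ℝ) 1, a x ≤ b + c * P x := by
    intro x hx
    have := h ⟨x, hx⟩
    rw [setIntegral_unitInterval A (show (0 : unitInterval) ≤ ⟨x, hx⟩ from hx.1)] at this
    simp only [ha, hP, projIcc_of_mem zero_le_one hx]
    exact this
  -- The hypothesis says exactly that this function has nonpositive derivative; it starts at `b`.
  set g : ℝ → ℝ := fun x => (b + c * P x) * Real.exp (-(c * x)) with hg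
  have hgd : ∀ x, HasDerivAt g (c * a x * Real.exp (-(c * x))
      + (b + c * P x) * (Real.exp (-(c * x)) * -(c * 1))) x := fun x =>
    (((hPd x).const_mul c).const_add b).mul (((hasDerivAt_id x).const_mul c).neg.exp)
  have hanti : AntitoneOn g (Icc 0 1) := by
    refine antitoneOn_of_deriv_nonpos (convex_Icc 0 1)
      (fun x _ => (hgd x).continuousAt.continuousWithinAt)
      (fun x _ => (hgd x).differentiableAt.differentiableWithinAt) fun x hx => ?_
    rw [interior_Icc] at hx
    rw [(hgd x).deriv]
    have h1 := hle x ⟨hx.1.le, hx.2.le⟩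
    have h2 : 0 ≤ c * Real.exp (-(c * x)) * (b + c * P x - a x) :=
      mul_nonneg (by positivity) (by linarith)
    linarith
  have h1 : g t ≤ g 0 := hanti ⟨le_rfl, zero_le_one⟩ t.2 t.2.1
  have h2 : g 0 = b := by simp [hg, hP]
  rw [h2, hg] at h1
  simp only at h1
  rw [Real.exp_neg, ← div_eq_mul_inv, div_le_iff₀ (Real.exp_pos _)] at h1
  have h3 : A t ≤ b + c * P t := by
    have := hle t t.2
    simpa [ha, projIcc_val] using this
  refine h3.trans (h1.trans (mul_le_mul_of_nonneg_left (Real.exp_le_exp.2 ?_) hb))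
  exact mul_le_of_le_one_right hc t.2.2

variable {U : Submodule ℝ (E d)} {ψ : U → ℝ} {F : E d → P1 d → E d} {m₀ : P1 d}

/-- Superlinearity gives φ(r) ≥ r/ε for large r. Since ε is arbitrary, bounded cost makes the
controls uniformly integrable. -/
theorem IsControlCost.exists_norm_le (hψ : IsControlCost U ψ) {ε : ℝ} (hε : 0 < ε) :
    ∃ C, 0 ≤ C ∧ ∀ x, ‖x‖ ≤ ε * ψ x + C := by
  obtain ⟨φ, hφ0, -, -, -, -, hlim, -, C, -, hb⟩ := hψ.exists_moderating
  obtain ⟨r₀, hr₀⟩ := eventually_atTop.1 (hlim.eventually_ge_atTop ε⁻¹)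
  -- The summand ε pays for the -1 in φ(‖x‖) - 1 ≤ ψ(x); `max r₀ 1` covers small x, the 1 making ‖x‖
  -- positive in the other case.
  refine ⟨ε + max r₀ 1, by positivity, fun x => ?_⟩
  by_cases hx : max r₀ 1 ≤ ‖x‖
  · have h1 := hr₀ ‖x‖ ((le_max_left _ _).trans hx)
    have hpos : 0 < ‖x‖ := one_pos.trans_le ((le_max_right _ _).trans hx)
    rw [le_div_iff₀ hpos, inv_mul_le_iff₀ hε] at h1
    have h2 : ε * φ ‖x‖ ≤ ε * (ψ x + 1) := mul_le_mul_of_nonneg_left (by linarith [(hb x).1]) hε.le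
    linarith [le_max_right r₀ 1]
  · have := mul_nonneg hε.le (hψ.nonneg x)
    linarith [not_le.1 hx]

/-- `μ` starts at `m₀` and solves the continuity equation with control `u`, whose cost is at
most `B`. -/
structure Controlled (F : E d → P1 d → E d) (ψ : U → ℝ) (m₀ : P1 d) (B : ℝ) (μ : Curve d)
    (u : X d → U) : Prop where
  integrable : Integrable u μ.spaceTime
  transported : TransportedBy μ fun z => F z.1 (μ z.2) + (u z : E d)
  initial : μ 0 = m₀
  integrable_cost : Integrable (fun z => ψ (u z)) μ.spaceTime
  cost_le : ∫ z, ψ (u z) ∂μ.spaceTime ≤ B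

variable {B : ℝ} {μ : Curve d} {u : X d → U}

theorem Controlled.setIntegral_cost_le (hψ : IsControlCost U ψ) (h : Controlled F ψ m₀ B μ u)
    (s : Set (X d)) : ∫ z in s, ψ (u z) ∂μ.spaceTime ≤ B :=
  (setIntegral_le_integral h.integrable_cost (ae_of_all _ fun _ => hψ.nonneg _)).trans h.cost_le

/-- The transport identity for the weight, with the velocity split into drift and control: the
common start of the moment and tail bounds. -/
theorem Controlled.integral_weight_le (hF : IsDrift F) (h : Controlled F ψ m₀ B μ u) {R : ℝ}
    (hR : 0 ≤ R) (t : unitInterval) :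
    ∫ y, weight R y ∂(μ t).toMeasure ≤ ∫ y, weight R y ∂m₀.toMeasure +
      ∫ z in Prod.snd ⁻¹' Ioc 0 t, ‖fderiv ℝ (weight R) z.1‖ * ‖F z.1 (μ z.2)‖ ∂μ.spaceTime +
      ∫ z in Prod.snd ⁻¹' Ioc 0 t, ‖fderiv ℝ (weight R) z.1‖ * ‖u z‖ ∂μ.spaceTime := by
  have hK : ∀ y : E d, ‖fderiv ℝ (weight R) y‖ ≤ (2 : NNReal) := norm_fderiv_weight_le_two hR
  have h1 := h.transported.integral_sub (contDiff_weight hR) hK (s := 0) (t := t) t.2.1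
  rw [h.initial] at h1
  have hm : AEStronglyMeasurable (fun z : X d => ‖fderiv ℝ (weight R) z.1‖) μ.spaceTime :=
    (((contDiff_weight hR).continuous_fderiv (by simp)).comp continuous_fst).norm.aestronglyMeasurable
  have i1 : Integrable (fun z : X d => ‖fderiv ℝ (weight R) z.1‖ * ‖F z.1 (μ z.2)‖) μ.spaceTime :=
    (hF.integrable μ).norm.bdd_mul (c := 2) hm (ae_of_all _ fun z => by simpa using hK z.1)
  have i2 : Integrable (fun z : X d => ‖fderiv ℝ (weight R) z.1‖ * ‖u z‖) μ.spaceTime :=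
    h.integrable.norm.bdd_mul (c := 2) hm (ae_of_all _ fun z => by simpa using hK z.1)
  rw [add_assoc, ← integral_add i1.integrableOn i2.integrableOn]
  rw [sub_eq_iff_eq_add'] at h1
  rw [h1]
  refine add_le_add le_rfl ?_
  refine integral_mono
    (integrable_fderiv_apply (contDiff_weight hR) hK h.transported.1).integrableOn
    (i1.add i2).integrableOn fun z => ?_
  refine (Real.le_norm_self _).trans ((ContinuousLinearMap.le_opNorm _ _).trans ?_)
  rw [← mul_add]
  exact mul_le_mul_of_nonneg_left (norm_add_le _ _) (norm_nonneg _)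

/-- First moments are bounded uniformly over all curves that are controlled at bounded cost. -/
theorem exists_moment_bound (hF : IsDrift F) (hψ : IsControlCost U ψ) (m₀ : P1 d) (B : ℝ) :
    ∃ M, 0 ≤ M ∧ ∀ μ u, Controlled F ψ m₀ B μ u → ∀ t, ∫ y, bracket y ∂(μ t).toMeasure ≤ M := by
  obtain ⟨C, C', hC, hC', hg⟩ := hF.growth
  obtain ⟨D, hD, hu⟩ := hψ.exists_norm_le one_pos
  set b := ∫ y, bracket y ∂m₀.toMeasure + 2 * (|B| + D) with hb
  have hbr : ∀ m : P1 d, 0 ≤ ∫ y, bracket y ∂m.toMeasure := fun m =>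
    integral_nonneg fun y => (bracket_pos y).le
  have hb0 : 0 ≤ b := by have := hbr m₀; positivity
  refine ⟨b * Real.exp (2 * (C + 2 * C')), by positivity, fun μ u h t => ?_⟩
  have hbi : ∀ m : P1 d, Integrable (fun y => bracket y) m.toMeasure := fun m =>
    m.integrable_of_lipschitz lipschitz_bracket
  refine le_mul_exp_of_le_add_integral (A := fun t => ∫ y, bracket y ∂(μ t).toMeasure)
    (μ.continuous_integral lipschitz_bracket) (by positivity) hb0 (fun t => ?_) t
  have h1 := h.integral_weight_le hF le_rfl t
  simp only [weight_zero] at h1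
  have hK : ∀ y : E d, ‖fderiv ℝ (weight 0) y‖ ≤ 2 := norm_fderiv_weight_le_two le_rfl
  have h2 : ∫ z in Prod.snd ⁻¹' Ioc 0 t, ‖fderiv ℝ (weight 0) z.1‖ * ‖u z‖ ∂μ.spaceTime
      ≤ 2 * (|B| + D) := by
    have e1 : ∀ z, ‖fderiv ℝ (weight 0) z.1‖ * ‖u z‖ ≤ 2 * (ψ (u z) + D) := fun z =>
      mul_le_mul (hK _) (by simpa using hu (u z)) (norm_nonneg _) zero_le_two
    calc _ ≤ ∫ z in Prod.snd ⁻¹' Ioc 0 t, 2 * (ψ (u z) + D) ∂μ.spaceTime :=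
          integral_mono_of_nonneg (ae_of_all _ fun z => by positivity)
            ((h.integrable_cost.add (integrable_const D)).const_mul 2).integrableOn
            (ae_of_all _ e1)
      _ ≤ ∫ z, 2 * (ψ (u z) + D) ∂μ.spaceTime :=
          setIntegral_le_integral ((h.integrable_cost.add (integrable_const D)).const_mul 2)
            (ae_of_all _ fun z => by
              have := hψ.nonneg (u z)
              simp only [Pi.zero_apply]; positivity)
      _ = 2 * (∫ z, ψ (u z) ∂μ.spaceTime + D) := by
          rw [integral_const_mul, integral_add h.integrable_cost (integrable_const D)]; simp
      _ ≤ 2 * (|B| + D) := by linarith [h.cost_le, le_abs_self B]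
  have h3 : ∫ z in Prod.snd ⁻¹' Ioc 0 t, ‖fderiv ℝ (weight 0) z.1‖ * ‖F z.1 (μ z.2)‖ ∂μ.spaceTime
      ≤ 2 * (C + 2 * C') * ∫ r in Ioc 0 t, ∫ y, bracket y ∂(μ r).toMeasure := by
    have i0 : Integrable (fun z : X d => 2 * ‖F z.1 (μ z.2)‖) μ.spaceTime :=
      (hF.integrable μ).norm.const_mul 2
    calc _ ≤ ∫ z in Prod.snd ⁻¹' Ioc 0 t, 2 * ‖F z.1 (μ z.2)‖ ∂μ.spaceTime :=
          integral_mono_of_nonneg (ae_of_all _ fun z => by positivity) i0.integrableOn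
            (ae_of_all _ fun z => mul_le_mul_of_nonneg_right (hK _) (norm_nonneg _))
      _ = ∫ r in Ioc 0 t, ∫ y, 2 * ‖F y (μ r)‖ ∂(μ r).toMeasure :=
          μ.setIntegral_spaceTime i0 measurableSet_Ioc
      _ ≤ ∫ r in Ioc 0 t, 2 * (C + 2 * C') * ∫ y, bracket y ∂(μ r).toMeasure := by
          refine integral_mono (μ.integrable_integral i0).integrableOn
            (((μ.continuous_integral lipschitz_bracket).integrable_of_hasCompactSupport
              (HasCompactSupport.of_compactSpace _)).const_mul _).integrableOn fun r => ?_
          simp only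
          rw [integral_const_mul, mul_assoc]
          refine mul_le_mul_of_nonneg_left ?_ zero_le_two
          have e3 : (μ r).moment ≤ ∫ y, bracket y ∂(μ r).toMeasure :=
            integral_mono (μ r).integrable_norm (hbi _) norm_le_bracket
          -- Needed to absorb the constant part of the growth bound into the moment, so that the
          -- Grönwall inequality is linear.
          have e4 : 1 ≤ ∫ y, bracket y ∂(μ r).toMeasure := by
            have := integral_mono (μ := (μ r).toMeasure) (integrable_const 1) (hbi _) one_le_bracket
            simpa using this
          calc ∫ y, ‖F y (μ r)‖ ∂(μ r).toMeasure
              ≤ ∫ y, (C + C' * (‖y‖ + (μ r).moment)) ∂(μ r).toMeasure :=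
                integral_mono_of_nonneg (ae_of_all _ fun z => norm_nonneg _)
                  ((integrable_const C).add (((μ r).integrable_norm.add
                    (integrable_const _)).const_mul C')) (ae_of_all _ fun y => hg y _)
            _ = C + C' * ((μ r).moment + (μ r).moment) := by
                have i3 : Integrable (fun y => ‖y‖ + (μ r).moment) (μ r).toMeasure :=
                  (μ r).integrable_norm.add (integrable_const _)
                rw [integral_add (integrable_const C) (i3.const_mul C'), integral_const_mul,
                  integral_add (μ r).integrable_norm (integrable_const _)]
                simp [P1.moment]
            _ ≤ _ := by nlinarith
      _ = _ := integral_const_mul _ _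
  simp only [hb]
  linarith

/-- The tails of first moments are uniformly small over all curves that are controlled at bounded
cost. -/
theorem exists_tail_bound (hF : IsDrift F) (hψ : IsControlCost U ψ) (m₀ : P1 d) (B : ℝ) {ε : ℝ}
    (hε : 0 < ε) : ∃ R ≥ 0, ∀ μ u, Controlled F ψ m₀ B μ u →
      ∀ t, ∫ y, weight R y ∂(μ t).toMeasure ≤ ε := by
  obtain ⟨M, hM, hMb⟩ := exists_moment_bound hF hψ m₀ B
  obtain ⟨c, hc, hFc⟩ := hF.exists_norm_le M hM
  set e := Real.exp (2 * c) with he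
  have he0 : 0 < e := Real.exp_pos _
  -- Three shares of η are spent before the Grönwall factor `e`: the initial tail, the cost part of
  -- the control, and the constant part of the control.
  set η := ε / e / 3 with hη
  have hη0 : 0 < η := by positivity
  obtain ⟨D, hD, hu⟩ := hψ.exists_norm_le (ε := η / (2 * (|B| + 1))) (by positivity)
  have lim : Tendsto (fun R : ℝ => 2 * D * M / R) atTop (𝓝 0) := tendsto_id.const_div_atTop _
  obtain ⟨R, ⟨hR1, hR2⟩, hR0⟩ := (((tendsto_integral_weight m₀).eventually (gt_mem_nhds hη0)).and
    (lim.eventually (gt_mem_nhds hη0))).and (eventually_gt_atTop 0) |>.exists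
  have hR : 0 ≤ R := hR0.le
  refine ⟨R, hR, fun μ u h t => ?_⟩
  have hbi : Integrable (fun z : X d => bracket z.1) μ.spaceTime :=
    μ.integrable_spaceTime_lipschitz lipschitz_bracket
  have hwi : Integrable (fun z : X d => weight R z.1) μ.spaceTime :=
    μ.integrable_spaceTime_lipschitz (lipschitz_weight hR)
  have hmom : ∀ t, (μ t).moment ≤ M := fun t =>
    (integral_mono (μ t).integrable_norm ((μ t).integrable_of_lipschitz lipschitz_bracket)
      norm_le_bracket).trans (hMb μ u h t)
  have hbt : ∫ z : X d, bracket z.1 ∂μ.spaceTime ≤ M := by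
    rw [μ.integral_spaceTime hbi]
    calc _ ≤ ∫ _ : unitInterval, M := integral_mono (μ.integrable_integral hbi)
            (integrable_const M) fun t => hMb μ u h t
      _ = M := by simp
  have key : ∀ t, ∫ y, weight R y ∂(μ t).toMeasure
      ≤ 3 * η + 2 * c * ∫ r in Ioc 0 t, ∫ y, weight R y ∂(μ r).toMeasure := by
    intro t
    have h1 := h.integral_weight_le hF hR t
    have h2 : ∫ z in Prod.snd ⁻¹' Ioc 0 t, ‖fderiv ℝ (weight R) z.1‖ * ‖F z.1 (μ z.2)‖ ∂μ.spaceTime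
        ≤ 2 * c * ∫ r in Ioc 0 t, ∫ y, weight R y ∂(μ r).toMeasure := by
      rw [← μ.setIntegral_spaceTime (f := fun z => weight R z.1) hwi measurableSet_Ioc,
        ← integral_const_mul]
      refine integral_mono_of_nonneg (ae_of_all _ fun z => by positivity)
        (hwi.const_mul _).integrableOn (ae_of_all _ fun z => ?_)
      calc ‖fderiv ℝ (weight R) z.1‖ * ‖F z.1 (μ z.2)‖
          ≤ ‖fderiv ℝ (weight R) z.1‖ * (c * bracket z.1) :=
            mul_le_mul_of_nonneg_left (hFc _ _ (hmom _)) (norm_nonneg _)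
        _ = c * (bracket z.1 * ‖fderiv ℝ (weight R) z.1‖) := by ring
        _ ≤ c * (2 * weight R z.1) :=
            mul_le_mul_of_nonneg_left (bracket_mul_norm_fderiv_weight_le hR _) hc
        _ = 2 * c * weight R z.1 := by ring
    have h3 : ∫ z in Prod.snd ⁻¹' Ioc 0 t, ‖fderiv ℝ (weight R) z.1‖ * ‖u z‖ ∂μ.spaceTime
        ≤ 2 * η := by
      have ic : Integrable (fun z => η / (|B| + 1) * ψ (u z) + 2 * D / R * bracket z.1) μ.spaceTime :=
        (h.integrable_cost.const_mul _).add (hbi.const_mul _)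
      have hψ0 : ∀ z, 0 ≤ η / (|B| + 1) * ψ (u z) := fun z =>
        mul_nonneg (by positivity) (hψ.nonneg _)
      calc _ ≤ ∫ z in Prod.snd ⁻¹' Ioc 0 t,
            (η / (|B| + 1) * ψ (u z) + 2 * D / R * bracket z.1) ∂μ.spaceTime := by
            refine integral_mono_of_nonneg (ae_of_all _ fun z => by positivity)
              ic.integrableOn (ae_of_all _ fun z => ?_)
            have hb := bracket_pos z.1
            -- Two gradient bounds are used. The bound 2 suffices for the cost part, whose
            -- coefficient is already small; the constant D needs 2⟨y⟩/R, which is small after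
            -- integration because D and M were fixed before R.
            have hw2 := norm_fderiv_weight_le_two hR z.1
            have hwR : ‖fderiv ℝ (weight R) z.1‖ ≤ 2 * bracket z.1 / R :=
              (norm_fderiv_weight_le hR z.1).trans
                (div_le_div_of_nonneg_left (by positivity) hR0 (by linarith))
            calc ‖fderiv ℝ (weight R) z.1‖ * ‖u z‖
                ≤ ‖fderiv ℝ (weight R) z.1‖ * (η / (2 * (|B| + 1)) * ψ (u z) + D) :=
                  mul_le_mul_of_nonneg_left (hu _) (norm_nonneg _)
              _ = ‖fderiv ℝ (weight R) z.1‖ * (η / (2 * (|B| + 1)) * ψ (u z))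
                  + ‖fderiv ℝ (weight R) z.1‖ * D := by ring
              _ ≤ 2 * (η / (2 * (|B| + 1)) * ψ (u z)) + 2 * bracket z.1 / R * D :=
                  add_le_add (mul_le_mul_of_nonneg_right hw2
                    (mul_nonneg (by positivity) (hψ.nonneg _))) (mul_le_mul_of_nonneg_right hwR hD)
              _ = _ := by field_simp
        _ ≤ ∫ z, (η / (|B| + 1) * ψ (u z) + 2 * D / R * bracket z.1) ∂μ.spaceTime :=
            setIntegral_le_integral ic (ae_of_all _ fun z => by
              have := bracket_pos z.1
              exact add_nonneg (hψ0 z) (by positivity))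
        _ = η / (|B| + 1) * ∫ z, ψ (u z) ∂μ.spaceTime
            + 2 * D / R * ∫ z : X d, bracket z.1 ∂μ.spaceTime := by
            rw [integral_add (h.integrable_cost.const_mul _) (hbi.const_mul _),
              integral_const_mul, integral_const_mul]
        _ ≤ η / (|B| + 1) * (|B| + 1) + 2 * D / R * M := by
            gcongr
            linarith [h.cost_le, le_abs_self B]
        _ = η + 2 * D * M / R := by field_simp
        _ ≤ 2 * η := by linarith
    linarith
  have := le_mul_exp_of_le_add_integral (A := fun t => ∫ y, weight R y ∂(μ t).toMeasure)
    (μ.continuous_integral (lipschitz_weight hR)) (by positivity) (by positivity) key t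
  refine this.trans (le_of_eq ?_)
  rw [← he, hη]
  field_simp

/-- Curves that are controlled at bounded cost are uniformly equicontinuous for `W₁`. -/
theorem exists_modulus (hF : IsDrift F) (hψ : IsControlCost U ψ) (m₀ : P1 d) (B : ℝ) {ε : ℝ}
    (hε : 0 < ε) : ∃ δ > 0, ∀ μ u, Controlled F ψ m₀ B μ u →
      ∀ s t : unitInterval, dist s t < δ → W1 (μ s) (μ t) ≤ ENNReal.ofReal ε := by
  obtain ⟨M, hM, hMb⟩ := exists_moment_bound hF hψ m₀ B
  obtain ⟨c, hc, hFc⟩ := hF.exists_norm_le M hM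
  obtain ⟨D, hD, hu⟩ := hψ.exists_norm_le (ε := ε / 2 / (|B| + 1)) (by positivity)
  -- Drift and constant part of the control contribute (cM + D)(t - s) ≤ ε/2; the cost part is at
  -- most ε/2 whatever the length of the interval.
  refine ⟨ε / 2 / (c * M + D + 1), by positivity, fun μ u h s t hst => ?_⟩
  wlog hle : s ≤ t generalizing s t
  · rw [W1_comm]
    exact this t s (by rwa [dist_comm]) (le_of_not_ge hle)
  refine (h.transported.W1_le hle).trans (ENNReal.ofReal_le_ofReal ?_)
  have hbi : Integrable (fun z : X d => bracket z.1) μ.spaceTime :=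
    μ.integrable_spaceTime_lipschitz lipschitz_bracket
  have hmom : ∀ t, (μ t).moment ≤ M := fun t =>
    (integral_mono (μ t).integrable_norm ((μ t).integrable_of_lipschitz lipschitz_bracket)
      norm_le_bracket).trans (hMb μ u h t)
  have ii : Integrable (fun z : X d => c * bracket z.1 + D) μ.spaceTime :=
    (hbi.const_mul c).add (integrable_const D)
  have e1 : ∫ z in Prod.snd ⁻¹' Ioc s t, (c * bracket z.1 + D) ∂μ.spaceTime
      ≤ (c * M + D) * (t - s) := by
    rw [μ.setIntegral_spaceTime ii measurableSet_Ioc]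
    calc _ ≤ ∫ r in Ioc s t, (c * M + D) := by
          refine integral_mono (μ.integrable_integral ii).integrableOn (integrable_const _)
            fun r => ?_
          simp only
          rw [integral_add (((μ r).integrable_of_lipschitz lipschitz_bracket).const_mul c)
            (integrable_const D), integral_const_mul]
          have := mul_le_mul_of_nonneg_left (hMb μ u h r) hc
          simpa using this
      _ = (c * M + D) * (t - s) := by
          rw [setIntegral_unitInterval _ hle]
          simp only [intervalIntegral.integral_const, smul_eq_mul]
          ring
  calc ∫ z in Prod.snd ⁻¹' Ioc s t, ‖F z.1 (μ z.2) + (u z : E d)‖ ∂μ.spaceTime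
      ≤ ∫ z in Prod.snd ⁻¹' Ioc s t,
        ((c * bracket z.1 + D) + ε / 2 / (|B| + 1) * ψ (u z)) ∂μ.spaceTime := by
        refine integral_mono h.transported.1.norm.integrableOn
          (ii.add (h.integrable_cost.const_mul _)).integrableOn fun z => ?_
        have h1 := hFc z.1 _ (hmom z.2)
        have h2 := hu (u z)
        have h3 := norm_add_le (F z.1 (μ z.2)) (u z : E d)
        have h4 : ‖(u z : E d)‖ = ‖u z‖ := rfl
        simp only
        linarith
    _ = ∫ z in Prod.snd ⁻¹' Ioc s t, (c * bracket z.1 + D) ∂μ.spaceTime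
        + ε / 2 / (|B| + 1) * ∫ z in Prod.snd ⁻¹' Ioc s t, ψ (u z) ∂μ.spaceTime := by
        rw [integral_add ii.integrableOn (h.integrable_cost.const_mul _).integrableOn,
          integral_const_mul]
    _ ≤ (c * M + D) * (t - s) + ε / 2 / (|B| + 1) * (|B| + 1) := by
        gcongr
        linarith [h.setIntegral_cost_le hψ (Prod.snd ⁻¹' Ioc s t), le_abs_self B]
    _ ≤ ε := by
        have h1 : ((t : ℝ) - s) ≤ ε / 2 / (c * M + D + 1) := by
          rw [Subtype.dist_eq, dist_comm, Real.dist_eq] at hst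
          exact (le_abs_self _).trans hst.le
        have h2 : (c * M + D) * ((t : ℝ) - s) ≤ ε / 2 := by
          rw [le_div_iff₀ (by positivity)] at h1
          have : (0 : ℝ) ≤ t - s := sub_nonneg.2 hle
          nlinarith
        have h3 : ε / 2 / (|B| + 1) * (|B| + 1) = ε / 2 := div_mul_cancel₀ _ (by positivity)
        linarith

end MFC

namespace MFC

/-! ### Narrow convergence, compactness in 𝒫₁, and Arzelà–Ascoli -/

section NarrowConvergence

variable {Ω : Type*} [MeasurableSpace Ω]

/-- A sequence of probability measures with a uniformly integrable coercive function has a narrowly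
convergent subsequence. -/
theorem exists_subseq_tendsto_of_lintegral_le [MetricSpace Ω]
    [SecondCountableTopology Ω] [BorelSpace Ω] (p : ℕ → ProbabilityMeasure Ω) {f : Ω → ℝ≥0∞}
    (hf : Measurable f) (hK : ∀ r : ℝ≥0∞, r ≠ ∞ → ∃ K, IsCompact K ∧ {x | f x < r} ⊆ K)
    {C : ℝ≥0∞} (hC : C ≠ ∞) (h : ∀ n, ∫⁻ x, f x ∂(p n : Measure Ω) ≤ C) :
    ∃ (a : ProbabilityMeasure Ω) (k : ℕ → ℕ), StrictMono k ∧
      Tendsto (fun n => p (k n)) atTop (𝓝 a) := by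
  have ht : IsTightMeasureSet {((q : ProbabilityMeasure Ω) : Measure Ω) | q ∈ range p} := by
    rw [isTightMeasureSet_iff_exists_isCompact_measure_compl_le]
    intro ε hε
    rcases eq_or_ne ε ∞ with rfl | hε'
    · exact ⟨∅, isCompact_empty, fun _ _ => le_top⟩
    -- Markov's inequality at this level leaves mass at most ε outside; the +1 keeps the level
    -- nonzero when C = 0.
    obtain ⟨K, hKc, hKf⟩ := hK ((C + 1) / ε) (ENNReal.div_ne_top (by simp [hC]) hε.ne')
    refine ⟨K, hKc, ?_⟩
    rintro _ ⟨_, ⟨n, rfl⟩, rfl⟩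
    have hsub : Kᶜ ⊆ {x | (C + 1) / ε ≤ f x} := fun x hx => by
      rw [mem_ofPred_eq]
      exact not_lt.1 fun hlt => hx (hKf hlt)
    have h0 : (C + 1) / ε ≠ 0 := by simp [hε']
    have h1 : (C + 1) / ε ≠ ∞ := ENNReal.div_ne_top (by simp [hC]) hε.ne'
    refine (measure_mono hsub).trans ((meas_ge_le_lintegral_div hf.aemeasurable h0 h1).trans ?_)
    refine ENNReal.div_le_of_le_mul ((h n).trans ?_)
    rw [ENNReal.mul_div_cancel hε.ne' hε']
    exact le_self_add
  obtain ⟨a, -, k, hk, hl⟩ := (isCompact_closure_of_isTightMeasureSet ht).tendsto_subseq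
    (x := p) fun n => subset_closure ⟨n, rfl⟩
  exact ⟨a, k, hk, hl⟩

/-- Integrals of nonnegative lower semicontinuous functions are lower semicontinuous for narrow
convergence. -/
theorem lintegral_le_liminf_of_lowerSemicontinuous [TopologicalSpace Ω] [OpensMeasurableSpace Ω]
    [HasOuterApproxClosed Ω] {p : ℕ → ProbabilityMeasure Ω} {a : ProbabilityMeasure Ω}
    (h : Tendsto p atTop (𝓝 a)) {f : Ω → ℝ≥0∞} (hf : LowerSemicontinuous f) :
    ∫⁻ x, f x ∂(a : Measure Ω) ≤ liminf (fun n => ∫⁻ x, f x ∂(p n : Measure Ω)) atTop := by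
  have hm : Measurable f := measurable_of_Ioi fun y => (hf.isOpen_preimage y).measurableSet
  -- Layer cake formula for the truncated function. Its superlevel sets are open, so the portmanteau
  -- theorem and Fatou's lemma apply; then N tends to infinity.
  have trunc : ∀ (N : ℕ) (q : Measure Ω), ∫⁻ x, min (f x) N ∂q
      = ∫⁻ t in Ioi (0 : ℝ), q {x | t < (min (f x) N).toReal} := by
    intro N q
    rw [← lintegral_eq_lintegral_meas_lt q (f := fun x => (min (f x) N).toReal)
      (ae_of_all _ fun x => ENNReal.toReal_nonneg) (by fun_prop)]
    exact lintegral_congr fun x => (ENNReal.ofReal_toReal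
      (ne_top_of_le_ne_top (ENNReal.natCast_ne_top N) (min_le_right _ _))).symm
  have bound : ∀ N : ℕ, ∫⁻ x, min (f x) N ∂(a : Measure Ω)
      ≤ liminf (fun n => ∫⁻ x, f x ∂(p n : Measure Ω)) atTop := by
    intro N
    calc ∫⁻ x, min (f x) N ∂(a : Measure Ω)
        ≤ ∫⁻ t in Ioi (0 : ℝ),
            liminf (fun n => (p n : Measure Ω) {x | t < (min (f x) N).toReal}) atTop := by
          rw [trunc]
          refine setLIntegral_mono' measurableSet_Ioi fun t ht => ?_
          have ho : IsOpen {x | t < (min (f x) N).toReal} := by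
            have : {x | t < (min (f x) N).toReal}
                = f ⁻¹' Ioi (ENNReal.ofReal t) ∩ {_x | ENNReal.ofReal t < N} := by
              ext x
              have hfin : min (f x) N ≠ ∞ :=
                ne_top_of_le_ne_top (ENNReal.natCast_ne_top N) (min_le_right _ _)
              simp only [mem_ofPred_eq, mem_inter_iff, mem_preimage, mem_Ioi, ← lt_min_iff]
              exact (ENNReal.ofReal_lt_iff_lt_toReal (le_of_lt ht) hfin).symm
            rw [this]
            exact (hf.isOpen_preimage _).inter isOpen_const
          exact ProbabilityMeasure.le_liminf_measure_open_of_tendsto h ho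
      _ ≤ liminf (fun n => ∫⁻ t in Ioi (0 : ℝ),
            (p n : Measure Ω) {x | t < (min (f x) N).toReal}) atTop := by
          refine lintegral_liminf_le fun n => Antitone.measurable fun s t hst => ?_
          exact measure_mono fun x (hx : t < _) => lt_of_le_of_lt hst hx
      _ ≤ _ := by
          refine liminf_le_liminf (Eventually.of_forall fun n => ?_)
          rw [← trunc]
          exact lintegral_mono fun x => min_le_left _ _
  have hsup : ∀ x, f x = ⨆ N : ℕ, min (f x) N := by
    intro x
    refine le_antisymm (le_of_forall_lt fun c hc => ?_) (iSup_le fun N => min_le_left _ _)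
    obtain ⟨N, hN⟩ := ENNReal.exists_nat_gt (ne_top_of_lt hc)
    exact (lt_min hc hN).trans_le (le_iSup (fun N : ℕ => min (f x) N) N)
  calc ∫⁻ x, f x ∂(a : Measure Ω) = ∫⁻ x, ⨆ N : ℕ, min (f x) N ∂(a : Measure Ω) :=
        lintegral_congr hsup
    _ = ⨆ N : ℕ, ∫⁻ x, min (f x) N ∂(a : Measure Ω) :=
        lintegral_iSup (fun N => hm.min measurable_const) fun N N' hN x =>
          min_le_min_left _ (by exact_mod_cast hN)
    _ ≤ _ := iSup_le bound

end NarrowConvergence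

variable {d : ℕ}

/-- Convergence in `W₁` implies narrow convergence. -/
theorem tendsto_toProb_of_tendsto_W1 {μ : ℕ → P1 d} {μ' : P1 d}
    (h : Tendsto (fun n => W1 (μ n) μ') atTop (𝓝 0)) :
    Tendsto (fun n => (μ n).toProb) atTop (𝓝 μ'.toProb) := by
  rw [tendsto_iff_forall_lipschitz_integral_tendsto]
  rintro f - ⟨K, hf⟩
  rw [tendsto_iff_norm_sub_tendsto_zero]
  have h0 : Tendsto (fun n => K * (W1 (μ n) μ').toReal) atTop (𝓝 (K * 0)) :=
    ((ENNReal.tendsto_toReal ENNReal.zero_ne_top).comp h).const_mul _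
  rw [mul_zero] at h0
  exact squeeze_zero (fun _ => norm_nonneg _) (fun n => abs_integral_sub_le_W1 _ _ hf) h0

/-- A constant sequence at distance zero converges narrowly to both measures, and narrow limits are
unique. -/
theorem W1_eq_zero {μ ν : P1 d} (h : W1 μ ν = 0) : μ = ν := by
  have h1 : Tendsto (fun _ : ℕ => μ.toProb) atTop (𝓝 ν.toProb) :=
    tendsto_toProb_of_tendsto_W1 (by simp [h])
  have h2 : μ.toProb = ν.toProb := tendsto_nhds_unique tendsto_const_nhds h1
  exact P1.ext (congrArg Subtype.val h2)

/-- The Wasserstein metric on `𝒫₁(ℝ^d)`. -/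
noncomputable instance : MetricSpace (P1 d) where
  dist μ ν := (W1 μ ν).toReal
  dist_self μ := by simp [W1_self]
  dist_comm μ ν := by rw [W1_comm]
  dist_triangle μ ν ρ := by
    rw [← ENNReal.toReal_add (W1_ne_top _ _) (W1_ne_top _ _)]
    exact ENNReal.toReal_mono (ENNReal.add_ne_top.2 ⟨W1_ne_top _ _, W1_ne_top _ _⟩)
      (W1_triangle _ _ _)
  eq_of_dist_eq_zero {μ ν} h :=
    W1_eq_zero (((ENNReal.toReal_eq_zero_iff _).1 h).resolve_right (W1_ne_top _ _))

theorem W1_eq_ofReal_dist (μ ν : P1 d) : W1 μ ν = ENNReal.ofReal (dist μ ν) :=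
  (ENNReal.ofReal_toReal (W1_ne_top _ _)).symm

theorem P1.tendsto_iff {ι : Type*} {l : Filter ι} {μ : ι → P1 d} {μ' : P1 d} :
    Tendsto μ l (𝓝 μ') ↔ Tendsto (fun n => W1 (μ n) μ') l (𝓝 0) := by
  rw [tendsto_iff_dist_tendsto_zero]
  constructor <;> intro h
  · simpa [W1_eq_ofReal_dist] using ENNReal.tendsto_ofReal h
  · exact (ENNReal.tendsto_toReal ENNReal.zero_ne_top).comp h

theorem Curve.continuous (μ : Curve d) : Continuous fun t => μ t :=
  continuous_iff_continuousAt.2 fun t => P1.tendsto_iff.2 (μ.continuous_W1 t)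

theorem P1.continuous_integral {K : NNReal} {f : E d → ℝ} (hf : LipschitzWith K f) :
    Continuous fun μ : P1 d => ∫ x, f x ∂μ.toMeasure :=
  (LipschitzWith.of_dist_le_mul (K := K) fun μ ν => abs_integral_sub_le_W1 μ ν hf).continuous

/-- A narrow limit of measures with bounded first moments has a finite first moment. -/
theorem exists_toProb_eq_of_tendsto {p : ℕ → P1 d} {a : ProbabilityMeasure (E d)}
    (h : Tendsto (fun n => (p n).toProb) atTop (𝓝 a)) {C : ℝ≥0∞} (hC : C ≠ ∞)
    (hp : ∀ n, ∫⁻ x, ‖x‖ₑ ∂(p n).toMeasure ≤ C) : ∃ q : P1 d, q.toProb = a := by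
  have := lintegral_le_liminf_of_lowerSemicontinuous h
    (f := fun x => ‖x‖ₑ) continuous_enorm.lowerSemicontinuous
  refine ⟨⟨a, a.2, (this.trans ?_).trans_lt hC.lt_top⟩, rfl⟩
  refine (liminf_le_liminf (v := fun _ => C) (Eventually.of_forall hp)).trans ?_
  simp

/-- A set of measures with bounded first moments and uniformly small tails is compact. -/
theorem isCompact_of_tails {M : ℝ} {R : ℝ → ℝ} (hR : ∀ ε > 0, 0 ≤ R ε) :
    IsCompact {p : P1 d | ∫ x, bracket x ∂p.toMeasure ≤ M ∧
      ∀ ε > 0, ∫ x, weight (R ε) x ∂p.toMeasure ≤ ε} := by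
  refine IsSeqCompact.isCompact fun p hp => ?_
  have hb : ∀ n, ∫⁻ x, ‖x‖ₑ ∂(p n).toMeasure ≤ ENNReal.ofReal M := by
    intro n
    have h1 : ∫⁻ x, ‖x‖ₑ ∂(p n).toMeasure = ENNReal.ofReal (∫ x, ‖x‖ ∂(p n).toMeasure) := by
      rw [ofReal_integral_eq_lintegral_ofReal (p n).integrable_norm
        (ae_of_all _ fun x => norm_nonneg x)]
      simp
    rw [h1]
    refine ENNReal.ofReal_le_ofReal (le_trans ?_ (hp n).1)
    exact integral_mono (p n).integrable_norm ((p n).integrable_of_lipschitz lipschitz_bracket)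
      norm_le_bracket
  -- The moment bound gives tightness and keeps the narrow limit in 𝒫₁; the tail bounds then turn
  -- narrow convergence into convergence in `W1`.
  obtain ⟨a, k, hk, hka⟩ := exists_subseq_tendsto_of_lintegral_le (fun n => (p n).toProb)
    (f := fun x => ‖x‖ₑ) (by fun_prop) (fun r hr => ⟨Metric.closedBall 0 r.toReal,
      isCompact_closedBall _ _, fun x hx => by
        rw [mem_closedBall_zero_iff, ← toReal_enorm]
        exact ENNReal.toReal_mono hr (le_of_lt hx)⟩) ENNReal.ofReal_ne_top hb
  obtain ⟨q, rfl⟩ := exists_toProb_eq_of_tendsto (p := fun n => p (k n)) hka ENNReal.ofReal_ne_top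
    fun n => hb (k n)
  have hq : Tendsto (fun n => p (k n)) atTop (𝓝 q) :=
    P1.tendsto_iff.2 (tendsto_W1_of_tendsto_toProb hka fun ε hε =>
      ⟨R ε, hR ε hε, fun n => (hp (k n)).2 ε hε⟩)
  refine ⟨q, ⟨?_, fun ε hε => ?_⟩, k, hk, hq⟩
  · exact le_of_tendsto' (((P1.continuous_integral lipschitz_bracket).tendsto q).comp hq)
      fun n => (hp (k n)).1
  · exact le_of_tendsto' (((P1.continuous_integral (lipschitz_weight (hR ε hε))).tendsto q).comp hq)
      fun n => (hp (k n)).2 ε hε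

/-- The Arzelà–Ascoli theorem for curves in `𝒫₁(ℝ^d)`. -/
theorem exists_subseq_curveTendsto (μ : ℕ → Curve d) {M : ℝ}
    (hM : ∀ n t, ∫ x, bracket x ∂(μ n t).toMeasure ≤ M)
    (hT : ∀ ε > 0, ∃ R ≥ 0, ∀ n t, ∫ x, weight R x ∂(μ n t).toMeasure ≤ ε)
    (hE : ∀ ε > 0, ∃ δ > 0, ∀ n, ∀ s t : unitInterval, dist s t < δ →
      W1 (μ n s) (μ n t) ≤ ENNReal.ofReal ε) :
    ∃ (μ' : Curve d) (k : ℕ → ℕ), StrictMono k ∧ CurveTendsto (fun n => μ (k n)) μ' := by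
  choose! R hR hRT using hT
  set S := {p : P1 d | ∫ x, bracket x ∂p.toMeasure ≤ M ∧
      ∀ ε > 0, ∫ x, weight (R ε) x ∂p.toMeasure ≤ ε} with hS
  let b : ℕ → BoundedContinuousFunction unitInterval (P1 d) := fun n =>
    BoundedContinuousFunction.mkOfCompact ⟨_, (μ n).continuous⟩
  have hue : UniformEquicontinuous fun f : range b => ((f : BoundedContinuousFunction _ _) :
      unitInterval → P1 d) := by
    rw [Metric.uniformEquicontinuous_iff]
    intro ε hε
    obtain ⟨δ, hδ, h⟩ := hE (ε / 2) (by positivity)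
    refine ⟨δ, hδ, ?_⟩
    rintro s t hst ⟨_, n, rfl⟩
    refine lt_of_le_of_lt ?_ (half_lt_self hε)
    have := h n s t hst
    rw [W1_eq_ofReal_dist] at this
    exact (ENNReal.ofReal_le_ofReal_iff (by positivity)).1 this
  have hc : IsCompact (closure (range b)) :=
    BoundedContinuousFunction.arzela_ascoli S (isCompact_of_tails hR) _
      (by rintro _ t ⟨n, rfl⟩; exact ⟨hM n t, fun ε hε => hRT ε hε n t⟩) hue.equicontinuous
  obtain ⟨g, -, k, hk, hl⟩ := hc.tendsto_subseq (x := b) fun n => subset_closure ⟨n, rfl⟩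
  refine ⟨⟨g, fun t => P1.tendsto_iff.1 (g.continuous.tendsto t)⟩, k, hk, ?_⟩
  rw [tendsto_iff_dist_tendsto_zero] at hl
  have h0 := ENNReal.tendsto_ofReal hl
  rw [ENNReal.ofReal_zero] at h0
  refine tendsto_of_tendsto_of_tendsto_of_le_of_le tendsto_const_nhds h0 (fun _ => zero_le)
    fun n => iSup_le fun t => ?_
  rw [W1_eq_ofReal_dist]
  exact ENNReal.ofReal_le_ofReal (BoundedContinuousFunction.dist_coe_le_dist (f := b (k n)) t)

/-- A uniformly convergent sequence of curves is uniformly close to its limit. -/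
theorem CurveTendsto.eventually {μ : ℕ → Curve d} {μ' : Curve d} (h : CurveTendsto μ μ') {ε : ℝ}
    (hε : 0 < ε) : ∀ᶠ n in atTop, ∀ t, W1 (μ n t) (μ' t) < ENNReal.ofReal ε := by
  filter_upwards [Tendsto.eventually h (gt_mem_nhds (ENNReal.ofReal_pos.2 hε))] with n hn t
  exact (le_iSup (fun t => W1 (μ n t) (μ' t)) t).trans_lt hn

theorem CurveTendsto.tendsto_apply {μ : ℕ → Curve d} {μ' : Curve d} (h : CurveTendsto μ μ')
    (t : unitInterval) : Tendsto (fun n => μ n t) atTop (𝓝 (μ' t)) :=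
  P1.tendsto_iff.2 (tendsto_of_tendsto_of_tendsto_of_le_of_le tendsto_const_nhds h
    (fun _ => zero_le) fun n => le_iSup (fun t => W1 (μ n t) (μ' t)) t)

/-- `dμ_t ⊗ dt` as a probability measure. -/
noncomputable def Curve.toProb (μ : Curve d) : ProbabilityMeasure (X d) :=
  ⟨μ.spaceTime, inferInstance⟩

theorem Curve.coe_toProb (μ : Curve d) : (μ.toProb : Measure (X d)) = μ.spaceTime := rfl

/-- Uniform convergence of curves implies narrow convergence of the space-time measures. -/
theorem CurveTendsto.tendsto_toProb {μ : ℕ → Curve d} {μ' : Curve d} (h : CurveTendsto μ μ') :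
    Tendsto (fun n => (μ n).toProb) atTop (𝓝 μ'.toProb) := by
  rw [tendsto_iff_forall_lipschitz_integral_tendsto]
  rintro f ⟨C, hC⟩ ⟨K, hf⟩
  have hb : ∀ z, ‖f z‖ ≤ ‖f 0‖ + C := fun z => by
    have := hC z 0
    rw [dist_eq_norm] at this
    have h2 := norm_sub_norm_le (f z) (f 0)
    linarith
  have hi : ∀ m : Measure (X d), IsFiniteMeasure m → Integrable f m := fun m _ =>
    Integrable.of_bound hf.continuous.aestronglyMeasurable _ (ae_of_all _ hb)
  have hlip : ∀ t : unitInterval, LipschitzWith K fun y : E d => f (y, t) := fun t =>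
    LipschitzWith.of_dist_le_mul fun x y => by
      have := hf.dist_le_mul (x, t) (y, t)
      simpa [Prod.dist_eq] using this
  have key : ∀ n, ‖∫ z, f z ∂(μ n).spaceTime - ∫ z, f z ∂μ'.spaceTime‖
      ≤ ∫ t, K * (W1 (μ n t) (μ' t)).toReal := by
    intro n
    have hcont : Continuous fun t => (K : ℝ) * (W1 (μ n t) (μ' t)).toReal :=
      continuous_const.mul ((μ n).continuous.dist μ'.continuous)
    rw [Curve.integral_spaceTime _ (hi _ inferInstance),
      Curve.integral_spaceTime _ (hi _ inferInstance),
      ← integral_sub ((μ n).integrable_integral (hi _ inferInstance))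
        (μ'.integrable_integral (hi _ inferInstance))]
    exact norm_integral_le_of_norm_le (hcont.integrable_of_hasCompactSupport
      (HasCompactSupport.of_compactSpace _))
      (ae_of_all _ fun t => abs_integral_sub_le_W1 _ _ (hlip t))
  rw [Metric.tendsto_atTop']
  intro ε hε
  have := h.eventually (ε := ε / (K + 1)) (by positivity)
  obtain ⟨N, hN⟩ := eventually_atTop.1 this
  refine ⟨N, fun n hn => ?_⟩
  rw [dist_eq_norm, Curve.coe_toProb, Curve.coe_toProb]
  refine (key n).trans_lt ?_
  have hle : ∀ t, (K : ℝ) * (W1 (μ n t) (μ' t)).toReal ≤ K * (ε / (K + 1)) := fun t => by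
    refine mul_le_mul_of_nonneg_left ?_ K.2
    exact ENNReal.toReal_le_of_le_ofReal (by positivity) (hN n hn.le t).le
  calc _ ≤ ∫ _ : unitInterval, (K : ℝ) * (ε / (K + 1)) :=
        integral_mono_of_nonneg (ae_of_all _ fun t => by positivity) (integrable_const _)
          (ae_of_all _ hle)
    _ = K * (ε / (K + 1)) := by simp
    _ < ε := by
        rw [mul_div_assoc', div_lt_iff₀ (by positivity)]
        nlinarith

end MFC

/-! ### Passage to the limit in the controls, the equation and the costs -/

namespace MFC

/-- Integrals of bounded continuous functions converge along narrowly convergent sequences. -/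
theorem tendsto_integral_of_bounded {Ω : Type*} [MeasurableSpace Ω] [TopologicalSpace Ω]
    [OpensMeasurableSpace Ω] {p : ℕ → ProbabilityMeasure Ω} {a : ProbabilityMeasure Ω}
    (h : Tendsto p atTop (𝓝 a)) {f : Ω → ℝ} (hf : Continuous f) {R : ℝ} (hR : ∀ x, |f x| ≤ R) :
    Tendsto (fun n => ∫ x, f x ∂(p n : Measure Ω)) atTop (𝓝 (∫ x, f x ∂(a : Measure Ω))) :=
  ProbabilityMeasure.tendsto_iff_forall_integral_tendsto.1 h
    (BoundedContinuousFunction.ofNormedAddCommGroup f hf R hR)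

/-- Integrals of continuous functions that are dominated by small multiples of a function with
bounded integrals converge along narrowly convergent sequences. -/
theorem tendsto_integral_of_dominated {Ω : Type*} [MeasurableSpace Ω] [TopologicalSpace Ω]
    [OpensMeasurableSpace Ω] {p : ℕ → ProbabilityMeasure Ω} {a : ProbabilityMeasure Ω}
    (h : Tendsto p atTop (𝓝 a)) {f c : Ω → ℝ} (hf : Continuous f) (hc : ∀ x, 0 ≤ c x)
    (hfc : ∀ ε > 0, ∃ D, 0 ≤ D ∧ ∀ x, |f x| ≤ ε * c x + D) {B : ℝ}
    (hp : ∀ n, Integrable c (p n : Measure Ω) ∧ ∫ x, c x ∂(p n : Measure Ω) ≤ B)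
    (ha : Integrable c (a : Measure Ω) ∧ ∫ x, c x ∂(a : Measure Ω) ≤ B) :
    Tendsto (fun n => ∫ x, f x ∂(p n : Measure Ω)) atTop (𝓝 (∫ x, f x ∂(a : Measure Ω))) := by
  have hB : 0 ≤ B := (integral_nonneg hc).trans ha.2
  rw [Metric.tendsto_atTop']
  intro ε hε
  -- Truncation at level D costs η B for the sequence and again for the limit; convergence of the
  -- truncated integrals costs η. The sum is ε.
  set η := ε / (2 * B + 1) with hη
  have hη0 : 0 < η := by positivity
  obtain ⟨D, hD, hfD⟩ := hfc η hη0
  set T : Ω → ℝ := fun x => max (-D) (min (f x) D) with hT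
  have hTc : Continuous T := continuous_const.max (hf.min continuous_const)
  have hTb : ∀ x, |T x| ≤ D := fun x => abs_le.2
    ⟨le_max_left _ _, max_le (by linarith) (min_le_right _ _)⟩
  have hdiff : ∀ x, |f x - T x| ≤ η * c x := by
    intro x
    have h1 := abs_le.1 (hfD x)
    have h2 := mul_nonneg hη0.le (hc x)
    rw [abs_le]
    simp only [hT]
    rcases le_total (f x) D with h3 | h3
    · rw [min_eq_left h3]
      rcases le_total (-D) (f x) with h4 | h4
      · rw [max_eq_right h4]; constructor <;> linarith
      · rw [max_eq_left h4]; constructor <;> linarith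
    · rw [min_eq_right h3, max_eq_right (by linarith)]; constructor <;> linarith
  have est : ∀ q : ProbabilityMeasure Ω, Integrable c (q : Measure Ω) →
      ∫ x, c x ∂(q : Measure Ω) ≤ B →
      |∫ x, f x ∂(q : Measure Ω) - ∫ x, T x ∂(q : Measure Ω)| ≤ η * B := by
    intro q hi hle
    have iT : Integrable T (q : Measure Ω) :=
      Integrable.of_bound hTc.aestronglyMeasurable D (ae_of_all _ hTb)
    have iF : Integrable f (q : Measure Ω) :=
      Integrable.mono' ((hi.const_mul η).add (integrable_const D)) hf.aestronglyMeasurable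
        (ae_of_all _ hfD)
    rw [← integral_sub iF iT, ← Real.norm_eq_abs]
    refine (norm_integral_le_of_norm_le (f := fun x => f x - T x) (hi.const_mul η)
      (ae_of_all _ hdiff)).trans ?_
    rw [integral_const_mul]
    exact mul_le_mul_of_nonneg_left hle hη0.le
  obtain ⟨N, hN⟩ := Metric.tendsto_atTop'.1 (tendsto_integral_of_bounded h hTc hTb) η hη0
  refine ⟨N, fun n hn => ?_⟩
  have e1 := abs_le.1 (est (p n) (hp n).1 (hp n).2)
  have e2 := abs_le.1 (est a ha.1 ha.2)
  have e3 := abs_lt.1 (hN n hn)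
  have e4 : 2 * (η * B) + η = ε := by rw [hη]; field_simp
  rw [Real.dist_eq, abs_lt]
  constructor <;> linarith

variable {d : ℕ} {U : Submodule ℝ (E d)} {ψ : U → ℝ}

/-- A finite convex function on a finite-dimensional space is locally Lipschitz. -/
theorem IsControlCost.continuous (hψ : IsControlCost U ψ) : Continuous ψ :=
  hψ.convex.locallyLipschitz.continuous

/-- The barycentre of the conditional distributions of the second component of a measure on
`X d × U` with finite cost. -/
theorem exists_barycentre (hψ : IsControlCost U ψ) (γ : Measure (X d × U)) [IsProbabilityMeasure γ]
    (hi : Integrable (fun w => ψ w.2) γ) :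
    ∃ u : X d → U, Integrable u γ.fst ∧
      (∫⁻ z, ENNReal.ofReal (ψ (u z)) ∂γ.fst ≤ ∫⁻ w, ENNReal.ofReal (ψ w.2) ∂γ) ∧
      ∀ (g : X d → E d) (C : ℝ), Continuous g → (∀ z, ‖g z‖ ≤ C) →
        ∫ w, ⟪g w.1, (w.2 : E d)⟫ ∂γ = ∫ z, ⟪g z, (u z : E d)⟫ ∂γ.fst := by
  have : CompleteSpace U := FiniteDimensional.complete ℝ U
  have hψm : Measurable ψ := hψ.continuous.measurable
  obtain ⟨D, hD, hu⟩ := hψ.exists_norm_le one_pos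
  have hv : Integrable (fun w : X d × U => w.2) γ :=
    Integrable.mono' ((hi.const_mul 1).add (integrable_const D))
      continuous_snd.aestronglyMeasurable (ae_of_all _ fun w => hu w.2)
  have hγ : γ.fst.compProd γ.condKernel = γ := γ.disintegrate γ.condKernel
  have hv' : Integrable (fun w : X d × U => w.2) (γ.fst.compProd γ.condKernel) := by rwa [hγ]
  have hi' : Integrable (fun w : X d × U => ψ w.2) (γ.fst.compProd γ.condKernel) := by rwa [hγ]
  have av := ((Measure.integrable_compProd_iff hv'.1).1 hv').1
  have ai := ((Measure.integrable_compProd_iff hi'.1).1 hi').1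
  -- Averaging the conditional laws lowers the convex cost by Jensen's inequality and leaves
  -- pairings unchanged, as these are linear in the control.
  refine ⟨fun z => ∫ v, v ∂γ.condKernel z, Integrable.integral_compProd hv', ?_, ?_⟩
  · calc ∫⁻ z, ENNReal.ofReal (ψ (∫ v, v ∂γ.condKernel z)) ∂γ.fst
        ≤ ∫⁻ z, ∫⁻ v, ENNReal.ofReal (ψ v) ∂γ.condKernel z ∂γ.fst := by
          refine lintegral_mono_ae ?_
          filter_upwards [av, ai] with z hz1 hz2
          rw [← ofReal_integral_eq_lintegral_ofReal hz2 (ae_of_all _ fun v => hψ.nonneg v)]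
          exact ENNReal.ofReal_le_ofReal (hψ.convex.map_integral_le hψ.continuous.continuousOn
            isClosed_univ (ae_of_all _ fun _ => mem_univ _) hz1 hz2)
      _ = ∫⁻ w, ENNReal.ofReal (ψ w.2) ∂(γ.fst.compProd γ.condKernel) :=
          (Measure.lintegral_compProd (f := fun w : X d × U => ENNReal.ofReal (ψ w.2))
            (by fun_prop)).symm
      _ = _ := by rw [hγ]
  · intro g C hg hC
    have ig : Integrable (fun w : X d × U => ⟪g w.1, (w.2 : E d)⟫) (γ.fst.compProd γ.condKernel) := by
      refine Integrable.mono' (hv'.norm.const_mul C) (Continuous.aestronglyMeasurable (by fun_prop))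
        (ae_of_all _ fun w => ?_)
      exact (norm_inner_le_norm _ _).trans
        (mul_le_mul_of_nonneg_right (hC w.1) (norm_nonneg _))
    calc ∫ w, ⟪g w.1, (w.2 : E d)⟫ ∂γ
        = ∫ w, ⟪g w.1, (w.2 : E d)⟫ ∂(γ.fst.compProd γ.condKernel) := by rw [hγ]
      _ = ∫ z, ∫ v, ⟪g z, ((v : U) : E d)⟫ ∂γ.condKernel z ∂γ.fst := Measure.integral_compProd ig
      _ = _ := by
          refine integral_congr_ae ?_
          filter_upwards [av] with z hz
          exact (pairing U (g z)).integral_comp_comm hz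

/-- Controls of bounded cost along a narrowly convergent sequence of measures with bounded first
moments converge, up to a subsequence, in duality with bounded continuous functions, and the cost
is lower semicontinuous. -/
theorem exists_limit_control (hψ : IsControlCost U ψ) {m : ℕ → ProbabilityMeasure (X d)}
    {m' : ProbabilityMeasure (X d)} (hm : Tendsto m atTop (𝓝 m')) {M : ℝ}
    (hM : ∀ n, ∫⁻ z, ‖z.1‖ₑ ∂(m n : Measure (X d)) ≤ ENNReal.ofReal M)
    {u : ℕ → X d → U} (hu : ∀ n, Integrable (u n) (m n : Measure (X d))) {B : ℝ}
    (hB : ∀ n, Integrable (fun z => ψ (u n z)) (m n : Measure (X d)) ∧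
      ∫ z, ψ (u n z) ∂(m n : Measure (X d)) ≤ B) :
    ∃ (u' : X d → U) (k : ℕ → ℕ), StrictMono k ∧ Integrable u' (m' : Measure (X d)) ∧
      (∫⁻ z, ENNReal.ofReal (ψ (u' z)) ∂(m' : Measure (X d)) ≤
        liminf (fun n => ∫⁻ z, ENNReal.ofReal (ψ (u (k n) z)) ∂(m (k n) : Measure (X d))) atTop) ∧
      ∀ (g : X d → E d) (C : ℝ), Continuous g → (∀ z, ‖g z‖ ≤ C) →
        Tendsto (fun n => ∫ z, ⟪g z, (u (k n) z : E d)⟫ ∂(m (k n) : Measure (X d))) atTop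
          (𝓝 (∫ z, ⟪g z, (u' z : E d)⟫ ∂(m' : Measure (X d)))) := by
  have hψm : Measurable ψ := hψ.continuous.measurable
  have hgm : ∀ n, AEMeasurable (fun z => (z, u n z)) (m n : Measure (X d)) := fun n =>
    aemeasurable_id.prodMk (hu n).1.aemeasurable
  -- Laws of (z, u_n(z)): on the product space the controls become comparable although the base
  -- measures vary. First moments and costs make these laws tight.
  let γ : ℕ → ProbabilityMeasure (X d × U) := fun n => (m n).map (hgm n)
  have γl : ∀ n (f : X d × U → ℝ≥0∞), Measurable f →
      ∫⁻ w, f w ∂(γ n : Measure (X d × U)) = ∫⁻ z, f (z, u n z) ∂(m n : Measure (X d)) :=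
    fun n f hf => lintegral_map' hf.aemeasurable (hgm n)
  have γi : ∀ n (f : X d × U → ℝ), Continuous f →
      ∫ w, f w ∂(γ n : Measure (X d × U)) = ∫ z, f (z, u n z) ∂(m n : Measure (X d)) :=
    fun n f hf => integral_map (hgm n) hf.aestronglyMeasurable
  obtain ⟨D, hD, hnorm⟩ := hψ.exists_norm_le one_pos
  have hcost : ∀ n, ∫⁻ z, ENNReal.ofReal (ψ (u n z)) ∂(m n : Measure (X d)) ≤ ENNReal.ofReal B := by
    intro n
    rw [← ofReal_integral_eq_lintegral_ofReal (hB n).1 (ae_of_all _ fun z => hψ.nonneg _)]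
    exact ENNReal.ofReal_le_ofReal (hB n).2
  have hnormE : ∀ x : U, ‖x‖ₑ ≤ ENNReal.ofReal (ψ x) + ENNReal.ofReal D := fun x => by
    rw [← ofReal_norm, ← ENNReal.ofReal_add (hψ.nonneg x) hD]
    exact ENNReal.ofReal_le_ofReal (by linarith [hnorm x])
  obtain ⟨a, k, hk, hka⟩ := exists_subseq_tendsto_of_lintegral_le γ
    (f := fun w => ‖w.1.1‖ₑ + ‖w.2‖ₑ) (by fun_prop)
    (C := ENNReal.ofReal M + (ENNReal.ofReal B + ENNReal.ofReal D))
    (fun r hr => by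
      refine ⟨(Metric.closedBall 0 r.toReal ×ˢ univ) ×ˢ Metric.closedBall 0 r.toReal,
        ((isCompact_closedBall _ _).prod isCompact_univ).prod (isCompact_closedBall _ _), ?_⟩
      rintro w hw
      have hw' : ‖w.1.1‖ₑ + ‖w.2‖ₑ < r := hw
      refine ⟨⟨?_, mem_univ _⟩, ?_⟩
      · rw [mem_closedBall_zero_iff, ← toReal_enorm]
        exact ENNReal.toReal_mono hr (le_self_add.trans hw'.le)
      · rw [mem_closedBall_zero_iff, ← toReal_enorm]
        exact ENNReal.toReal_mono hr (le_add_self.trans hw'.le)) (by simp)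
    (fun n => by
      rw [γl n _ (by fun_prop), lintegral_add_left (by fun_prop)]
      refine add_le_add (hM n) ?_
      calc ∫⁻ z, ‖u n z‖ₑ ∂(m n : Measure (X d))
          ≤ ∫⁻ z, (ENNReal.ofReal (ψ (u n z)) + ENNReal.ofReal D) ∂(m n : Measure (X d)) :=
            lintegral_mono fun z => hnormE _
        _ = ∫⁻ z, ENNReal.ofReal (ψ (u n z)) ∂(m n : Measure (X d)) + ENNReal.ofReal D := by
            rw [lintegral_add_right _ measurable_const]; simp
        _ ≤ _ := by gcongr; exact hcost n)
  have hfst : (a : Measure (X d × U)).fst = m' := by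
    have h1 := ProbabilityMeasure.tendsto_map_of_tendsto_of_continuous _ _ hka
      (continuous_fst (X := X d) (Y := U))
    have h2 : ∀ n, (γ n).map continuous_fst.measurable.aemeasurable = m n := fun n => by
      refine Subtype.ext ?_
      change ((m n : Measure (X d)).map fun z => (z, u n z)).map Prod.fst = _
      rw [AEMeasurable.map_map_of_aemeasurable measurable_fst.aemeasurable (hgm n)]
      exact Measure.map_id
    simp only [h2] at h1
    have h3 : a.map continuous_fst.measurable.aemeasurable = m' :=
      tendsto_nhds_unique h1 (hm.comp hk.tendsto_atTop)
    exact congrArg Subtype.val h3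
  have hlsc : ∫⁻ w, ENNReal.ofReal (ψ w.2) ∂(a : Measure (X d × U)) ≤
      liminf (fun n => ∫⁻ z, ENNReal.ofReal (ψ (u (k n) z)) ∂(m (k n) : Measure (X d))) atTop := by
    have hc : Continuous fun w : X d × U => ENNReal.ofReal (ψ w.2) :=
      ENNReal.continuous_ofReal.comp (hψ.continuous.comp continuous_snd)
    refine (lintegral_le_liminf_of_lowerSemicontinuous hka hc.lowerSemicontinuous).trans ?_
    simp only [γl _ _ hc.measurable, le_refl]
  have hle : ∫⁻ w, ENNReal.ofReal (ψ w.2) ∂(a : Measure (X d × U)) ≤ ENNReal.ofReal B := by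
    refine (hlsc.trans (liminf_le_liminf (v := fun _ => ENNReal.ofReal B)
      (Eventually.of_forall fun n => hcost (k n)))).trans ?_
    simp
  have hψ2 : Continuous fun w : X d × U => ψ w.2 := hψ.continuous.comp continuous_snd
  have hai : Integrable (fun w : X d × U => ψ w.2) (a : Measure (X d × U)) :=
    ⟨hψ2.aestronglyMeasurable, by
      rw [hasFiniteIntegral_iff_ofReal (ae_of_all _ fun w => hψ.nonneg _)]
      exact hle.trans_lt ENNReal.ofReal_lt_top⟩
  have hB0 : 0 ≤ B := (integral_nonneg fun z => hψ.nonneg _).trans (hB 0).2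
  have haB : ∫ w, ψ w.2 ∂(a : Measure (X d × U)) ≤ B := by
    rw [← ENNReal.ofReal_le_ofReal_iff hB0, ofReal_integral_eq_lintegral_ofReal hai
      (ae_of_all _ fun w => hψ.nonneg _)]
    exact hle
  obtain ⟨u', hu', hcost', hpair⟩ := exists_barycentre hψ (a : Measure (X d × U)) hai
  rw [hfst] at hu' hcost'
  refine ⟨u', k, hk, hu', hcost'.trans hlsc, fun g C hg hC => ?_⟩
  have hgc : Continuous fun w : X d × U => ⟪g w.1, (w.2 : E d)⟫ := by fun_prop
  -- The pairing is unbounded in the control variable, but superlinearity dominates it by small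
  -- multiples of ψ.
  have hlim := tendsto_integral_of_dominated hka hgc (c := fun w => ψ w.2)
    (fun w => hψ.nonneg _) (B := B) (fun ε hε => ?_) (fun n => ⟨?_, ?_⟩) ⟨hai, haB⟩
  · rw [hpair g C hg hC, hfst] at hlim
    simpa only [γi _ _ hgc] using hlim
  · obtain ⟨D', hD', h'⟩ := hψ.exists_norm_le (ε := ε / (|C| + 1)) (by positivity)
    refine ⟨|C| * D', by positivity, fun w => ?_⟩
    have h1 : |⟪g w.1, (w.2 : E d)⟫| ≤ |C| * ‖w.2‖ := (abs_real_inner_le_norm _ _).trans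
      (mul_le_mul_of_nonneg_right ((hC _).trans (le_abs_self C)) (norm_nonneg _))
    have h2 := mul_le_mul_of_nonneg_left (h' w.2) (abs_nonneg C)
    have h3 : |C| * (ε / (|C| + 1)) ≤ ε := by
      rw [mul_div_assoc', div_le_iff₀ (by positivity)]
      nlinarith [abs_nonneg C]
    have h4 := mul_le_mul_of_nonneg_right h3 (hψ.nonneg w.2)
    linarith
  · exact (integrable_map_measure hψ2.aestronglyMeasurable (hgm (k n))).2 (hB (k n)).1
  · rw [γi _ _ hψ2]
    exact (hB (k n)).2

/-- Confines the drift term to a ball, where a drift of linear growth is bounded. -/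
theorem exists_gradient_eq_zero {φ : E d × ℝ → ℝ} (hφ : ContDiff ℝ (⊤ : ℕ∞) φ)
    (hc : HasCompactSupport φ) :
    ∃ ρ, ∀ z : X d, ρ < ‖z.1‖ → gradient (fun x => φ (x, (z.2 : ℝ))) z.1 = 0 := by
  obtain ⟨ρ, hρ⟩ := hc.isCompact.isBounded.subset_closedBall 0
  refine ⟨ρ, fun z hz => ?_⟩
  have h : (z.1, (z.2 : ℝ)) ∉ tsupport φ := fun hmem => by
    have h1 := hρ hmem
    rw [mem_closedBall_zero_iff] at h1
    exact absurd ((norm_fst_le (z.1, (z.2 : ℝ))).trans h1) (not_le.2 hz)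
  rw [← norm_eq_zero, norm_gradient, fderiv_space_eq hφ, fderiv_of_notMem_tsupport ℝ h]
  simp

/-- The drift term of the continuity equation passes to the limit. -/
theorem CurveTendsto.tendsto_integral_drift {F : E d → P1 d → E d} (hF : IsDrift F)
    {μ : ℕ → Curve d} {μ' : Curve d} (h : CurveTendsto μ μ') {g : X d → E d} (hg : Continuous g)
    {C ρ : ℝ} (hC : ∀ z, ‖g z‖ ≤ C) (hρ : ∀ z, ρ < ‖z.1‖ → g z = 0) :
    Tendsto (fun n => ∫ z, ⟪g z, F z.1 (μ n z.2)⟫ ∂(μ n).spaceTime) atTop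
      (𝓝 (∫ z, ⟪g z, F z.1 (μ' z.2)⟫ ∂μ'.spaceTime)) := by
  have hC0 : 0 ≤ C := (norm_nonneg _).trans (hC 0)
  obtain ⟨M, hM, hmom⟩ := μ'.exists_moment_le
  obtain ⟨c, hc, hFc⟩ := hF.exists_norm_le M hM
  have hFcont := hF.continuous μ'
  have hcont : Continuous fun z : X d => ⟪g z, F z.1 (μ' z.2)⟫ := hg.inner hFcont
  have hb : ∀ z : X d, |⟪g z, F z.1 (μ' z.2)⟫| ≤ C * (c * (1 + |ρ|)) := by
    intro z
    rcases lt_or_ge ρ ‖z.1‖ with hz | hz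
    · rw [hρ z hz]
      simp only [inner_zero_left, abs_zero]
      positivity
    · refine (abs_real_inner_le_norm _ _).trans
        (mul_le_mul (hC z) ((hFc _ _ (hmom _)).trans (mul_le_mul_of_nonneg_left
          ((bracket_le _).trans ?_) hc)) (norm_nonneg _) hC0)
      linarith [le_abs_self ρ]
  -- With the measure argument frozen at the limit curve the integrand is bounded and continuous.
  -- Unfreezing it (`l2`) costs a uniformly small amount, by uniform continuity of F at the same
  -- point y.
  have l1 := tendsto_integral_of_bounded h.tendsto_toProb hcont hb
  have l2 : Tendsto (fun n => ∫ z, ⟪g z, F z.1 (μ n z.2)⟫ ∂(μ n).spaceTime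
      - ∫ z, ⟪g z, F z.1 (μ' z.2)⟫ ∂(μ n).spaceTime) atTop (𝓝 0) := by
    rw [Metric.tendsto_atTop']
    intro ε hε
    obtain ⟨δ, hδ, hmod⟩ := hF.uniformContinuous (ε / (C + 1)) (by positivity)
    obtain ⟨N, hN⟩ := eventually_atTop.1 (h.eventually hδ)
    refine ⟨N, fun n hn => ?_⟩
    have i1 := integrable_inner_of_bound hg hC (hF.integrable (μ n))
    have i2 : Integrable (fun z : X d => ⟪g z, F z.1 (μ' z.2)⟫) (μ n).spaceTime :=
      Integrable.of_bound hcont.aestronglyMeasurable _ (ae_of_all _ hb)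
    rw [dist_zero_right, ← MeasureTheory.integral_sub i1 i2]
    refine (norm_integral_le_of_norm_le_const (C := C * (ε / (C + 1)))
      (ae_of_all _ fun z => ?_)).trans_lt ?_
    · rw [← inner_sub_right]
      refine (norm_inner_le_norm _ _).trans (mul_le_mul (hC z) ?_ (norm_nonneg _) hC0)
      rw [← dist_eq_norm]
      exact (hmod _ _ _ _ (by simpa using hδ) (hN n hn.le z.2)).le
    · rw [probReal_univ, mul_one, mul_div_assoc', div_lt_iff₀ (by positivity)]
      nlinarith
  have l3 := l2.add l1
  simp only [Curve.coe_toProb, sub_add_cancel, zero_add] at l3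
  exact l3

/-- The continuity equation passes to the limit. -/
theorem CurveTendsto.transportedBy {U : Submodule ℝ (E d)} {F : E d → P1 d → E d} (hF : IsDrift F)
    {μ : ℕ → Curve d} {μ' : Curve d} (h : CurveTendsto μ μ') {u : ℕ → X d → U} {u' : X d → U}
    (hu : ∀ n, Integrable (u n) (μ n).spaceTime) (hu' : Integrable u' μ'.spaceTime)
    (hlim : ∀ (g : X d → E d) (C : ℝ), Continuous g → (∀ z, ‖g z‖ ≤ C) →
      Tendsto (fun n => ∫ z, ⟪g z, (u n z : E d)⟫ ∂(μ n).spaceTime) atTop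
        (𝓝 (∫ z, ⟪g z, (u' z : E d)⟫ ∂μ'.spaceTime)))
    (ht : ∀ n, TransportedBy (μ n) fun z => F z.1 (μ n z.2) + (u n z : E d)) :
    TransportedBy μ' fun z => F z.1 (μ' z.2) + (u' z : E d) := by
  have hui : ∀ {m : Measure (X d)} {v : X d → U}, Integrable v m →
      Integrable (fun z => (v z : E d)) m := fun hv => U.subtypeL.integrable_comp hv
  refine ⟨(hF.integrable μ').add (hui hu'), fun φ hφ hc hs => ?_⟩
  obtain ⟨C, -, hC⟩ := exists_bound_test hφ hc
  obtain ⟨ρ, hρ⟩ := exists_gradient_eq_zero hφ hc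
  have c1 := continuous_deriv_time (d := d) hφ
  have c2 := continuous_gradient_space (d := d) hφ
  have split : ∀ (m : Curve d) (v : X d → U), Integrable v m.spaceTime →
      ∫ z, (deriv (fun s : ℝ => φ (z.1, s)) (z.2 : ℝ)
        + ⟪gradient (fun x => φ (x, (z.2 : ℝ))) z.1, F z.1 (m z.2) + (v z : E d)⟫) ∂m.spaceTime
      = ∫ z : X d, deriv (fun s : ℝ => φ (z.1, s)) (z.2 : ℝ) ∂m.spaceTime
        + (∫ z : X d, ⟪gradient (fun x => φ (x, (z.2 : ℝ))) z.1, F z.1 (m z.2)⟫ ∂m.spaceTime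
        + ∫ z : X d, ⟪gradient (fun x => φ (x, (z.2 : ℝ))) z.1, (v z : E d)⟫ ∂m.spaceTime) := by
    intro m v hv
    have i1 : Integrable (fun z : X d => deriv (fun s => φ (z.1, s)) (z.2 : ℝ)) m.spaceTime :=
      Integrable.of_bound c1.aestronglyMeasurable C (ae_of_all _ fun z => (hC z).1)
    have i2 := integrable_inner_of_bound c2 (fun z => (hC z).2) (hF.integrable m)
    have i3 := integrable_inner_of_bound c2 (fun z => (hC z).2) (hui hv)
    rw [← integral_add i2 i3, ← integral_add i1 (by exact i2.add i3)]
    simp only [inner_add_right]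
  have l1 := tendsto_integral_of_bounded h.tendsto_toProb c1 fun z => (hC z).1
  have l2 := h.tendsto_integral_drift hF c2 (fun z => (hC z).2) hρ
  have l3 := hlim _ C c2 fun z => (hC z).2
  have l4 := l1.add (l2.add l3)
  simp only [Curve.coe_toProb] at l4
  rw [← split μ' u' hu'] at l4
  refine tendsto_nhds_unique l4 (tendsto_const_nhds.congr fun n => ?_)
  rw [← split (μ n) (u n) (hu n)]
  exact ((ht n).2 φ hφ hc hs).symm

/-- The state cost is lower semicontinuous for uniform convergence of curves. -/
theorem CurveTendsto.lintegral_stateCost_le {L : E d → P1 d → ℝ≥0∞} (hL : IsStateCost L)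
    {μ : ℕ → Curve d} {μ' : Curve d} (h : CurveTendsto μ μ') :
    ∫⁻ t : unitInterval, ∫⁻ y, L y (μ' t) ∂(μ' t).toMeasure ≤
      liminf (fun n => ∫⁻ t : unitInterval, ∫⁻ y, L y (μ n t) ∂(μ n t).toMeasure) atTop := by
  have key : ∀ f : X d → ℝ≥0∞, LowerSemicontinuous f →
      ∫⁻ t : unitInterval, ∫⁻ y, f (y, t) ∂(μ' t).toMeasure ≤
        liminf (fun n => ∫⁻ t : unitInterval, ∫⁻ y, f (y, t) ∂(μ n t).toMeasure) atTop := by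
    intro f hf
    have hm : Measurable f := measurable_of_Ioi fun y => (hf.isOpen_preimage y).measurableSet
    simp only [← Curve.lintegral_spaceTime _ hm]
    exact lintegral_le_liminf_of_lowerSemicontinuous h.tendsto_toProb hf
  rcases hL with ⟨hfin, huc⟩ | ⟨hind, hcont⟩
  · have hc : Continuous fun z : X d => L z.1 (μ' z.2) := by
      have hr : Continuous fun z : X d => (L z.1 (μ' z.2)).toReal := by
        rw [continuous_iff_continuousAt]
        intro z
        rw [ContinuousAt, Metric.tendsto_nhds]
        intro ε hε
        obtain ⟨δ, hδ, hmod⟩ := huc ε hε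
        have h1 : ∀ᶠ w : X d in 𝓝 z, dist w.1 z.1 < δ :=
          continuous_fst.continuousAt.eventually (Metric.ball_mem_nhds _ hδ)
        have h2 : ∀ᶠ w : X d in 𝓝 z, W1 (μ' w.2) (μ' z.2) < ENNReal.ofReal δ :=
          continuous_snd.continuousAt.eventually
            ((μ'.continuous_W1 z.2).eventually (gt_mem_nhds (ENNReal.ofReal_pos.2 hδ)))
        filter_upwards [h1, h2] with w hw1 hw2 using hmod _ _ _ _ hw1 hw2
      refine (ENNReal.continuous_ofReal.comp hr).congr fun z => ENNReal.ofReal_toReal (hfin _ _)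
    -- The same freezing as for the drift: L along the limit curve is continuous, and replacing μ'
    -- by μ_n changes it by less than ε uniformly.
    refine ENNReal.le_of_forall_pos_le_add fun ε hε _ => ?_
    obtain ⟨δ, hδ, hmod⟩ := huc ε hε
    refine (key _ hc.lowerSemicontinuous).trans ?_
    rw [← liminf_add_const atTop _ (ε : ℝ≥0∞) (by isBoundedDefault) (by isBoundedDefault)]
    refine liminf_le_liminf ?_
    filter_upwards [h.eventually hδ] with n hn
    calc ∫⁻ t : unitInterval, ∫⁻ y, L y (μ' t) ∂(μ n t).toMeasure
        ≤ ∫⁻ t : unitInterval, ∫⁻ y, (L y (μ n t) + ε) ∂(μ n t).toMeasure := by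
          refine lintegral_mono fun t => lintegral_mono fun y => ?_
          have h1 := (abs_lt.1 (hmod y y (μ n t) (μ' t) (by simpa using hδ) (hn t))).1
          rw [← ENNReal.ofReal_toReal (hfin y (μ' t)), ← ENNReal.ofReal_toReal (hfin y (μ n t)),
            ← ENNReal.ofReal_coe_nnreal, ← ENNReal.ofReal_add ENNReal.toReal_nonneg ε.coe_nonneg]
          exact ENNReal.ofReal_le_ofReal (by linarith)
      _ = _ := by
          simp only [lintegral_add_right _ measurable_const, lintegral_const, measure_univ, mul_one]
  -- `μ' 0` is an arbitrary representative. Near a point of infinite cost L stays infinite; near a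
  -- point of finite cost it is either close, by relative continuity, or infinite.
  · have hlsc : LowerSemicontinuous fun y => L y (μ' 0) := by
      intro y r hr
      by_cases hy : L y (μ' 0) = ∞
      · filter_upwards [(hcont (μ' 0)).1.mem_nhds hy] with x hx
        have hx' : L x (μ' 0) = ∞ := hx
        rw [hx', ← hy]
        exact hr
      · have h1 := (hcont (μ' 0)).2 y (lt_top_iff_ne_top.2 hy)
        have h2 := h1.eventually (lt_mem_nhds hr)
        rw [eventually_nhdsWithin_iff] at h2
        filter_upwards [h2] with x hx
        by_cases hx' : L x (μ' 0) < ∞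
        · exact hx hx'
        · rw [not_lt_top_iff.1 hx']
          exact hr.trans_le le_top
    have h1 := key (fun z => L z.1 (μ' 0)) (hlsc.comp continuous_fst)
    have h2 : ∀ (m : Curve d), ∫⁻ t : unitInterval, ∫⁻ y, L y (μ' 0) ∂(m t).toMeasure
        = ∫⁻ t : unitInterval, ∫⁻ y, L y (m t) ∂(m t).toMeasure := fun m =>
      lintegral_congr fun t => lintegral_congr fun y => hind _ _ _
    simpa only [h2] using h1

/-- Infima over the tails from i and from j are both at most the values at `max i j`. This joins the
separate semicontinuity of the two costs. -/
theorem liminf_add_liminf_le {u v : ℕ → ℝ≥0∞} {c : ℝ≥0∞} (h : ∀ n, u n + v n ≤ c) :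
    liminf u atTop + liminf v atTop ≤ c := by
  rw [liminf_eq_iSup_iInf_of_nat, liminf_eq_iSup_iInf_of_nat]
  exact ENNReal.iSup_add_iSup_le fun i j =>
    (add_le_add (iInf₂_le (max i j) (le_max_left i j)) (iInf₂_le (max i j) (le_max_right i j))).trans
      (h _)

/-- Pairs of finite cost are given by controls of bounded cost. -/
theorem Admissible.exists_controlled {U : Submodule ℝ (E d)} {F : E d → P1 d → E d}
    (hF : IsDrift F) {ψ : U → ℝ} (hψ : IsControlCost U ψ) {m₀ : P1 d} {μ : Curve d}
    {ν : VectorMeasure (X d) U} (h : Admissible F m₀ μ ν) {B : ℝ≥0∞} (hB : B ≠ ∞)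
    (hP : Psi ψ ν μ ≤ B) : ∃ u, IsDensity ν μ u ∧ Controlled F ψ m₀ B.toReal μ u := by
  by_cases hu : ∃ u, IsDensity ν μ u
  · obtain ⟨u, hu⟩ := hu
    rw [Psi_eq ψ ν μ u hu] at hP
    have hn : ∀ z, 0 ≤ ψ (u z) := fun z => hψ.nonneg _
    have hm : AEStronglyMeasurable (fun z => ψ (u z)) μ.spaceTime :=
      hψ.continuous.comp_aestronglyMeasurable hu.1.1
    refine ⟨u, hu, hu.1, (solvesContinuityEquation_iff hF hu).1 h.solves, h.initial, ⟨hm, ?_⟩, ?_⟩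
    · rw [hasFiniteIntegral_iff_ofReal (ae_of_all _ hn)]
      exact hP.trans_lt hB.lt_top
    · rw [integral_eq_lintegral_of_nonneg_ae (ae_of_all _ hn) hm]
      exact ENNReal.toReal_mono hB hP
  · rw [Psi_eq_top ψ ν μ hu] at hP
    exact absurd (top_le_iff.1 hP) hB

end MFC

/-! ### The compactness and lower semicontinuity lemma -/

theorem lemma3p2 {d : ℕ} (m₀ : MFC.P1 d) (U : Submodule ℝ (MFC.E d))
    (L : MFC.E d → MFC.P1 d → ℝ≥0∞) (hL : MFC.IsStateCost L)
    (ψ : U → ℝ) (hψ : MFC.IsControlCost U ψ)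
    (F : MFC.E d → MFC.P1 d → MFC.E d) (hF : MFC.IsDrift F)
    (μ : ℕ → MFC.Curve d) (ν : ℕ → VectorMeasure (MFC.X d) U)
    (hC : ∀ n, MFC.Admissible F m₀ (μ n) (ν n))
    (hG : ⨆ n, MFC.G ψ L (μ n) (ν n) < ∞) :
    ∃ (μ' : MFC.Curve d) (ν' : VectorMeasure (MFC.X d) U) (k : ℕ → ℕ),
      StrictMono k ∧
      MFC.Admissible F m₀ μ' ν' ∧
      MFC.CurveTendsto (fun n => μ (k n)) μ' ∧
      MFC.NarrowTendsto (fun n => ν (k n)) ν' ∧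
      MFC.G ψ L μ' ν' ≤ ⨆ n, MFC.G ψ L (μ n) (ν n) := by
  set S := ⨆ n, MFC.G ψ L (μ n) (ν n) with hS
  have hGS : ∀ n, MFC.G ψ L (μ n) (ν n) ≤ S := fun n => le_iSup (fun n => MFC.G ψ L (μ n) (ν n)) n
  choose u hu hcon using fun n =>
    (hC n).exists_controlled hF hψ hG.ne (le_self_add.trans (hGS n))
  obtain ⟨M, hM, hMb⟩ := MFC.exists_moment_bound hF hψ m₀ S.toReal
  obtain ⟨μ', k₁, hk₁, hμ'⟩ := MFC.exists_subseq_curveTendsto μ (M := M)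
    (fun n t => hMb _ _ (hcon n) t)
    (fun ε hε => by
      obtain ⟨R, hR, h⟩ := MFC.exists_tail_bound hF hψ m₀ S.toReal hε
      exact ⟨R, hR, fun n t => h _ _ (hcon n) t⟩)
    (fun ε hε => by
      obtain ⟨δ, hδ, h⟩ := MFC.exists_modulus hF hψ m₀ S.toReal hε
      exact ⟨δ, hδ, fun n s t => h _ _ (hcon n) s t⟩)
  have hmom : ∀ n, ∫⁻ z, ‖z.1‖ₑ ∂(μ n).spaceTime ≤ ENNReal.ofReal M := by
    intro n
    rw [MFC.Curve.lintegral_spaceTime _ (by fun_prop)]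
    calc _ ≤ ∫⁻ _ : unitInterval, ENNReal.ofReal M := lintegral_mono fun t => by
          have hi := (μ n t).integrable_norm
          have h1 : ∫⁻ y, ‖y‖ₑ ∂(μ n t).toMeasure
              = ENNReal.ofReal (∫ y, ‖y‖ ∂(μ n t).toMeasure) := by
            rw [ofReal_integral_eq_lintegral_ofReal hi (ae_of_all _ fun y => norm_nonneg y)]
            simp
          simp only
          rw [h1]
          exact ENNReal.ofReal_le_ofReal ((integral_mono hi
            ((μ n t).integrable_of_lipschitz MFC.lipschitz_bracket) MFC.norm_le_bracket).trans
              (hMb _ _ (hcon n) t))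
      _ = _ := by simp
  obtain ⟨u', k₂, hk₂, hu', hcost, hlim⟩ := MFC.exists_limit_control hψ hμ'.tendsto_toProb
    (M := M) (fun n => hmom (k₁ n)) (u := fun n => u (k₁ n)) (fun n => (hu (k₁ n)).1)
    (B := S.toReal) fun n => ⟨(hcon (k₁ n)).integrable_cost, (hcon (k₁ n)).cost_le⟩
  simp only [MFC.Curve.coe_toProb] at hu' hcost hlim
  have hμk : MFC.CurveTendsto (fun n => μ (k₁ (k₂ n))) μ' :=
    (show Tendsto (fun n => ⨆ t, MFC.W1 (μ (k₁ n) t) (μ' t)) atTop (𝓝 0) from hμ').comp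
      hk₂.tendsto_atTop
  -- The limit vector measure is defined by its density, so its cost is that of u' and its pairings
  -- are those controlled by `hlim`.
  have hν' : MFC.IsDensity (μ'.spaceTime.withDensityᵥ u') μ' u' := ⟨hu', rfl⟩
  have htr := hμk.transportedBy hF (u := fun n => u (k₁ (k₂ n))) (fun n => (hu _).1) hu' hlim
    fun n => (hcon _).transported
  refine ⟨μ', μ'.spaceTime.withDensityᵥ u', k₁ ∘ k₂, hk₁.comp hk₂,
    ⟨htr.isAC, (MFC.solvesContinuityEquation_iff hF hν').2 htr, ?_⟩, hμk, ?_, ?_⟩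
  · have h0 := hμk.tendsto_apply 0
    simp only [(hC _).initial] at h0
    exact tendsto_nhds_unique h0 tendsto_const_nhds |>.symm ▸ rfl
  · rintro f hf ⟨B, hB⟩
    have hfc : Continuous fun z => (f z : MFC.E d) := continuous_subtype_val.comp hf
    have hd : ∀ (m : MFC.Curve d) (v : MFC.X d → U), Integrable v m.spaceTime →
        MFC.dotIntegral (m.spaceTime.withDensityᵥ v) (fun z => (f z : MFC.E d))
          = ∫ z, ⟪(f z : MFC.E d), (v z : MFC.E d)⟫ ∂m.spaceTime := fun m v hv =>
      MFC.dotIntegral_withDensity _ hv hfc.stronglyMeasurable hB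
    rw [hd _ _ hu']
    refine (hlim _ B hfc hB).congr fun n => ?_
    rw [← hd _ _ (hu _).1, ← (hu _).2]
    rfl
  · rw [MFC.G, MFC.Psi_eq ψ _ _ u' hν']
    refine (add_le_add hcost (hμk.lintegral_stateCost_le hL)).trans
      (MFC.liminf_add_liminf_le fun n => ?_)
    refine le_trans (le_of_eq ?_) (hGS (k₁ (k₂ n)))
    rw [MFC.G, MFC.Psi_eq ψ _ _ _ (hu _)]
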